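/- **Setting.** Let $\alpha:R\to A$ and $\beta:S\to B$ be homomorphisms of unital associative rings; $A$-modules (resp. $B$-modules) are regarded as $R$-modules (resp. $S$-modules) along $\alpha$ (resp. $\beta$). A *$B$-$A$ herd* consists of a $B$-$A$ bimodule $T$; an $A$-$B$ bimodule $\widehat T$ with an $A$-bimodule map $\mathrm{ev}:\widehat T\otimes_S T\to A$ and a $B$-bimodule map $\widehat{\mathrm{ev}}:T\otimes_R\widehat T\to B$ such that $\widehat{\mathrm{ev}}(x\otimes\hat x)\,y=x\,\mathrm{ev}(\hat x\otimes y)$ and $\hat x\,\widehat{\mathrm{ev}}(x\otimes\hat y)=\mathrm{ev}(\hat x\otimes x)\,\hat y$ for $x,y\in T$, $\hat x,\hat y\in\widehat T$; and an $S$-$R$ bimodule map $\gamma:T\to T\otimes_R\widehat T\otimes_S T$, written $\gamma(x)=x^{(1)}\otimes x^{(2)}\otimes x^{(3)}$, such that $\widehat{\mathrm{ev}}(x^{(1)}\otimes x^{(2)})\otimes x^{(3)}=1_B\otimes x$ in $B\otimes_S T$, $x^{(1)}\otimes \mathrm{ev}(x^{(2)}\otimes x^{(3)})=x\otimes 1_A$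 in $T\otimes_R A$, and $(\gamma\otimes_R\widehat T\otimes_S T)\circ\gamma=(T\otimes_R\widehat T\otimes_S\gamma)\circ\gamma$. Put $$C=\Big\{\sum_i\hat x_i\otimes x_i\in\widehat T\otimes_S T:\ \sum_i\mathrm{ev}(\hat x_i\otimes x_i^{(1)})\otimes x_i^{(2)}\otimes x_i^{(3)}=\sum_i 1_A\otimes\hat x_i\otimes x_i\ \text{ in } A\otimes_R\widehat T\otimes_S T\Big\},$$ $$D=\Big\{\sum_i x_i\otimes\hat x_i\in T\otimes_R\widehat T:\ \sum_i x_i^{(1)}\otimes x_i^{(2)}\otimes\widehat{\mathrm{ev}}(x_i^{(3)}\otimes\hat x_i)=\sum_i x_i\otimes\hat x_i\otimes 1_B\ \text{ in } T\otimes_R\widehat T\otimes_S B\Big\};$$ these are an $R$-bimodule and an $S$-bimodule, respectively. A ring map $K\to L$ is a *split extension* if it has a retraction that is a $K$-bimodule map. For an $R$-coring $C$, an *entwining* of $C$ with $A$ over $R$ is an $R$-bimodule map $\psi:C\otimes_R A\to A\otimes_R C$ compatible with the multiplication and unit of $A$ and the coproduct and counit of $C$, i.e. (with $\mu$ the multiplication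 of $A$) $$\psi\circ(C\otimes\mu)=(\mu\otimes C)\circ(A\otimes\psi)\circ(\psi\otimes A),\qquad \psi(c\otimes 1_A)=1_A\otimes c,$$ $$(A\otimes\Delta_C)\circ\psi=(\psi\otimes C)\circ(C\otimes\psi)\circ(\Delta_C\otimes A),\qquad (A\otimes\varepsilon_C)\circ\psi=\varepsilon_C\otimes A;$$ a *right $(A,C,\psi)_R$-entwined module* is a right $A$-module $M$ that is a right $C$-comodule, $\rho(m)=m_{[0]}\otimes m_{[1]}$, with $\rho(ma)=m_{[0]}\psi(m_{[1]}\otimes a)$. An entwining $\varphi:B\otimes_S D\to D\otimes_S B$ and left $(B,D,\varphi)_S$-entwined modules are defined symmetrically. **Theorem.** Let $(T,\widehat T,\gamma)$ be a $B$-$A$ herd. (1) Assume that (i) $T$ is a faithfully flat right $R$-module and $A$ is a faithfully flat right (or left) $R$-module, or (ii) $\alpha$ is a split extension. Then the canonical maps $C\otimes_R C\to(\widehat T\otimes_S T)\otimes_R(\widehat T\otimes_S T)$, $A\otimes_R C\to A\otimes_R\widehat T\otimes_S T$ and $T\otimes_R C\to T\otimes_R\widehat T\otimes_S T$ are injective,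 and, identifying their sources with their images: (a) $C$ is an $R$-coring with coproduct $\Delta_C\big(\sum_i\hat x_i\otimes x_i\big)=\sum_i\hat x_i\otimes\gamma(x_i)\in C\otimes_R C$ and counit $\varepsilon_C=\mathrm{ev}|_C$, i.e. $\alpha\circ\varepsilon_C=\mathrm{ev}|_C$. (b) $C$ is entwined with $A$ over $R$ by $\psi:C\otimes_R A\to A\otimes_R C$, $$\psi\Big(\sum_i\hat x_i\otimes x_i\otimes a\Big)=\sum_i\mathrm{ev}\big(\hat x_i\otimes(x_ia)^{(1)}\big)\otimes(x_ia)^{(2)}\otimes(x_ia)^{(3)}.$$ (c) $T$ is a right $(A,C,\psi)_R$-entwined module with coaction $\gamma$. (2) Assume that (i) $T$ is a faithfully flat left $S$-module and $B$ is a faithfully flat left (or right) $S$-module, or (ii) $\beta$ is a split extension. Then the canonical maps $D\otimes_S D\to(T\otimes_R\widehat T)\otimes_S(T\otimes_R\widehat T)$, $D\otimes_S B\to T\otimes_R\widehat T\otimes_S B$ and $D\otimes_S T\to T\otimes_R\widehat T\otimes_S T$ are injective, and, identifying their sources with their images: (a) $D$ is an $S$-coring with coproduct $\Delta_D\big(\sum_i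 x_i\otimes\hat x_i\big)=\sum_i\gamma(x_i)\otimes\hat x_i\in D\otimes_S D$ and counit $\varepsilon_D=\widehat{\mathrm{ev}}|_D$, i.e. $\beta\circ\varepsilon_D=\widehat{\mathrm{ev}}|_D$. (b) $B$ is entwined with $D$ over $S$ by $\varphi:B\otimes_S D\to D\otimes_S B$, $$\varphi\Big(\sum_i b\otimes x_i\otimes\hat x_i\Big)=\sum_i(bx_i)^{(1)}\otimes(bx_i)^{(2)}\otimes\widehat{\mathrm{ev}}\big((bx_i)^{(3)}\otimes\hat x_i\big).$$ (c) $T$ is a left $(B,D,\varphi)_S$-entwined module with coaction $\gamma$. -/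

import Mathlib

open MulOpposite

universe u

noncomputable section

namespace BimoduleHerd

/-! Right modules over a ring `K` are modules over `Kᵐᵒᵖ`; a `K`-`L` bimodule has commuting actions
of `K` and `Lᵐᵒᵖ`. A module over `A` is regarded as a module over `R` along a ring map `R →+* A`,
and this ring map is always written out. -/

section Linearity

variable {R K K' M M' : Type*} [Ring R] [Ring K] [Ring K'] [AddCommGroup M] [AddCommGroup M']

/-- `f` is left `R`-linear, `R` acting along `σ` on the source and along `σ'` on the target. -/
def LeftLin (σ : R →+* K) (σ' : R →+* K') [Module K M] [Module K' M'] (f : M →+ M') : Prop :=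
  ∀ (r : R) (m : M), f (σ r • m) = σ' r • f m

/-- `f` is right `R`-linear, `R` acting along `ρ` on the source and along `ρ'` on the target. -/
def RightLin (ρ : R →+* K) (ρ' : R →+* K') [Module Kᵐᵒᵖ M] [Module K'ᵐᵒᵖ M'] (f : M →+ M') :
    Prop :=
  ∀ (r : R) (m : M), f (op (ρ r) • m) = op (ρ' r) • f m

theorem leftLin_id (σ : R →+* K) [Module K M] : LeftLin σ σ (AddMonoidHom.id M) :=
  fun _ _ => rfl

theorem rightLin_id (ρ : R →+* K) [Module Kᵐᵒᵖ M] : RightLin ρ ρ (AddMonoidHom.id M) :=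
  fun _ _ => rfl

end Linearity

section Tensor

variable {R A₁ A₂ : Type*} [Ring R] [Ring A₁] [Ring A₂]

/-- The relations `m r ⊗ n - m ⊗ r n`. -/
def tensRel (ρ : R →+* A₁) (σ : R →+* A₂) (M N : Type*) [AddCommGroup M] [AddCommGroup N]
    [Module A₁ᵐᵒᵖ M] [Module A₂ N] : AddSubgroup (TensorProduct ℤ M N) :=
  AddSubgroup.closure {z | ∃ (r : R) (m : M) (n : N),
    z = TensorProduct.tmul ℤ (op (ρ r) • m) n - TensorProduct.tmul ℤ m (σ r • n)}

/-- The tensor product `M ⊗_R N` of a right and a left module over a (noncommutative) ring `R`,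
where `R` acts on the right `A₁`-module `M` along `ρ` and on the left `A₂`-module `N` along `σ`. -/
def Tens (ρ : R →+* A₁) (σ : R →+* A₂) (M N : Type*) [AddCommGroup M] [AddCommGroup N]
    [Module A₁ᵐᵒᵖ M] [Module A₂ N] : Type _ :=
  TensorProduct ℤ M N ⧸ tensRel ρ σ M N

namespace Tens

variable (ρ : R →+* A₁) (σ : R →+* A₂) {M N : Type*} [AddCommGroup M] [AddCommGroup N]
  [Module A₁ᵐᵒᵖ M] [Module A₂ N]

instance : AddCommGroup (Tens ρ σ M N) :=
  inferInstanceAs (AddCommGroup (TensorProduct ℤ M N ⧸ tensRel ρ σ M N))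

/-- The simple tensor `m ⊗_R n`. -/
def tmul (m : M) (n : N) : Tens ρ σ M N :=
  QuotientAddGroup.mk' (tensRel ρ σ M N) (TensorProduct.tmul ℤ m n)

theorem tmul_add_left (m m' : M) (n : N) : tmul ρ σ (m + m') n = tmul ρ σ m n + tmul ρ σ m' n := by
  simp only [tmul, TensorProduct.add_tmul, map_add]; rfl

theorem tmul_add_right (m : M) (n n' : N) : tmul ρ σ m (n + n') = tmul ρ σ m n + tmul ρ σ m n' := by
  simp only [tmul, TensorProduct.tmul_add, map_add]; rfl

theorem zero_tmul (n : N) : tmul ρ σ (0 : M) n = 0 := by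
  simpa using tmul_add_left ρ σ (0 : M) 0 n

theorem tmul_zero (m : M) : tmul ρ σ m (0 : N) = 0 := by
  simpa using tmul_add_right ρ σ m (0 : N) 0

theorem tmul_bal (r : R) (m : M) (n : N) : tmul ρ σ (op (ρ r) • m) n = tmul ρ σ m (σ r • n) := by
  refine (QuotientAddGroup.eq_iff_sub_mem).2 ?_
  exact AddSubgroup.subset_closure ⟨r, m, n, rfl⟩

variable {ρ σ}

/-- The additive map on `M ⊗_R N` given by a balanced biadditive map. -/
def lift {P : Type*} [AddCommGroup P] (f : M → N → P)
    (h₁ : ∀ m m' n, f (m + m') n = f m n + f m' n)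
    (h₂ : ∀ m n n', f m (n + n') = f m n + f m n')
    (h : ∀ r m n, f (op (ρ r) • m) n = f m (σ r • n)) : Tens ρ σ M N →+ P :=
  let F : M →+ N →+ P :=
    AddMonoidHom.mk' (fun m => AddMonoidHom.mk' (f m) (h₂ m)) fun m m' => by ext n; exact h₁ m m' n
  let G : TensorProduct ℤ M N →+ P := TensorProduct.liftAddHom F fun r m n => by
    simp only [map_zsmul, AddMonoidHom.coe_smul, Pi.smul_apply]
  QuotientAddGroup.lift (tensRel ρ σ M N) G <| by
    refine (AddSubgroup.closure_le _).2 ?_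
    rintro _ ⟨r, m, n, rfl⟩
    show G _ = 0
    rw [map_sub, sub_eq_zero]
    exact h r m n

theorem lift_tmul {P : Type*} [AddCommGroup P] (f : M → N → P) (h₁ h₂ h) (m : M) (n : N) :
    lift (ρ := ρ) (σ := σ) f h₁ h₂ h (tmul ρ σ m n) = f m n :=
  rfl

theorem induction {p : Tens ρ σ M N → Prop} (zero : p 0) (tmul : ∀ m n, p (tmul ρ σ m n))
    (add : ∀ x y, p x → p y → p (x + y)) (z : Tens ρ σ M N) : p z := by
  obtain ⟨w, rfl⟩ := QuotientAddGroup.mk_surjective z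
  induction w using TensorProduct.induction_on with
  | zero => exact zero
  | tmul m n => exact tmul m n
  | add x y hx hy => exact add _ _ hx hy

theorem hom_ext {P : Type*} [AddCommGroup P] {f g : Tens ρ σ M N →+ P}
    (h : ∀ m n, f (tmul ρ σ m n) = g (tmul ρ σ m n)) : f = g := by
  ext z
  induction z using Tens.induction with
  | zero => simp
  | tmul m n => exact h m n
  | add x y hx hy => simp [hx, hy]

/-- `f ⊗_R g`. -/
def map {A₁' A₂' M' N' : Type*} [Ring A₁'] [Ring A₂'] {ρ' : R →+* A₁'} {σ' : R →+* A₂'}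
    [AddCommGroup M'] [AddCommGroup N'] [Module A₁'ᵐᵒᵖ M'] [Module A₂' N']
    (f : M →+ M') (hf : RightLin ρ ρ' f) (g : N →+ N') (hg : LeftLin σ σ' g) :
    Tens ρ σ M N →+ Tens ρ' σ' M' N' :=
  lift (fun m n => tmul ρ' σ' (f m) (g n))
    (fun m m' n => by rw [map_add, tmul_add_left])
    (fun m n n' => by rw [map_add, tmul_add_right])
    (fun r m n => by rw [hf, hg, tmul_bal])

theorem map_tmul {A₁' A₂' M' N' : Type*} [Ring A₁'] [Ring A₂'] {ρ' : R →+* A₁'} {σ' : R →+* A₂'}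
    [AddCommGroup M'] [AddCommGroup N'] [Module A₁'ᵐᵒᵖ M'] [Module A₂' N']
    (f : M →+ M') (hf : RightLin ρ ρ' f) (g : N →+ N') (hg : LeftLin σ σ' g) (m : M) (n : N) :
    map f hf g hg (tmul ρ σ m n) = tmul ρ' σ' (f m) (g n) :=
  rfl

section LeftAction

variable {K : Type*} [Ring K] [Module K M] [SMulCommClass K A₁ᵐᵒᵖ M]

/-- The left action of `K` on `M ⊗_R N` for a bimodule `M`: `k (m ⊗ n) = k m ⊗ n`. -/
def leftAct (k : K) : Tens ρ σ M N →+ Tens ρ σ M N :=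
  map (DistribSMul.toAddMonoidHom M k) (fun r m => smul_comm k (op (ρ r)) m)
    (AddMonoidHom.id N) (leftLin_id σ)

instance : Module K (Tens ρ σ M N) where
  smul k z := leftAct k z
  one_smul z := by
    refine DFunLike.congr_fun (f := leftAct (1 : K)) (g := AddMonoidHom.id _) (hom_ext ?_) z
    intro m n; show tmul ρ σ ((1 : K) • m) n = tmul ρ σ m n; rw [one_smul]
  mul_smul k l z := by
    refine DFunLike.congr_fun (f := leftAct (k * l)) (g := (leftAct k).comp (leftAct l))
      (hom_ext ?_) z
    intro m n; show tmul ρ σ ((k * l) • m) n = tmul ρ σ (k • l • m) n; rw [mul_smul]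
  smul_zero k := map_zero (leftAct k)
  smul_add k := map_add (leftAct k)
  add_smul k l z := by
    refine DFunLike.congr_fun (f := leftAct (k + l)) (g := leftAct k + leftAct l) (hom_ext ?_) z
    intro m n; show tmul ρ σ ((k + l) • m) n = tmul ρ σ (k • m) n + tmul ρ σ (l • m) n
    rw [add_smul, tmul_add_left]
  zero_smul z := by
    refine DFunLike.congr_fun (f := leftAct (0 : K)) (g := 0) (hom_ext ?_) z
    intro m n; show tmul ρ σ ((0 : K) • m) n = 0
    rw [zero_smul, zero_tmul]

theorem smul_tmul (k : K) (m : M) (n : N) : k • tmul ρ σ m n = tmul ρ σ (k • m) n :=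
  rfl

end LeftAction

section RightAction

variable {L : Type*} [Ring L] [Module Lᵐᵒᵖ N] [SMulCommClass A₂ Lᵐᵒᵖ N]

/-- The right action of `L` on `M ⊗_R N` for a bimodule `N`: `(m ⊗ n) l = m ⊗ n l`. -/
def rightAct (l : Lᵐᵒᵖ) : Tens ρ σ M N →+ Tens ρ σ M N :=
  map (AddMonoidHom.id M) (rightLin_id ρ) (DistribSMul.toAddMonoidHom N l)
    (fun r n => (smul_comm (σ r) l n).symm)

instance : Module Lᵐᵒᵖ (Tens ρ σ M N) where
  smul l z := rightAct l z
  one_smul z := by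
    refine DFunLike.congr_fun (f := rightAct (1 : Lᵐᵒᵖ)) (g := AddMonoidHom.id _) (hom_ext ?_) z
    intro m n; show tmul ρ σ m ((1 : Lᵐᵒᵖ) • n) = tmul ρ σ m n; rw [one_smul]
  mul_smul k l z := by
    refine DFunLike.congr_fun (f := rightAct (k * l)) (g := (rightAct k).comp (rightAct l))
      (hom_ext ?_) z
    intro m n; show tmul ρ σ m ((k * l) • n) = tmul ρ σ m (k • l • n); rw [mul_smul]
  smul_zero k := map_zero (rightAct k)
  smul_add k := map_add (rightAct k)
  add_smul k l z := by
    refine DFunLike.congr_fun (f := rightAct (k + l)) (g := rightAct k + rightAct l)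
      (hom_ext ?_) z
    intro m n; show tmul ρ σ m ((k + l) • n) = tmul ρ σ m (k • n) + tmul ρ σ m (l • n)
    rw [add_smul, tmul_add_right]
  zero_smul z := by
    refine DFunLike.congr_fun (f := rightAct (0 : Lᵐᵒᵖ)) (g := 0) (hom_ext ?_) z
    intro m n; show tmul ρ σ m ((0 : Lᵐᵒᵖ) • n) = 0
    rw [zero_smul, tmul_zero]

theorem op_smul_tmul (l : Lᵐᵒᵖ) (m : M) (n : N) : l • tmul ρ σ m n = tmul ρ σ m (l • n) :=
  rfl

end RightAction

instance {K L : Type*} [Ring K] [Ring L] [Module K M] [SMulCommClass K A₁ᵐᵒᵖ M] [Module Lᵐᵒᵖ N]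
    [SMulCommClass A₂ Lᵐᵒᵖ N] : SMulCommClass K Lᵐᵒᵖ (Tens ρ σ M N) where
  smul_comm k l z := by
    refine DFunLike.congr_fun (f := (leftAct k).comp (rightAct l))
      (g := (rightAct l).comp (leftAct k)) (hom_ext ?_) z
    intro m n; rfl

section Assoc

variable {R' A₃ A₄ P : Type*} [Ring R'] [Ring A₃] [Ring A₄] {ρ' : R' →+* A₃} {σ' : R' →+* A₄}
  [Module A₃ᵐᵒᵖ N] [SMulCommClass A₂ A₃ᵐᵒᵖ N] [AddCommGroup P] [Module A₄ P]

/-- `(m ⊗ n) ⊗ p ↦ m ⊗ (n ⊗ p)` -/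
def assocHom : Tens ρ' σ' (Tens ρ σ M N) P →+ Tens ρ σ M (Tens ρ' σ' N P) :=
  lift
    (fun z p => lift (ρ := ρ) (σ := σ) (fun m n => tmul ρ σ m (tmul ρ' σ' n p))
      (fun m m' n => tmul_add_left ..)
      (fun m n n' => by rw [tmul_add_left, tmul_add_right])
      (fun r m n => by rw [tmul_bal, smul_tmul]) z)
    (fun z z' p => map_add _ z z')
    (fun z p p' => by
      induction z using Tens.induction with
      | zero => simp
      | tmul m n => simp only [lift_tmul, tmul_add_right]
      | add x y hx hy => simp only [map_add, hx, hy]; abel)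
    (fun r z p => by
      induction z using Tens.induction with
      | zero => simp
      | tmul m n => simp only [op_smul_tmul, lift_tmul, tmul_bal]
      | add x y hx hy => simp only [smul_add, map_add, hx, hy])

/-- `m ⊗ (n ⊗ p) ↦ (m ⊗ n) ⊗ p` -/
def assocInv : Tens ρ σ M (Tens ρ' σ' N P) →+ Tens ρ' σ' (Tens ρ σ M N) P :=
  lift
    (fun m z => lift (ρ := ρ') (σ := σ') (fun n p => tmul ρ' σ' (tmul ρ σ m n) p)
      (fun n n' p => by rw [tmul_add_right, tmul_add_left])
      (fun n p p' => tmul_add_right ..)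
      (fun r n p => by rw [← tmul_bal, op_smul_tmul]) z)
    (fun m m' z => by
      induction z using Tens.induction with
      | zero => simp
      | tmul n p => simp only [lift_tmul, tmul_add_left]
      | add x y hx hy => simp only [map_add, hx, hy]; abel)
    (fun m z z' => map_add _ z z')
    (fun r m z => by
      induction z using Tens.induction with
      | zero => simp
      | tmul n p => simp only [smul_tmul, lift_tmul, tmul_bal]
      | add x y hx hy => simp only [smul_add, map_add, hx, hy])

/-- The associativity isomorphism `(M ⊗ N) ⊗ P ≅ M ⊗ (N ⊗ P)` for a bimodule `N`. -/
def assoc : Tens ρ' σ' (Tens ρ σ M N) P ≃+ Tens ρ σ M (Tens ρ' σ' N P) :=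
  AddMonoidHom.toAddEquiv assocHom assocInv
    (hom_ext fun z p => by
      induction z using Tens.induction with
      | zero =>
        simp [zero_tmul]
      | tmul m n => rfl
      | add x y hx hy => rw [tmul_add_left, map_add, map_add, hx, hy])
    (hom_ext fun m z => by
      induction z using Tens.induction with
      | zero =>
        simp [tmul_zero]
      | tmul n p => rfl
      | add x y hx hy => rw [tmul_add_right, map_add, map_add, hx, hy])

theorem assoc_tmul (m : M) (n : N) (p : P) :
    assoc (tmul ρ' σ' (tmul ρ σ m n) p) = tmul ρ σ m (tmul ρ' σ' n p) :=
  rfl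

theorem assoc_symm_tmul (m : M) (n : N) (p : P) :
    assoc.symm (tmul ρ σ m (tmul ρ' σ' n p)) = tmul ρ' σ' (tmul ρ σ m n) p :=
  rfl

end Assoc

/-- `R ⊗_R N → N`, `r ⊗ n ↦ r n`. -/
def lid (σ : R →+* A₂) (N : Type*) [AddCommGroup N] [Module A₂ N] :
    Tens (RingHom.id R) σ R N →+ N :=
  lift (fun r n => σ r • n) (fun r r' n => by rw [map_add, add_smul]) (fun r n n' => smul_add ..)
    (fun s r n => by simp [mul_smul])

/-- `M ⊗_R R → M`, `m ⊗ r ↦ m r`. -/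
def rid (ρ : R →+* A₁) (M : Type*) [AddCommGroup M] [Module A₁ᵐᵒᵖ M] :
    Tens ρ (RingHom.id R) M R →+ M :=
  lift (fun m r => op (ρ r) • m) (fun m m' r => smul_add ..)
    (fun m r r' => by rw [map_add, op_add, add_smul]) (fun s m r => by simp [mul_smul])

/-- `A ⊗_R N → N`, `a ⊗ n ↦ a n`, for a left `A`-module `N`. -/
def lact {A : Type*} [Ring A] (α : R →+* A) (N : Type*) [AddCommGroup N] [Module A N] :
    Tens α α A N →+ N :=
  lift (fun a n => a • n) (fun a a' n => add_smul ..) (fun a n n' => smul_add ..)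
    (fun r a n => by simp [mul_smul])

/-- `M ⊗_R A → M`, `m ⊗ a ↦ m a`, for a right `A`-module `M`. -/
def ract {A : Type*} [Ring A] (α : R →+* A) (M : Type*) [AddCommGroup M] [Module Aᵐᵒᵖ M] :
    Tens α α M A →+ M :=
  lift (fun m a => op a • m) (fun m m' a => smul_add ..)
    (fun m a a' => by rw [op_add, add_smul]) (fun r m a => by simp [mul_smul])

section Linear

variable {A₁' A₂' M' N' : Type*} [Ring A₁'] [Ring A₂'] {ρ' : R →+* A₁'} {σ' : R →+* A₂'}
    [AddCommGroup M'] [AddCommGroup N'] [Module A₁'ᵐᵒᵖ M'] [Module A₂' N']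

theorem leftLin_map {Q K K' : Type*} [Ring Q] [Ring K] [Ring K'] {τ : Q →+* K} {τ' : Q →+* K'}
    [Module K M] [SMulCommClass K A₁ᵐᵒᵖ M] [Module K' M'] [SMulCommClass K' A₁'ᵐᵒᵖ M']
    (f : M →+ M') (hf : RightLin ρ ρ' f) (g : N →+ N') (hg : LeftLin σ σ' g)
    (h : LeftLin τ τ' f) : LeftLin τ τ' (map f hf g hg) := by
  intro q z
  induction z using Tens.induction with
  | zero => simp
  | tmul m n => rw [smul_tmul, map_tmul, h, map_tmul, smul_tmul]
  | add x y hx hy => rw [smul_add, map_add, hx, hy, map_add, smul_add]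

theorem rightLin_map {Q L L' : Type*} [Ring Q] [Ring L] [Ring L'] {τ : Q →+* L} {τ' : Q →+* L'}
    [Module Lᵐᵒᵖ N] [SMulCommClass A₂ Lᵐᵒᵖ N] [Module L'ᵐᵒᵖ N'] [SMulCommClass A₂' L'ᵐᵒᵖ N']
    (f : M →+ M') (hf : RightLin ρ ρ' f) (g : N →+ N') (hg : LeftLin σ σ' g)
    (h : RightLin τ τ' g) : RightLin τ τ' (map f hf g hg) := by
  intro q z
  induction z using Tens.induction with
  | zero => simp
  | tmul m n => rw [op_smul_tmul, map_tmul, h, map_tmul, op_smul_tmul]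
  | add x y hx hy => rw [smul_add, map_add, hx, hy, map_add, smul_add]

variable {R' A₃ A₄ P : Type*} [Ring R'] [Ring A₃] [Ring A₄] {τ : R' →+* A₃} {τ' : R' →+* A₄}
  [Module A₃ᵐᵒᵖ N] [SMulCommClass A₂ A₃ᵐᵒᵖ N] [AddCommGroup P] [Module A₄ P]

theorem assoc_symm_smul {K : Type*} [Ring K] [Module K M] [SMulCommClass K A₁ᵐᵒᵖ M]
    (k : K) (z : Tens ρ σ M (Tens τ τ' N P)) : assoc.symm (k • z) = k • assoc.symm z := by
  induction z using Tens.induction with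
  | zero => simp
  | tmul m w =>
    induction w using Tens.induction with
    | zero =>
      simp [tmul_zero]
    | tmul n p => rfl
    | add x y hx hy => rw [tmul_add_right, smul_add, map_add, hx, hy, map_add, smul_add]
  | add x y hx hy => rw [smul_add, map_add, hx, hy, map_add, smul_add]

theorem assoc_symm_op_smul {L : Type*} [Ring L] [Module Lᵐᵒᵖ P] [SMulCommClass A₄ Lᵐᵒᵖ P]
    (l : Lᵐᵒᵖ) (z : Tens ρ σ M (Tens τ τ' N P)) : assoc.symm (l • z) = l • assoc.symm z := by
  induction z using Tens.induction with
  | zero => simp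
  | tmul m w =>
    induction w using Tens.induction with
    | zero =>
      simp [tmul_zero]
    | tmul n p => rfl
    | add x y hx hy => rw [tmul_add_right, smul_add, map_add, hx, hy, map_add, smul_add]
  | add x y hx hy => rw [smul_add, map_add, hx, hy, map_add, smul_add]

theorem assoc_smul {K : Type*} [Ring K] [Module K M] [SMulCommClass K A₁ᵐᵒᵖ M]
    (k : K) (z : Tens τ τ' (Tens ρ σ M N) P) : assoc (k • z) = k • assoc z := by
  apply assoc.symm.injective
  rw [assoc_symm_smul, AddEquiv.symm_apply_apply, AddEquiv.symm_apply_apply]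

theorem assoc_op_smul {L : Type*} [Ring L] [Module Lᵐᵒᵖ P] [SMulCommClass A₄ Lᵐᵒᵖ P]
    (l : Lᵐᵒᵖ) (z : Tens τ τ' (Tens ρ σ M N) P) : assoc (l • z) = l • assoc z := by
  apply assoc.symm.injective
  rw [assoc_symm_op_smul, AddEquiv.symm_apply_apply, AddEquiv.symm_apply_apply]

end Linear

end Tens

end Tensor

open Tens

section Flatness

variable {R A : Type u} [Ring R] [Ring A]

/-- `M` is a faithfully flat right `R`-module: a sequence of left `R`-modules is exact if and only
if it is exact after `M ⊗_R -`. -/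
def RightFaithfullyFlat (ρ : R →+* A) (M : Type u) [AddCommGroup M] [Module Aᵐᵒᵖ M] : Prop :=
  ∀ (X Y Z : Type u) [AddCommGroup X] [AddCommGroup Y] [AddCommGroup Z] [Module R X] [Module R Y]
    [Module R Z] (f : X →+ Y) (g : Y →+ Z)
    (hf : LeftLin (RingHom.id R) (RingHom.id R) f) (hg : LeftLin (RingHom.id R) (RingHom.id R) g),
    Function.Exact f g ↔
      Function.Exact (map (AddMonoidHom.id M) (rightLin_id ρ) f hf)
        (map (AddMonoidHom.id M) (rightLin_id ρ) g hg)

/-- `N` is a faithfully flat left `R`-module: a sequence of right `R`-modules is exact if and only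
if it is exact after `- ⊗_R N`. -/
def LeftFaithfullyFlat (σ : R →+* A) (N : Type u) [AddCommGroup N] [Module A N] : Prop :=
  ∀ (X Y Z : Type u) [AddCommGroup X] [AddCommGroup Y] [AddCommGroup Z] [Module Rᵐᵒᵖ X]
    [Module Rᵐᵒᵖ Y] [Module Rᵐᵒᵖ Z] (f : X →+ Y) (g : Y →+ Z)
    (hf : RightLin (RingHom.id R) (RingHom.id R) f)
    (hg : RightLin (RingHom.id R) (RingHom.id R) g),
    Function.Exact f g ↔
      Function.Exact (map f hf (AddMonoidHom.id N) (leftLin_id σ))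
        (map g hg (AddMonoidHom.id N) (leftLin_id σ))

/-- The ring map `α : R → A` is a split extension: it has a retraction which is a map of
`R`-bimodules. -/
def SplitExtension (α : R →+* A) : Prop :=
  ∃ π : A →+ R, (∀ r a, π (α r * a) = r * π a) ∧ (∀ a r, π (a * α r) = π a * r) ∧
    ∀ r, π (α r) = r

end Flatness

section Coring

/-- An `R`-coring: an `R`-bimodule `C` with coassociative and counital `R`-bimodule maps
`C → C ⊗_R C` and `C → R`. -/
structure Coring (R C : Type*) [Ring R] [AddCommGroup C] [Module R C] [Module Rᵐᵒᵖ C]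
    [SMulCommClass R Rᵐᵒᵖ C] where
  comul : C →+ Tens (RingHom.id R) (RingHom.id R) C C
  comul_left : LeftLin (RingHom.id R) (RingHom.id R) comul
  comul_right : RightLin (RingHom.id R) (RingHom.id R) comul
  counit : C →+ R
  counit_left : LeftLin (RingHom.id R) (RingHom.id R) counit
  counit_right : RightLin (RingHom.id R) (RingHom.id R) counit
  coassoc : ∀ c, assoc (map comul comul_right (AddMonoidHom.id C) (leftLin_id _) (comul c)) =
    map (AddMonoidHom.id C) (rightLin_id _) comul comul_left (comul c)
  counit_comul : ∀ c,
    lid (RingHom.id R) C (map counit counit_right (AddMonoidHom.id C) (leftLin_id _) (comul c)) = c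
  comul_counit : ∀ c,
    rid (RingHom.id R) C (map (AddMonoidHom.id C) (rightLin_id _) counit counit_left (comul c)) = c

variable {R A C : Type*} [Ring R] [Ring A] (α : R →+* A) [AddCommGroup C] [Module R C]
  [Module Rᵐᵒᵖ C] [SMulCommClass R Rᵐᵒᵖ C]

/-- The right action `(M ⊗_R C) ⊗_R A → M ⊗_R C`, `(m ⊗ c) ⊗ a ↦ m ψ(c ⊗ a)`, induced by
`ψ : C ⊗_R A → A ⊗_R C` for a right `A`-module `M`; the composite of `M ⊗ ψ` and the action of
`A` on `M`. -/
def rightEntwinedAct (ψ : Tens (RingHom.id R) α C A →+ Tens α (RingHom.id R) A C)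
    (hψ : LeftLin (RingHom.id R) α ψ) (M : Type*) [AddCommGroup M] [Module Aᵐᵒᵖ M] :
    Tens (RingHom.id R) α (Tens α (RingHom.id R) M C) A →+ Tens α (RingHom.id R) M C :=
  (map (ract α M) (fun r z => by
      induction z using Tens.induction with
      | zero => simp
      | tmul m a => simp only [op_smul_tmul, ract, lift_tmul, op_smul_eq_mul, op_mul, mul_smul]
      | add x y hx hy => rw [smul_add, map_add, hx, hy, map_add, smul_add])
    (AddMonoidHom.id C) (leftLin_id _)).comp <|
  (assoc (ρ := α) (σ := α) (ρ' := α) (σ' := RingHom.id R)).symm.toAddMonoidHom.comp <|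
  (map (AddMonoidHom.id M) (rightLin_id α) ψ hψ).comp
  (assoc (ρ := α) (σ := RingHom.id R) (ρ' := RingHom.id R) (σ' := α)).toAddMonoidHom

/-- A (right-right) entwining structure `(A, C, ψ)` over `R`: the coring `C` is entwined with the
`R`-ring `A` by the `R`-bimodule map `ψ : C ⊗_R A → A ⊗_R C`. -/
structure RightEntwining (𝒞 : Coring R C) where
  ψ : Tens (RingHom.id R) α C A →+ Tens α (RingHom.id R) A C
  left_lin : LeftLin (RingHom.id R) α ψ
  right_lin : RightLin α (RingHom.id R) ψ
  ψ_mul : ∀ (c : C) (a b : A), ψ (tmul _ _ c (a * b)) =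
    rightEntwinedAct α ψ left_lin A (tmul _ _ (ψ (tmul _ _ c a)) b)
  ψ_one : ∀ c : C, ψ (tmul _ _ c 1) = tmul _ _ 1 c
  ψ_comul : ∀ z : Tens (RingHom.id R) α C A,
    map (AddMonoidHom.id A) (rightLin_id α) 𝒞.comul 𝒞.comul_left (ψ z) =
      assoc (map ψ right_lin (AddMonoidHom.id C) (leftLin_id _)
        (assoc.symm (map (AddMonoidHom.id C) (rightLin_id _) ψ left_lin
          (assoc (map 𝒞.comul 𝒞.comul_right (AddMonoidHom.id A) (leftLin_id α) z)))))
  ψ_counit : ∀ z : Tens (RingHom.id R) α C A,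
    rid α A (map (AddMonoidHom.id A) (rightLin_id α) 𝒞.counit 𝒞.counit_left (ψ z)) =
      lid α A (map 𝒞.counit 𝒞.counit_right (AddMonoidHom.id A) (leftLin_id α) z)

/-- A right `(A, C, ψ)_R`-entwined module structure on the right `A`-module `M`: a right
`C`-comodule structure with `ρ(m a) = m₀ ψ(m₁ ⊗ a)`. -/
structure RightEntwinedModule {α : R →+* A} {𝒞 : Coring R C} (E : RightEntwining α 𝒞) (M : Type*)
    [AddCommGroup M] [Module Aᵐᵒᵖ M] where
  coact : M →+ Tens α (RingHom.id R) M C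
  right_lin : RightLin α (RingHom.id R) coact
  coassoc : ∀ m, assoc (map coact right_lin (AddMonoidHom.id C) (leftLin_id _) (coact m)) =
    map (AddMonoidHom.id M) (rightLin_id α) 𝒞.comul 𝒞.comul_left (coact m)
  counit : ∀ m,
    rid α M (map (AddMonoidHom.id M) (rightLin_id α) 𝒞.counit 𝒞.counit_left (coact m)) = m
  entwined : ∀ (m : M) (a : A),
    coact (op a • m) = rightEntwinedAct α E.ψ E.left_lin M (tmul _ _ (coact m) a)

/-- The left action `A ⊗_R (C ⊗_R M) → C ⊗_R M`, `a ⊗ (c ⊗ m) ↦ φ(a ⊗ c) m`, induced by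
`φ : A ⊗_R C → C ⊗_R A` for a left `A`-module `M`; the composite of `φ ⊗ M` and the action of
`A` on `M`. -/
def leftEntwinedAct (φ : Tens α (RingHom.id R) A C →+ Tens (RingHom.id R) α C A)
    (hφ : RightLin (RingHom.id R) α φ) (M : Type*) [AddCommGroup M] [Module A M] :
    Tens α (RingHom.id R) A (Tens (RingHom.id R) α C M) →+ Tens (RingHom.id R) α C M :=
  (map (AddMonoidHom.id C) (rightLin_id _) (lact α M) (fun r z => by
      induction z using Tens.induction with
      | zero => simp
      | tmul a m => simp only [smul_tmul, lact, lift_tmul, smul_eq_mul, mul_smul]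
      | add x y hx hy => rw [smul_add, map_add, hx, hy, map_add, smul_add])).comp <|
  (assoc (ρ := RingHom.id R) (σ := α) (ρ' := α) (σ' := α)).toAddMonoidHom.comp <|
  (map φ hφ (AddMonoidHom.id M) (leftLin_id α)).comp
  (assoc (ρ := α) (σ := RingHom.id R) (ρ' := RingHom.id R) (σ' := α)).symm.toAddMonoidHom

/-- A (left-left) entwining structure `(A, C, φ)` over `R`: the `R`-ring `A` is entwined with the
coring `C` by the `R`-bimodule map `φ : A ⊗_R C → C ⊗_R A`. -/
structure LeftEntwining (𝒞 : Coring R C) where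
  φ : Tens α (RingHom.id R) A C →+ Tens (RingHom.id R) α C A
  left_lin : LeftLin α (RingHom.id R) φ
  right_lin : RightLin (RingHom.id R) α φ
  φ_mul : ∀ (a b : A) (c : C), φ (tmul _ _ (a * b) c) =
    leftEntwinedAct α φ right_lin A (tmul _ _ a (φ (tmul _ _ b c)))
  φ_one : ∀ c : C, φ (tmul _ _ 1 c) = tmul _ _ c 1
  φ_comul : ∀ z : Tens α (RingHom.id R) A C,
    assoc (map 𝒞.comul 𝒞.comul_right (AddMonoidHom.id A) (leftLin_id α) (φ z)) =
      map (AddMonoidHom.id C) (rightLin_id _) φ left_lin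
        (assoc (map φ right_lin (AddMonoidHom.id C) (leftLin_id _)
          (assoc.symm (map (AddMonoidHom.id A) (rightLin_id α) 𝒞.comul 𝒞.comul_left z))))
  φ_counit : ∀ z : Tens α (RingHom.id R) A C,
    lid α A (map 𝒞.counit 𝒞.counit_right (AddMonoidHom.id A) (leftLin_id α) (φ z)) =
      rid α A (map (AddMonoidHom.id A) (rightLin_id α) 𝒞.counit 𝒞.counit_left z)

/-- A left `(A, C, φ)_R`-entwined module structure on the left `A`-module `M`: a left
`C`-comodule structure with `λ(a m) = φ(a ⊗ m₋₁) m₀`. -/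
structure LeftEntwinedModule {α : R →+* A} {𝒞 : Coring R C} (E : LeftEntwining α 𝒞) (M : Type*)
    [AddCommGroup M] [Module A M] where
  coact : M →+ Tens (RingHom.id R) α C M
  left_lin : LeftLin α (RingHom.id R) coact
  coassoc : ∀ m, assoc (map 𝒞.comul 𝒞.comul_right (AddMonoidHom.id M) (leftLin_id α) (coact m)) =
    map (AddMonoidHom.id C) (rightLin_id _) coact left_lin (coact m)
  counit : ∀ m,
    lid α M (map 𝒞.counit 𝒞.counit_right (AddMonoidHom.id M) (leftLin_id α) (coact m)) = m
  entwined : ∀ (a : A) (m : M),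
    coact (a • m) = leftEntwinedAct α E.φ E.right_lin M (tmul _ _ a (coact m))

end Coring

section Herd

variable {R S A B : Type*} [Ring R] [Ring S] [Ring A] [Ring B] (α : R →+* A) (β : S →+* B)
  (T T' : Type*) [AddCommGroup T] [Module B T] [Module Aᵐᵒᵖ T] [SMulCommClass B Aᵐᵒᵖ T]
  [AddCommGroup T'] [Module A T'] [Module Bᵐᵒᵖ T'] [SMulCommClass A Bᵐᵒᵖ T']

/-- The `B`-`A` bimodule `T` with the formal dual (pen) `T'` and the shepherd `γ` is a
`B`-`A` herd. -/
structure Herd where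
  /-- The evaluation `T' ⊗_S T → A`. -/
  ev : Tens β β T' T →+ A
  ev_left : ∀ (a : A) z, ev (a • z) = a * ev z
  ev_right : ∀ (a : A) z, ev (op a • z) = ev z * a
  /-- The evaluation `T ⊗_R T' → B`. -/
  ev' : Tens α α T T' →+ B
  ev'_left : ∀ (b : B) z, ev' (b • z) = b * ev' z
  ev'_right : ∀ (b : B) z, ev' (op b • z) = ev' z * b
  ev'_smul : ∀ (x : T) (x' : T') (y : T), ev' (tmul α α x x') • y = op (ev (tmul β β x' y)) • x
  ev_smul : ∀ (x' : T') (x : T) (y' : T'), op (ev' (tmul α α x y')) • x' = ev (tmul β β x' x) • y'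
  /-- The shepherd `T → T ⊗_R T' ⊗_S T`. -/
  γ : T →+ Tens α α T (Tens β β T' T)
  γ_left : LeftLin β β γ
  γ_right : RightLin α α γ
  ev'_γ : ∀ x, map ev' (fun s z => ev'_right (β s) z) (AddMonoidHom.id T) (leftLin_id β)
    (assoc.symm (γ x)) = tmul β β (1 : B) x
  ev_γ : ∀ x, map (AddMonoidHom.id T) (rightLin_id α) ev (fun r z => ev_left (α r) z) (γ x) =
    tmul α α x (1 : A)
  /-- Coassociativity in `T ⊗_R (T' ⊗_S (T ⊗_R (T' ⊗_S T)))`. -/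
  γ_coassoc : ∀ x,
    map (AddMonoidHom.id T) (rightLin_id α) assoc.toAddMonoidHom (fun r z => assoc_smul (α r) z)
      (assoc (map γ γ_right (AddMonoidHom.id (Tens β β T' T)) (leftLin_id α) (γ x))) =
    map (AddMonoidHom.id T) (rightLin_id α)
      (map (AddMonoidHom.id T') (rightLin_id β) γ γ_left)
      (leftLin_map _ _ _ _ (leftLin_id α)) (γ x)

namespace Herd

variable {α β T T'} (H : Herd α β T T')

theorem ev_rightLin : RightLin α α H.ev := fun r z => H.ev_right (α r) z

theorem ev'_leftLin : LeftLin β β H.ev' := fun s z => H.ev'_left (β s) z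

/-- `x' ⊗ x ↦ x' ⊗ γ(x)`, as a map `T' ⊗_S T → (T' ⊗_S T) ⊗_R (T' ⊗_S T)`. -/
def comulC : Tens β β T' T →+ Tens α α (Tens β β T' T) (Tens β β T' T) :=
  assoc.symm.toAddMonoidHom.comp (map (AddMonoidHom.id T') (rightLin_id β) H.γ H.γ_left)

/-- `(ev ⊗ T' ⊗ T) ∘ (T' ⊗ γ) : T' ⊗_S T → A ⊗_R (T' ⊗_S T)`. -/
def ξC : Tens β β T' T →+ Tens α α A (Tens β β T' T) :=
  (map H.ev H.ev_rightLin (AddMonoidHom.id _) (leftLin_id α)).comp H.comulC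

theorem ξC_smul (a : A) (z : Tens β β T' T) : H.ξC (a • z) = a • H.ξC z := by
  have h1 := leftLin_map (τ := RingHom.id A) (τ' := RingHom.id A) (AddMonoidHom.id T')
    (rightLin_id β) H.γ H.γ_left (leftLin_id _) a z
  have h2 := leftLin_map (τ := RingHom.id A) (τ' := RingHom.id A) H.ev H.ev_rightLin
    (AddMonoidHom.id (Tens β β T' T)) (leftLin_id α) (fun a z => H.ev_left a z) a
  simp only [RingHom.id_apply] at h1 h2
  simp only [ξC, comulC, AddMonoidHom.comp_apply, AddEquiv.coe_toAddMonoidHom]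
  rw [h1, assoc_symm_smul, h2]

theorem ξC_op_smul (r : R) (z : Tens β β T' T) :
    H.ξC (op (α r) • z) = op (α r) • H.ξC z := by
  have h1 := rightLin_map (τ := α) (τ' := α) (AddMonoidHom.id T')
    (rightLin_id β) H.γ H.γ_left H.γ_right r z
  have h2 := rightLin_map (τ := α) (τ' := α) H.ev H.ev_rightLin
    (AddMonoidHom.id (Tens β β T' T)) (leftLin_id α) (rightLin_id α) r
  simp only [ξC, comulC, AddMonoidHom.comp_apply, AddEquiv.coe_toAddMonoidHom]
  rw [h1, assoc_symm_op_smul, h2]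

/-- The equaliser `C` of `ξC` and `z ↦ 1_A ⊗ z` in `T' ⊗_S T`. -/
def C : AddSubgroup (Tens β β T' T) where
  carrier := {z | H.ξC z = tmul α α (1 : A) z}
  zero_mem' := by
    show H.ξC 0 = _
    rw [map_zero, tmul_zero]
  add_mem' := by
    intro x y hx hy
    show H.ξC (x + y) = _
    rw [map_add, tmul_add_right, show H.ξC x = _ from hx, show H.ξC y = _ from hy]
  neg_mem' := by
    intro x hx
    show H.ξC (-x) = _
    have h := tmul_add_right α α (1 : A) x (-x)
    rw [add_neg_cancel, tmul_zero] at h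
    rw [map_neg, show H.ξC x = _ from hx]
    exact neg_eq_of_add_eq_zero_right h.symm

theorem C_smul_mem (r : R) {z : Tens β β T' T} (hz : z ∈ H.C) : α r • z ∈ H.C := by
  show H.ξC _ = _
  rw [ξC_smul, show H.ξC z = _ from hz, smul_tmul, ← tmul_bal]
  simp

theorem C_op_smul_mem (r : R) {z : Tens β β T' T} (hz : z ∈ H.C) : op (α r) • z ∈ H.C := by
  show H.ξC _ = _
  rw [ξC_op_smul, show H.ξC z = _ from hz, op_smul_tmul]

instance : Module R H.C where
  smul r c := ⟨α r • (c : Tens β β T' T), H.C_smul_mem r c.2⟩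
  one_smul c := Subtype.ext <| show α 1 • (c : Tens β β T' T) = c by simp
  mul_smul r s c := Subtype.ext <|
    show α (r * s) • (c : Tens β β T' T) = α r • α s • (c : Tens β β T' T) by simp [mul_smul]
  smul_zero r := Subtype.ext <| show α r • (0 : Tens β β T' T) = 0 by simp
  smul_add r c d := Subtype.ext <| smul_add (α r) (c : Tens β β T' T) d
  add_smul r s c := Subtype.ext <| show α (r + s) • (c : Tens β β T' T) = α r • c + α s • c by
    simp [add_smul]
  zero_smul c := Subtype.ext <| show α 0 • (c : Tens β β T' T) = 0 by simp

instance : Module Rᵐᵒᵖ H.C where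
  smul r c := ⟨op (α r.unop) • (c : Tens β β T' T), H.C_op_smul_mem r.unop c.2⟩
  one_smul c := Subtype.ext <| show op (α 1) • (c : Tens β β T' T) = c by simp
  mul_smul r s c := Subtype.ext <|
    show op (α (s.unop * r.unop)) • (c : Tens β β T' T) =
      op (α r.unop) • op (α s.unop) • (c : Tens β β T' T) by simp [mul_smul]
  smul_zero r := Subtype.ext <| show op (α r.unop) • (0 : Tens β β T' T) = 0 by simp
  smul_add r c d := Subtype.ext <| smul_add (op (α r.unop)) (c : Tens β β T' T) d
  add_smul r s c := Subtype.ext <|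
    show op (α (r.unop + s.unop)) • (c : Tens β β T' T) =
      op (α r.unop) • (c : Tens β β T' T) + op (α s.unop) • (c : Tens β β T' T) by simp [add_smul]
  zero_smul c := Subtype.ext <| show op (α 0) • (c : Tens β β T' T) = 0 by simp

instance : SMulCommClass R Rᵐᵒᵖ H.C where
  smul_comm r s c := Subtype.ext <| smul_comm (α r) (op (α s.unop)) (c : Tens β β T' T)

/-- The inclusion `C → T' ⊗_S T`. -/
def ιC : H.C →+ Tens β β T' T := H.C.subtype

theorem ιC_left : LeftLin (RingHom.id R) α H.ιC := fun _ _ => rfl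

theorem ιC_right : RightLin (RingHom.id R) α H.ιC := fun _ _ => rfl

/-- `γ` as a map `T → (T ⊗_R T') ⊗_S T`. -/
def γ' : T →+ Tens β β (Tens α α T T') T := assoc.symm.toAddMonoidHom.comp H.γ

theorem γ'_left : LeftLin β β H.γ' := fun s x => by
  simp only [γ', AddMonoidHom.comp_apply, AddEquiv.coe_toAddMonoidHom]
  rw [H.γ_left, assoc_symm_smul]

theorem γ'_right : RightLin α α H.γ' := fun r x => by
  simp only [γ', AddMonoidHom.comp_apply, AddEquiv.coe_toAddMonoidHom]
  rw [H.γ_right, assoc_symm_op_smul]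

/-- `x ⊗ x' ↦ γ(x) ⊗ x'`, as a map `T ⊗_R T' → (T ⊗_R T') ⊗_S (T ⊗_R T')`. -/
def comulD : Tens α α T T' →+ Tens β β (Tens α α T T') (Tens α α T T') :=
  assoc.toAddMonoidHom.comp (map H.γ' H.γ'_right (AddMonoidHom.id T') (leftLin_id α))

/-- `(T ⊗ T' ⊗ ev') ∘ (γ ⊗ T') : T ⊗_R T' → (T ⊗_R T') ⊗_S B`. -/
def ξD : Tens α α T T' →+ Tens β β (Tens α α T T') B :=
  (map (AddMonoidHom.id _) (rightLin_id β) H.ev' H.ev'_leftLin).comp H.comulD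

theorem ξD_smul (s : S) (z : Tens α α T T') : H.ξD (β s • z) = β s • H.ξD z := by
  have h1 := leftLin_map (τ := β) (τ' := β) H.γ' H.γ'_right (AddMonoidHom.id T')
    (leftLin_id α) H.γ'_left s z
  have h2 := leftLin_map (τ := β) (τ' := β) (AddMonoidHom.id (Tens α α T T')) (rightLin_id β)
    H.ev' H.ev'_leftLin (leftLin_id β) s
  simp only [ξD, comulD, AddMonoidHom.comp_apply, AddEquiv.coe_toAddMonoidHom]
  rw [h1, assoc_smul, h2]

theorem ξD_op_smul (b : B) (z : Tens α α T T') : H.ξD (op b • z) = op b • H.ξD z := by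
  have h1 := rightLin_map (τ := RingHom.id B) (τ' := RingHom.id B) H.γ' H.γ'_right
    (AddMonoidHom.id T') (leftLin_id α) (rightLin_id _) b z
  have h2 := rightLin_map (τ := RingHom.id B) (τ' := RingHom.id B)
    (AddMonoidHom.id (Tens α α T T')) (rightLin_id β) H.ev' H.ev'_leftLin
    (fun b z => H.ev'_right b z) b
  simp only [RingHom.id_apply] at h1 h2
  simp only [ξD, comulD, AddMonoidHom.comp_apply, AddEquiv.coe_toAddMonoidHom]
  rw [h1, assoc_op_smul, h2]

/-- The equaliser `D` of `ξD` and `z ↦ z ⊗ 1_B` in `T ⊗_R T'`. -/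
def D : AddSubgroup (Tens α α T T') where
  carrier := {z | H.ξD z = tmul β β z (1 : B)}
  zero_mem' := by
    show H.ξD 0 = _
    rw [map_zero, zero_tmul]
  add_mem' := by
    intro x y hx hy
    show H.ξD (x + y) = _
    rw [map_add, tmul_add_left, show H.ξD x = _ from hx, show H.ξD y = _ from hy]
  neg_mem' := by
    intro x hx
    show H.ξD (-x) = _
    have h := tmul_add_left β β x (-x) (1 : B)
    rw [add_neg_cancel, zero_tmul] at h
    rw [map_neg, show H.ξD x = _ from hx]
    exact neg_eq_of_add_eq_zero_right h.symm

theorem D_smul_mem (s : S) {z : Tens α α T T'} (hz : z ∈ H.D) : β s • z ∈ H.D := by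
  show H.ξD _ = _
  rw [ξD_smul, show H.ξD z = _ from hz, smul_tmul]

theorem D_op_smul_mem (s : S) {z : Tens α α T T'} (hz : z ∈ H.D) : op (β s) • z ∈ H.D := by
  show H.ξD _ = _
  rw [ξD_op_smul, show H.ξD z = _ from hz, op_smul_tmul, tmul_bal]
  simp

instance : Module S H.D where
  smul s d := ⟨β s • (d : Tens α α T T'), H.D_smul_mem s d.2⟩
  one_smul c := Subtype.ext <| show β 1 • (c : Tens α α T T') = c by simp
  mul_smul r s c := Subtype.ext <|
    show β (r * s) • (c : Tens α α T T') = β r • β s • (c : Tens α α T T') by simp [mul_smul]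
  smul_zero r := Subtype.ext <| show β r • (0 : Tens α α T T') = 0 by simp
  smul_add r c d := Subtype.ext <| smul_add (β r) (c : Tens α α T T') d
  add_smul r s c := Subtype.ext <| show β (r + s) • (c : Tens α α T T') = β r • c + β s • c by
    simp [add_smul]
  zero_smul c := Subtype.ext <| show β 0 • (c : Tens α α T T') = 0 by simp

instance : Module Sᵐᵒᵖ H.D where
  smul s d := ⟨op (β s.unop) • (d : Tens α α T T'), H.D_op_smul_mem s.unop d.2⟩
  one_smul c := Subtype.ext <| show op (β 1) • (c : Tens α α T T') = c by simp
  mul_smul r s c := Subtype.ext <|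
    show op (β (s.unop * r.unop)) • (c : Tens α α T T') =
      op (β r.unop) • op (β s.unop) • (c : Tens α α T T') by simp [mul_smul]
  smul_zero r := Subtype.ext <| show op (β r.unop) • (0 : Tens α α T T') = 0 by simp
  smul_add r c d := Subtype.ext <| smul_add (op (β r.unop)) (c : Tens α α T T') d
  add_smul r s c := Subtype.ext <|
    show op (β (r.unop + s.unop)) • (c : Tens α α T T') =
      op (β r.unop) • (c : Tens α α T T') + op (β s.unop) • (c : Tens α α T T') by simp [add_smul]
  zero_smul c := Subtype.ext <| show op (β 0) • (c : Tens α α T T') = 0 by simp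

instance : SMulCommClass S Sᵐᵒᵖ H.D where
  smul_comm r s c := Subtype.ext <| smul_comm (β r) (op (β s.unop)) (c : Tens α α T T')

/-- The inclusion `D → T ⊗_R T'`. -/
def ιD : H.D →+ Tens α α T T' := H.D.subtype

theorem ιD_left : LeftLin (RingHom.id S) β H.ιD := fun _ _ => rfl

theorem ιD_right : RightLin (RingHom.id S) β H.ιD := fun _ _ => rfl

/-- `C ⊗_R C → (T' ⊗_S T) ⊗_R (T' ⊗_S T)`. -/
def inclCC : Tens (RingHom.id R) (RingHom.id R) H.C H.C →+
    Tens α α (Tens β β T' T) (Tens β β T' T) :=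
  map H.ιC H.ιC_right H.ιC H.ιC_left

/-- `M ⊗_R C → M ⊗_R (T' ⊗_S T)` for a right `A`-module `M`. -/
def inclC (M : Type*) [AddCommGroup M] [Module Aᵐᵒᵖ M] :
    Tens α (RingHom.id R) M H.C →+ Tens α α M (Tens β β T' T) :=
  map (AddMonoidHom.id M) (rightLin_id α) H.ιC H.ιC_left

/-- `D ⊗_S D → (T ⊗_R T') ⊗_S (T ⊗_R T')`. -/
def inclDD : Tens (RingHom.id S) (RingHom.id S) H.D H.D →+
    Tens β β (Tens α α T T') (Tens α α T T') :=
  map H.ιD H.ιD_right H.ιD H.ιD_left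

/-- `D ⊗_S N → (T ⊗_R T') ⊗_S N` for a left `B`-module `N`. -/
def inclD (N : Type*) [AddCommGroup N] [Module B N] :
    Tens (RingHom.id S) β H.D N →+ Tens β β (Tens α α T T') N :=
  map H.ιD H.ιD_right (AddMonoidHom.id N) (leftLin_id β)

end Herd

end Herd

end BimoduleHerd

end

open BimoduleHerd

noncomputable section

namespace BimoduleHerd

/-! ### Calculus of tensor products over a noncommutative ring -/

namespace Tens

section General

variable {R A₁ A₂ : Type*} [Ring R] [Ring A₁] [Ring A₂] {ρ : R →+* A₁} {σ : R →+* A₂}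
  {M N : Type*} [AddCommGroup M] [AddCommGroup N] [Module A₁ᵐᵒᵖ M] [Module A₂ N]

/-! Write `X = T' ⊗_S T`. The map `ξ : X → A ⊗_R X`, `x' ⊗ x ↦ ev(x' ⊗ x¹) ⊗ x² ⊗ x³`, is a descent
datum along `α` on the left `A`-module `X`: it is `A`-linear, it is a section of the action `A ⊗_R X
→ X` (`lact_ξC`), and `(A ⊗ ξ) ξ = (A ⊗ 1 ⊗ -) ξ` (`ξC_ξC`). The elements of `C` are the descended
ones, `ξ(z) = 1 ⊗ z`, so one expects `X ≅ A ⊗_R C`. The argument rests on three properties.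

`LiftC`: `ξ` factors through `A ⊗_R C`. Then for every right `A`-module `M` the map `m ⊗ z ↦ m ξ(z)`
retracts `M ⊗_R C → M ⊗_R X`, and its image is where `M ⊗ ξ` and `M ⊗ (1 ⊗ -)` agree. `IsPureC`: the
equaliser defining `C` survives `- ⊗_R N` for left `R`-modules `N`. This handles `C ⊗_R C`, whose
left factor is not an `A`-module. `IsEffectiveMono`: `R` is the equaliser of `A ⇉ A ⊗_R A`. This
forces `ev` to take values in `R` on `C`.

If `α` splits by `π`, then `(π ⊗ X) ξ` is an `R`-bimodule retraction of `X` onto `C`, and the first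
two properties follow. If `T` is faithfully flat, coassociativity places `γ(x)` in `T ⊗_R C`, and
applying `ev(x' ⊗ -)` places `ξ(x' ⊗ x)` in the image of `A ⊗_R C`. Injectivity of `A ⊗_R C → A ⊗_R
X` follows because `T ⊗ -` annihilates the inclusion of the kernel. Purity holds because the
sequence in question becomes split after `T ⊗ -`. Flatness of `A` serves the third property.

The coproduct is then the restriction of `x' ⊗ x ↦ x' ⊗ γ(x)`, and `ψ(c ⊗ a) = ξ(c a)` is the right
`A`-action of `X` transported to `A ⊗_R C`. Most axioms are checked after an injection into tensor
powers of `X`, where they reduce to identities of the herd (`comulC_coassoc`, `ξC_comulC`,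
`comulC_ev`, `entC_comulC`, `entC_γ`).

The statement for `D` is the mirror image, with `Y = T ⊗_R T'`, `ξ(x ⊗ x') = x¹ ⊗ x² ⊗ ev'(x³ ⊗
x')`, and `γ` rebracketed as `γ'`. -/

theorem hom_congr {P : Type*} [AddCommGroup P] {f g : Tens ρ σ M N →+ P}
    (h : ∀ m n, f (tmul ρ σ m n) = g (tmul ρ σ m n)) (z : Tens ρ σ M N) : f z = g z :=
  DFunLike.congr_fun (hom_ext h) z

theorem map_sub_left {A₁' A₂' M' N' : Type*} [Ring A₁'] [Ring A₂'] {ρ' : R →+* A₁'}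
    {σ' : R →+* A₂'} [AddCommGroup M'] [AddCommGroup N'] [Module A₁'ᵐᵒᵖ M'] [Module A₂' N']
    (f f' : M →+ M') (hf : RightLin ρ ρ' f) (hf' : RightLin ρ ρ' f')
    (h : RightLin ρ ρ' (f - f')) (g : N →+ N') (hg : LeftLin σ σ' g) (z : Tens ρ σ M N) :
    map (f - f') h g hg z = map f hf g hg z - map f' hf' g hg z := by
  refine hom_congr (f := map (f - f') h g hg) (g := map f hf g hg - map f' hf' g hg)
    (fun m n => ?_) z
  rw [AddMonoidHom.sub_apply, map_tmul, map_tmul, map_tmul, eq_sub_iff_add_eq, ← tmul_add_left]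
  simp

theorem map_sub_right {A₁' A₂' M' N' : Type*} [Ring A₁'] [Ring A₂'] {ρ' : R →+* A₁'}
    {σ' : R →+* A₂'} [AddCommGroup M'] [AddCommGroup N'] [Module A₁'ᵐᵒᵖ M'] [Module A₂' N']
    (f : M →+ M') (hf : RightLin ρ ρ' f) (g g' : N →+ N') (hg : LeftLin σ σ' g)
    (hg' : LeftLin σ σ' g') (h : LeftLin σ σ' (g - g')) (z : Tens ρ σ M N) :
    map f hf (g - g') h z = map f hf g hg z - map f hf g' hg' z := by
  refine hom_congr (f := map f hf (g - g') h) (g := map f hf g hg - map f hf g' hg')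
    (fun m n => ?_) z
  rw [AddMonoidHom.sub_apply, map_tmul, map_tmul, map_tmul, eq_sub_iff_add_eq, ← tmul_add_right]
  simp

theorem map_zero_right {A₁' A₂' M' N' : Type*} [Ring A₁'] [Ring A₂'] {ρ' : R →+* A₁'}
    {σ' : R →+* A₂'} [AddCommGroup M'] [AddCommGroup N'] [Module A₁'ᵐᵒᵖ M'] [Module A₂' N']
    (f : M →+ M') (hf : RightLin ρ ρ' f) (h : LeftLin σ σ' (0 : N →+ N')) :
    map f hf (0 : N →+ N') h = 0 :=
  hom_ext fun _ _ => tmul_zero ..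

theorem map_zero_left {A₁' A₂' M' N' : Type*} [Ring A₁'] [Ring A₂'] {ρ' : R →+* A₁'}
    {σ' : R →+* A₂'} [AddCommGroup M'] [AddCommGroup N'] [Module A₁'ᵐᵒᵖ M'] [Module A₂' N']
    (h : RightLin ρ ρ' (0 : M →+ M')) (g : N →+ N') (hg : LeftLin σ σ' g) :
    map (0 : M →+ M') h g hg = 0 :=
  hom_ext fun _ _ => zero_tmul ..

theorem lid_injective (N : Type*) [AddCommGroup N] [Module A₂ N] :
    Function.Injective (lid σ N) := by
  refine Function.LeftInverse.injective
    (g := fun n => tmul (RingHom.id R) σ 1 n) fun z => ?_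
  refine hom_congr (f := (AddMonoidHom.mk' (fun n => tmul (RingHom.id R) σ 1 n)
    (tmul_add_right _ _ _)).comp (lid σ N)) (g := AddMonoidHom.id _) (fun r n => ?_) z
  change tmul (RingHom.id R) σ 1 (σ r • n) = tmul _ _ r n
  rw [← tmul_bal]; simp

end General

section Units

variable {R A : Type*} [Ring R] [Ring A]

/-- `n ↦ 1 ⊗ n`. -/
def unitL (α : R →+* A) (N : Type*) [AddCommGroup N] [Module A N] : N →+ Tens α α A N :=
  AddMonoidHom.mk' (fun n => tmul α α 1 n) (tmul_add_right α α 1)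

theorem unitL_apply (α : R →+* A) {N : Type*} [AddCommGroup N] [Module A N] (n : N) :
    unitL α N n = tmul α α 1 n := rfl

theorem unitL_left (α : R →+* A) (N : Type*) [AddCommGroup N] [Module A N] :
    LeftLin α α (unitL α N) := fun r n => by
  rw [unitL_apply, unitL_apply, smul_tmul, ← tmul_bal]; simp

theorem unitL_right (α : R →+* A) (N : Type*) [AddCommGroup N] [Module A N] {L : Type*} [Ring L]
    [Module Lᵐᵒᵖ N] [SMulCommClass A Lᵐᵒᵖ N] (τ : R →+* L) :
    RightLin τ τ (unitL α N) := fun _ _ => rfl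

/-- `n ↦ n ⊗ 1`. -/
def unitR (α : R →+* A) (N : Type*) [AddCommGroup N] [Module Aᵐᵒᵖ N] : N →+ Tens α α N A :=
  AddMonoidHom.mk' (fun n => tmul α α n 1) (fun n n' => tmul_add_left α α n n' 1)

theorem unitR_apply (α : R →+* A) {N : Type*} [AddCommGroup N] [Module Aᵐᵒᵖ N] (n : N) :
    unitR α N n = tmul α α n 1 := rfl

theorem unitR_right (α : R →+* A) (N : Type*) [AddCommGroup N] [Module Aᵐᵒᵖ N] :
    RightLin α α (unitR α N) := fun r n => by
  rw [unitR_apply, unitR_apply, op_smul_tmul, tmul_bal]; simp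

theorem unitR_left (α : R →+* A) (N : Type*) [AddCommGroup N] [Module Aᵐᵒᵖ N] {K : Type*} [Ring K]
    [Module K N] [SMulCommClass K Aᵐᵒᵖ N] (τ : R →+* K) :
    LeftLin τ τ (unitR α N) := fun _ _ => rfl

/-- `m ⊗ (a ⊗ n) ↦ m a ⊗ n`. -/
def actR {K : Type*} [Ring K] (α : R →+* A) (σ : R →+* K) (M N : Type*) [AddCommGroup M]
    [Module Aᵐᵒᵖ M] [AddCommGroup N] [Module K N] :
    Tens α α M (Tens α σ A N) →+ Tens α σ M N :=
  (map (ract α M) (fun r z => by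
      induction z using Tens.induction with
      | zero => simp
      | tmul m a => simp only [op_smul_tmul, ract, lift_tmul, op_smul_eq_mul, op_mul, mul_smul]
      | add x y hx hy => rw [smul_add, map_add, hx, hy, map_add, smul_add])
    (AddMonoidHom.id N) (leftLin_id σ)).comp
  (assoc (ρ := α) (σ := α) (ρ' := α) (σ' := σ)).symm.toAddMonoidHom

/-- `(m ⊗ a) ⊗ n ↦ m ⊗ a n`. -/
def actL {K : Type*} [Ring K] (α : R →+* A) (ρ : R →+* K) (M N : Type*) [AddCommGroup M]
    [Module Kᵐᵒᵖ M] [AddCommGroup N] [Module A N] :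
    Tens α α (Tens ρ α M A) N →+ Tens ρ α M N :=
  (map (AddMonoidHom.id M) (rightLin_id ρ) (lact α N) (fun r z => by
      induction z using Tens.induction with
      | zero => simp
      | tmul a m => simp only [smul_tmul, lact, lift_tmul, smul_eq_mul, mul_smul]
      | add x y hx hy => rw [smul_add, map_add, hx, hy, map_add, smul_add])).comp
  (assoc (ρ := ρ) (σ := α) (ρ' := α) (σ' := α)).toAddMonoidHom

theorem actR_tmul {K : Type*} [Ring K] (α : R →+* A) (σ : R →+* K) {M N : Type*} [AddCommGroup M]
    [Module Aᵐᵒᵖ M] [AddCommGroup N] [Module K N] (m : M) (a : A) (n : N) :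
    actR α σ M N (tmul α α m (tmul α σ a n)) = tmul α σ (op a • m) n := rfl

theorem actL_tmul {K : Type*} [Ring K] (α : R →+* A) (ρ : R →+* K) {M N : Type*} [AddCommGroup M]
    [Module Kᵐᵒᵖ M] [AddCommGroup N] [Module A N] (m : M) (a : A) (n : N) :
    actL α ρ M N (tmul α α (tmul ρ α m a) n) = tmul ρ α m (a • n) := rfl

end Units

end Tens

open Tens

/-- Preimages under an injective map are unique, so choosing them is automatically additive. The
factored `ξ`, the coproducts and the counits all arise this way. -/
theorem exists_lift_of_injective {P Q M : Type*} [AddCommGroup P] [AddCommGroup Q]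
    [AddCommGroup M] {i : P →+ Q} (hi : Function.Injective i) (f : M →+ Q)
    (hf : ∀ m, ∃ p, i p = f m) : ∃ g : M →+ P, ∀ m, i (g m) = f m := by
  choose g hg using hf
  exact ⟨AddMonoidHom.mk' g fun a b => hi (by rw [map_add, hg, hg, hg, map_add]), hg⟩

/-! ### Faithful flatness and effective monomorphisms -/

section Flatness

variable {R A K₁ K₂ K₃ : Type u} [Ring R] [Ring A] [Ring K₁] [Ring K₂] [Ring K₃]
  {X Y Z M : Type u} [AddCommGroup X] [AddCommGroup Y] [AddCommGroup Z] [AddCommGroup M]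

/-- The definition tests modules over `R` itself. Restricting scalars along the `σᵢ` produces such
modules without changing the tensor products, even definitionally. -/
theorem RightFaithfullyFlat.exact_iff [Module K₁ X] [Module K₂ Y] [Module K₃ Z] [Module Aᵐᵒᵖ M]
    {ρ : R →+* A} (h : RightFaithfullyFlat ρ M)
    {σ₁ : R →+* K₁} {σ₂ : R →+* K₂} {σ₃ : R →+* K₃} (f : X →+ Y) (g : Y →+ Z)
    (hf : LeftLin σ₁ σ₂ f) (hg : LeftLin σ₂ σ₃ g) :
    Function.Exact f g ↔ Function.Exact (map (AddMonoidHom.id M) (rightLin_id ρ) f hf)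
        (map (AddMonoidHom.id M) (rightLin_id ρ) g hg) :=
  letI := Module.compHom X σ₁
  letI := Module.compHom Y σ₂
  letI := Module.compHom Z σ₃
  h X Y Z f g hf hg

theorem LeftFaithfullyFlat.exact_iff [Module K₁ᵐᵒᵖ X] [Module K₂ᵐᵒᵖ Y] [Module K₃ᵐᵒᵖ Z] [Module A M]
    {ρ : R →+* A} (h : LeftFaithfullyFlat ρ M)
    {σ₁ : R →+* K₁} {σ₂ : R →+* K₂} {σ₃ : R →+* K₃} (f : X →+ Y) (g : Y →+ Z)
    (hf : RightLin σ₁ σ₂ f) (hg : RightLin σ₂ σ₃ g) :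
    Function.Exact f g ↔ Function.Exact (map f hf (AddMonoidHom.id M) (leftLin_id ρ))
        (map g hg (AddMonoidHom.id M) (leftLin_id ρ)) :=
  letI := Module.compHom X σ₁.op
  letI := Module.compHom Y σ₂.op
  letI := Module.compHom Z σ₃.op
  h X Y Z f g hf hg

theorem exact_zero_iff {P Q : Type*} [AddCommGroup P] [AddCommGroup Q] {L : Type*} [AddCommGroup L]
    (g : P →+ Q) : Function.Exact (0 : L →+ P) g ↔ Function.Injective g := by
  rw [injective_iff_map_eq_zero]
  constructor
  · intro h a ha
    obtain ⟨_, rfl⟩ := (h a).1 ha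
    rfl
  · intro h a
    refine ⟨fun ha => ⟨0, (h a ha).symm⟩, ?_⟩
    rintro ⟨_, rfl⟩
    exact map_zero g

theorem RightFaithfullyFlat.injective_iff [Module K₂ Y] [Module K₃ Z] [Module Aᵐᵒᵖ M]
    {ρ : R →+* A} (h : RightFaithfullyFlat ρ M)
    {σ₂ : R →+* K₂} {σ₃ : R →+* K₃} (g : Y →+ Z) (hg : LeftLin σ₂ σ₃ g) :
    Function.Injective g ↔
      Function.Injective (map (AddMonoidHom.id M) (rightLin_id ρ) g hg) := by
  -- Injectivity is exactness at `Y` with a zero map coming in; the zero endomorphism of `Y` plays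
  -- that part.
  have h0 : LeftLin σ₂ σ₂ (0 : Y →+ Y) := fun r m => by simp
  rw [← exact_zero_iff (L := Y), h.exact_iff _ _ h0 hg, map_zero_right, exact_zero_iff]

theorem LeftFaithfullyFlat.injective_iff [Module K₂ᵐᵒᵖ Y] [Module K₃ᵐᵒᵖ Z] [Module A M]
    {ρ : R →+* A} (h : LeftFaithfullyFlat ρ M)
    {σ₂ : R →+* K₂} {σ₃ : R →+* K₃} (g : Y →+ Z) (hg : RightLin σ₂ σ₃ g) :
    Function.Injective g ↔
      Function.Injective (map g hg (AddMonoidHom.id M) (leftLin_id ρ)) := by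
  have h0 : RightLin σ₂ σ₂ (0 : Y →+ Y) := fun r m => by simp
  rw [← exact_zero_iff (L := Y), h.exact_iff _ _ h0 hg, map_zero_left, exact_zero_iff]

/-- `R → A → A ⊗_R A` is an equaliser diagram of sets. -/
def IsEffectiveMono (α : R →+* A) : Prop :=
  Function.Injective α ∧ ∀ a : A, tmul α α a (1 : A) = tmul α α 1 a → ∃ r, α r = a

end Flatness

section EffectiveMono

variable {R A : Type u} [Ring R] [Ring A] {α : R →+* A}

/-- Applying `π ⊗ A` and then the action to `a ⊗ 1 = 1 ⊗ a` gives `α(π a) = a`. -/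
theorem SplitExtension.isEffectiveMono (h : SplitExtension α) : IsEffectiveMono α := by
  obtain ⟨π, hl, hr, h1⟩ := h
  refine ⟨Function.LeftInverse.injective h1, fun a ha => ⟨π a, ?_⟩⟩
  have hr' : RightLin α (RingHom.id R) π := fun r a => hr a r
  have := congrArg (fun z => lid α A (map π hr' (AddMonoidHom.id A) (leftLin_id α) z)) ha
  have e1 : π 1 = 1 := by simpa using h1 1
  simpa [map_tmul, lid, lift_tmul, e1] using this

theorem rid_injective {R A : Type*} [Ring R] [Ring A] (α : R →+* A) (N : Type*) [AddCommGroup N]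
    [Module Aᵐᵒᵖ N] : Function.Injective (rid α N) := by
  refine Function.LeftInverse.injective
    (g := fun n => tmul α (RingHom.id R) n 1) fun z => ?_
  refine hom_congr (f := (AddMonoidHom.mk' (fun n => tmul α (RingHom.id R) n 1)
    (fun n n' => tmul_add_left _ _ n n' 1)).comp (rid α N)) (g := AddMonoidHom.id _)
    (fun n r => ?_) z
  change tmul α (RingHom.id R) (op (α r) • n) 1 = tmul _ _ n r
  rw [tmul_bal]; simp

/-- After `A ⊗_R -` the sequence `R → A → A ⊗_R A` is contracted by the multiplication of `A`, hence
exact, and faithful flatness reflects this. Likewise `A ⊗_R R → A ⊗_R A` is injective since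
multiplication composes with it to the canonical map `A ⊗_R R → A`. -/
theorem RightFaithfullyFlat.isEffectiveMono (h : RightFaithfullyFlat α A) :
    IsEffectiveMono α := by
  have hα : LeftLin (RingHom.id R) α α.toAddMonoidHom := fun r m => by simp
  have hg : LeftLin α α (unitL α A - unitR α A) := fun r m => by
    simp only [AddMonoidHom.sub_apply, unitL_left α A r m, unitR_left α A α r m, smul_sub]
  refine ⟨(h.injective_iff α.toAddMonoidHom hα).2 (Function.Injective.of_comp
    (f := ract α A) ?_), ?_⟩
  · rw [show ⇑(ract α A) ∘ ⇑(map (AddMonoidHom.id A) (rightLin_id α) α.toAddMonoidHom hα) =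
      rid α A from funext fun z => hom_congr (f := (ract α A).comp (map (AddMonoidHom.id A)
        (rightLin_id α) α.toAddMonoidHom hα)) (g := rid α A) (fun _ _ => rfl) z]
    exact rid_injective α A
  · have hex : Function.Exact α.toAddMonoidHom (unitL α A - unitR α A) := by
      rw [h.exact_iff _ _ hα hg]
      intro z
      constructor
      · intro hz
        rw [map_sub_right _ _ _ _ (unitL_left α A) (unitR_left α A α), sub_eq_zero] at hz
        -- Multiplying the first two factors undoes `a ⊗ b ↦ a ⊗ 1 ⊗ b` and sends `a ⊗ b ⊗ 1` to `ab
        -- ⊗ 1`. If the two insertions of `1` agree on `z`, then `z` is its own product tensored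
        -- with `1`, so it comes from `A ⊗_R R`.
        have h1 : ∀ z, actR α α A A (map (AddMonoidHom.id A) (rightLin_id α) (unitL α A)
            (unitL_left α A) z) = z :=
          hom_congr (f := (actR α α A A).comp (map _ _ _ _)) (g := AddMonoidHom.id _)
            fun m n => by
              change tmul α α (op (1 : A) • m) n = tmul _ _ m n
              rw [op_one, one_smul]
        have h2 : ∀ z, actR α α A A (map (AddMonoidHom.id A) (rightLin_id α) (unitR α A)
            (unitR_left α A α) z) = tmul α α (ract α A z) 1 :=
          hom_congr (f := (actR α α A A).comp (map _ _ _ _)) (g := (unitR α A).comp (ract α A))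
            fun m n => rfl
        refine ⟨tmul _ _ (ract α A z) 1, ?_⟩
        have h3 := h1 z
        rw [hz, h2] at h3
        rw [map_tmul]
        simpa using h3
      · rintro ⟨z, rfl⟩
        refine hom_congr (f := (map _ (rightLin_id α) _ hg).comp
          (map _ (rightLin_id α) _ hα)) (g := 0) (fun m n => ?_) z
        simp only [AddMonoidHom.comp_apply, map_tmul, AddMonoidHom.sub_apply, unitL_apply,
          unitR_apply, AddMonoidHom.zero_apply]
        have : tmul α α 1 (α.toAddMonoidHom n) = tmul α α (α.toAddMonoidHom n) 1 := by
          have := tmul_bal α α n (1 : A) (1 : A)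
          simpa using this.symm
        rw [this, sub_self, Tens.tmul_zero]
    intro a ha
    exact (hex a).1 (by rw [AddMonoidHom.sub_apply, unitL_apply, unitR_apply, ha, sub_self])

/-- The mirror image: the contraction now multiplies the last two of three factors. -/
theorem LeftFaithfullyFlat.isEffectiveMono (h : LeftFaithfullyFlat α A) :
    IsEffectiveMono α := by
  have hα : RightLin (RingHom.id R) α α.toAddMonoidHom := fun r m => by simp
  have hg : RightLin α α (unitR α A - unitL α A) := fun r m => by
    simp only [AddMonoidHom.sub_apply, unitL_right α A α r m, unitR_right α A r m, smul_sub]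
  refine ⟨(h.injective_iff α.toAddMonoidHom hα).2 (Function.Injective.of_comp
    (f := lact α A) ?_), ?_⟩
  · rw [show ⇑(lact α A) ∘ ⇑(map α.toAddMonoidHom hα (AddMonoidHom.id A) (leftLin_id α)) =
      lid α A from funext fun z => hom_congr (f := (lact α A).comp (map α.toAddMonoidHom hα
        (AddMonoidHom.id A) (leftLin_id α))) (g := lid α A) (fun _ _ => rfl) z]
    exact lid_injective A
  · have hex : Function.Exact α.toAddMonoidHom (unitR α A - unitL α A) := by
      rw [h.exact_iff _ _ hα hg]
      intro z
      constructor
      · intro hz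
        rw [map_sub_left _ _ (unitR_right α A) (unitL_right α A α), sub_eq_zero] at hz
        have h1 : ∀ z, actL α α A A (map (unitR α A) (unitR_right α A) (AddMonoidHom.id A)
            (leftLin_id α) z) = z :=
          hom_congr (f := (actL α α A A).comp (map _ _ _ _)) (g := AddMonoidHom.id _)
            fun m n => by
              change tmul α α m ((1 : A) • n) = tmul _ _ m n
              rw [one_smul]
        have h2 : ∀ z, actL α α A A (map (unitL α A) (unitL_right α A α) (AddMonoidHom.id A)
            (leftLin_id α) z) = tmul α α 1 (lact α A z) :=
          hom_congr (f := (actL α α A A).comp (map _ _ _ _)) (g := (unitL α A).comp (lact α A))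
            fun m n => rfl
        refine ⟨tmul _ _ 1 (lact α A z), ?_⟩
        have h3 := h1 z
        rw [hz, h2] at h3
        rw [map_tmul]
        simpa using h3
      · rintro ⟨z, rfl⟩
        refine hom_congr (f := (map _ hg _ (leftLin_id α)).comp
          (map _ hα _ (leftLin_id α))) (g := 0) (fun m n => ?_) z
        simp only [AddMonoidHom.comp_apply, map_tmul, AddMonoidHom.sub_apply, unitL_apply,
          unitR_apply, AddMonoidHom.zero_apply]
        have : tmul α α 1 (α.toAddMonoidHom m) = tmul α α (α.toAddMonoidHom m) 1 := by
          have := tmul_bal α α m (1 : A) (1 : A)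
          simpa using this.symm
        rw [this, sub_self, Tens.zero_tmul]
    intro a ha
    exact (hex a).1 (by rw [AddMonoidHom.sub_apply, unitL_apply, unitR_apply, ha, sub_self])

end EffectiveMono

namespace Tens

variable {R A₁ A₂ : Type*} [Ring R] [Ring A₁] [Ring A₂]
  {M N : Type*} [AddCommGroup M] [AddCommGroup N] [Module A₁ᵐᵒᵖ M] [Module A₂ N]

/-- `m ↦ m ⊗ n`. -/
def tmulRight (ρ : R →+* A₁) (σ : R →+* A₂) (M : Type*) [AddCommGroup M] [Module A₁ᵐᵒᵖ M] (n : N) :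
    M →+ Tens ρ σ M N :=
  AddMonoidHom.mk' (fun m => tmul ρ σ m n) (fun m m' => tmul_add_left ρ σ m m' n)

/-- `n ↦ m ⊗ n`. -/
def tmulLeft (ρ : R →+* A₁) (σ : R →+* A₂) (N : Type*) [AddCommGroup N] [Module A₂ N] (m : M) :
    N →+ Tens ρ σ M N :=
  AddMonoidHom.mk' (fun n => tmul ρ σ m n) (tmul_add_right ρ σ m)

theorem tmulLeft_right {Q L : Type*} [Ring Q] [Ring L] {ρ : R →+* A₁} {σ : R →+* A₂} (τ : Q →+* L)
    [Module Lᵐᵒᵖ N] [SMulCommClass A₂ Lᵐᵒᵖ N] (m : M) : RightLin τ τ (tmulLeft ρ σ N m) :=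
  fun _ _ => rfl

theorem tmulRight_left {Q K : Type*} [Ring Q] [Ring K] {ρ : R →+* A₁} {σ : R →+* A₂} (τ : Q →+* K)
    [Module K M] [SMulCommClass K A₁ᵐᵒᵖ M] (n : N) : LeftLin τ τ (tmulRight ρ σ M n) :=
  fun _ _ => rfl

variable {ρ : R →+* A₁} {σ : R →+* A₂} {R' A₃ A₄ P : Type*} [Ring R'] [Ring A₃] [Ring A₄]
  {ρ' : R' →+* A₃} {σ' : R' →+* A₄}
  [Module A₃ᵐᵒᵖ N] [SMulCommClass A₂ A₃ᵐᵒᵖ N] [AddCommGroup P] [Module A₄ P]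

/-- The composites are separate arguments `f''`, `g''` tied to the factors by pointwise equations.
The lemma thus also applies when a composite is only provably, not definitionally, the desired map.
-/
theorem map_comp {R A₁ A₂ A₁' A₂' A₁'' A₂'' M N M' N' M'' N'' : Type*} [Ring R] [Ring A₁]
    [Ring A₂] [Ring A₁'] [Ring A₂'] [Ring A₁''] [Ring A₂''] {ρ : R →+* A₁} {σ : R →+* A₂}
    {ρ' : R →+* A₁'} {σ' : R →+* A₂'} {ρ'' : R →+* A₁''} {σ'' : R →+* A₂''}
    [AddCommGroup M] [AddCommGroup N] [AddCommGroup M'] [AddCommGroup N'] [AddCommGroup M'']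
    [AddCommGroup N''] [Module A₁ᵐᵒᵖ M] [Module A₂ N] [Module A₁'ᵐᵒᵖ M'] [Module A₂' N']
    [Module A₁''ᵐᵒᵖ M''] [Module A₂'' N'']
    {f : M →+ M'} {hf : RightLin ρ ρ' f} {g : N →+ N'} {hg : LeftLin σ σ' g}
    {f' : M' →+ M''} {hf' : RightLin ρ' ρ'' f'} {g' : N' →+ N''} {hg' : LeftLin σ' σ'' g'}
    {f'' : M →+ M''} (hf'' : RightLin ρ ρ'' f'') {g'' : N →+ N''} (hg'' : LeftLin σ σ'' g'')
    (ef : ∀ m, f' (f m) = f'' m) (eg : ∀ n, g' (g n) = g'' n) (z : Tens ρ σ M N) :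
    map f' hf' g' hg' (map f hf g hg z) = map f'' hf'' g'' hg'' z := by
  induction z using Tens.induction with
  | zero => simp only [map_zero]
  | tmul m n => simp only [map_tmul, ef, eg]
  | add x y hx hy => simp only [map_add, hx, hy]

theorem map_comm {R A₁ A₂ A₁' A₂' M N M' N' : Type*} [Ring R] [Ring A₁]
    [Ring A₂] [Ring A₁'] [Ring A₂'] {ρ : R →+* A₁} {σ : R →+* A₂}
    {ρ' : R →+* A₁'} {σ' : R →+* A₂'}
    [AddCommGroup M] [AddCommGroup N] [AddCommGroup M'] [AddCommGroup N']
    [Module A₁ᵐᵒᵖ M] [Module A₂ N] [Module A₁'ᵐᵒᵖ M'] [Module A₂' N']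
    (f : M →+ M') (hf : RightLin ρ ρ' f) (g : N →+ N') (hg : LeftLin σ σ' g) (z : Tens ρ σ M N) :
    map f hf (AddMonoidHom.id N') (leftLin_id σ')
        (map (AddMonoidHom.id M) (rightLin_id ρ) g hg z) =
      map (AddMonoidHom.id M') (rightLin_id ρ') g hg
        (map f hf (AddMonoidHom.id N) (leftLin_id σ) z) := by
  rw [map_comp hf hg (fun _ => rfl) (fun _ => rfl), map_comp hf hg (fun _ => rfl) (fun _ => rfl)]

theorem map_assoc {R R' A₁ A₂ A₃ A₄ A₁' A₂' A₃' A₄' M N P M' N' P' : Type*} [Ring R] [Ring R']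
    [Ring A₁] [Ring A₂] [Ring A₃] [Ring A₄] [Ring A₁'] [Ring A₂'] [Ring A₃'] [Ring A₄']
    {ρ : R →+* A₁} {σ : R →+* A₂} {τ : R' →+* A₃} {υ : R' →+* A₄}
    {ρ' : R →+* A₁'} {σ' : R →+* A₂'} {τ' : R' →+* A₃'} {υ' : R' →+* A₄'}
    [AddCommGroup M] [AddCommGroup N] [AddCommGroup P]
    [AddCommGroup M'] [AddCommGroup N'] [AddCommGroup P']
    [Module A₁ᵐᵒᵖ M] [Module A₂ N] [Module A₃ᵐᵒᵖ N] [SMulCommClass A₂ A₃ᵐᵒᵖ N] [Module A₄ P]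
    [Module A₁'ᵐᵒᵖ M'] [Module A₂' N'] [Module A₃'ᵐᵒᵖ N'] [SMulCommClass A₂' A₃'ᵐᵒᵖ N']
    [Module A₄' P']
    {f : M →+ M'} {hf : RightLin ρ ρ' f} {g : N →+ N'} {hg : LeftLin σ σ' g}
    {hg' : RightLin τ τ' g} {h : P →+ P'} {hh : LeftLin υ υ' h}
    (hfg : RightLin τ τ' (map f hf g hg)) (hgh : LeftLin σ σ' (map g hg' h hh))
    (z : Tens τ υ (Tens ρ σ M N) P) :
    assoc (map (map f hf g hg) hfg h hh z) = map f hf (map g hg' h hh) hgh (assoc z) := by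
  induction z using Tens.induction with
  | zero => simp only [map_zero]
  | add x y hx hy => simp only [map_add, hx, hy]
  | tmul w p =>
    induction w using Tens.induction with
    | zero => simp only [map_zero, zero_tmul]
    | add x y hx hy => simp only [map_add, tmul_add_left, hx, hy]
    | tmul m n => rfl

end Tens

/-! ### Herd identities for `ξ`, `γ` and the evaluations: the `C` side -/

namespace Herd

variable {R S A B : Type*} [Ring R] [Ring S] [Ring A] [Ring B] {α : R →+* A} {β : S →+* B}
  {T T' : Type*} [AddCommGroup T] [Module B T] [Module Aᵐᵒᵖ T] [SMulCommClass B Aᵐᵒᵖ T]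
  [AddCommGroup T'] [Module A T'] [Module Bᵐᵒᵖ T'] [SMulCommClass A Bᵐᵒᵖ T'] (H : Herd α β T T')

/-- The law `ev'(x¹ ⊗ x²) ⊗ x³ = 1 ⊗ x` as a rule of calculation: a map that sees its first two
arguments only through `ev'` is evaluated at `γ(x)` by contracting them. `apply_γ_of_ev` does the
same for the other law. -/
theorem apply_γ_of_ev' {N : Type*} [AddCommGroup N] (F : Tens α α T (Tens β β T' T) →+ N)
    (G : Tens β β B T →+ N)
    (h : ∀ t t' y, F (tmul α α t (tmul β β t' y)) = G (tmul β β (H.ev' (tmul α α t t')) y))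
    (x : T) : F (H.γ x) = G (tmul β β 1 x) := by
  rw [← H.ev'_γ]
  generalize H.γ x = w
  induction w using Tens.induction with
  | zero => simp only [map_zero]
  | add x y hx hy => simp only [map_add, hx, hy]
  | tmul t z =>
    induction z using Tens.induction with
    | zero => simp only [tmul_zero, map_zero]
    | add x y hx hy => simp only [map_add, tmul_add_right, hx, hy]
    | tmul t' y => exact h t t' y

theorem apply_γ_of_ev {N : Type*} [AddCommGroup N] (F : Tens α α T (Tens β β T' T) →+ N)
    (G : Tens α α T A →+ N)
    (h : ∀ t z, F (tmul α α t z) = G (tmul α α t (H.ev z)))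
    (x : T) : F (H.γ x) = G (tmul α α x 1) := by
  rw [← H.ev_γ]
  generalize H.γ x = w
  induction w using Tens.induction with
  | zero => simp only [map_zero]
  | add x y hx hy => simp only [map_add, hx, hy]
  | tmul t z => exact h t z

section Right

variable {K : Type*} [Ring K] {σ : R →+* K} {N : Type*} [AddCommGroup N] [Module K N]

/-- `t ⊗ n ↦ (x' ⊗ t) ⊗ n`. -/
def penC (β : S →+* B) (σ : R →+* K) (N : Type*) [AddCommGroup N] [Module K N] (x' : T') :
    Tens α σ T N →+ Tens α σ (Tens β β T' T) N :=
  map (tmulLeft β β T x') (tmulLeft_right α x') (AddMonoidHom.id N) (leftLin_id σ)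

/-- `t ⊗ n ↦ ev(x' ⊗ t) ⊗ n`. -/
def evC (σ : R →+* K) (N : Type*) [AddCommGroup N] [Module K N] (x' : T') :
    Tens α σ T N →+ Tens α σ A N :=
  map (H.ev.comp (tmulLeft β β T x')) (fun r m => H.ev_right (α r) (tmul β β x' m))
    (AddMonoidHom.id N) (leftLin_id σ)

theorem comulC_tmul (x' : T') (x : T) : H.comulC (tmul β β x' x) = penC β α _ x' (H.γ x) := rfl

theorem map_ev_penC (x' : T') (z : Tens α σ T N) :
    map H.ev H.ev_rightLin (AddMonoidHom.id N) (leftLin_id σ) (penC β σ N x' z) =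
      H.evC σ N x' z :=
  map_comp _ _ (fun _ => rfl) (fun _ => rfl) z

theorem ξC_tmul (x' : T') (x : T) : H.ξC (tmul β β x' x) = H.evC α _ x' (H.γ x) :=
  H.map_ev_penC x' (H.γ x)

theorem comulC_left : LeftLin α α H.comulC := fun r z => by
  have h := leftLin_map (τ := α) (τ' := α) (AddMonoidHom.id T')
    (rightLin_id β) H.γ H.γ_left (leftLin_id α) r z
  simp only [comulC, AddMonoidHom.comp_apply, AddEquiv.coe_toAddMonoidHom]
  rw [h, assoc_symm_smul]

theorem comulC_right : RightLin α α H.comulC := fun r z => by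
  have h := rightLin_map (τ := α) (τ' := α) (AddMonoidHom.id T')
    (rightLin_id β) H.γ H.γ_left H.γ_right r z
  simp only [comulC, AddMonoidHom.comp_apply, AddEquiv.coe_toAddMonoidHom]
  rw [h, assoc_symm_op_smul]

theorem ev_leftLin : LeftLin α α H.ev := fun r z => H.ev_left (α r) z

theorem ξC_left : LeftLin α α H.ξC := fun r z => H.ξC_smul (α r) z

theorem ξC_right : RightLin α α H.ξC := H.ξC_op_smul

/-- In Sweedler form: `ev(x' ⊗ x¹) x² ⊗ x³ = x' ev'(x¹ ⊗ x²) ⊗ x³ = x' ⊗ x`, by the compatibility of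
the two evaluations and the `ev'` law. -/
theorem lact_ξC (z : Tens β β T' T) : lact α _ (H.ξC z) = z := by
  induction z using Tens.induction with
  | zero => simp only [map_zero]
  | add x y hx hy => simp only [map_add, hx, hy]
  | tmul x' x =>
    rw [ξC_tmul]
    have hl : RightLin β β (AddMonoidHom.mk' (fun b : B => op b • x')
      fun b c => by rw [op_add, add_smul]) := fun r b => by simp [mul_smul]
    refine (H.apply_γ_of_ev' ((lact α _).comp (H.evC α _ x'))
      (map _ hl (AddMonoidHom.id T) (leftLin_id β)) (fun t t' y => ?_) x).trans ?_
    · change tmul β β (H.ev (tmul β β x' t) • t') y = tmul β β (op (H.ev' (tmul α α t t')) • x') y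
      rw [H.ev_smul]
    · change tmul β β (op (1 : B) • x') x = _
      rw [op_one, one_smul]

/-- Coassociativity of `γ`, rebracketed from `T ⊗ (T' ⊗ (T ⊗ X))` to `T ⊗ (X ⊗ X)` so that it
involves `comulC`. -/
theorem γ_comulC (x : T) :
    map (AddMonoidHom.id T) (rightLin_id α) H.comulC H.comulC_left (H.γ x) =
      assoc (map H.γ H.γ_right (AddMonoidHom.id _) (leftLin_id α) (H.γ x)) := by
  have hs : LeftLin α α (assoc (ρ := β) (σ := β) (ρ' := α) (σ' := α) (M := T') (N := T)
      (P := Tens β β T' T)).symm.toAddMonoidHom := fun r z => assoc_symm_smul (α r) z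
  have h := congrArg (map (AddMonoidHom.id T) (rightLin_id α) _ hs) (H.γ_coassoc x)
  refine Eq.trans ?_ (h.symm.trans ?_)
  · generalize H.γ x = w
    symm
    exact map_comp (rightLin_id α) H.comulC_left (fun _ => rfl) (fun _ => rfl) w
  · generalize assoc (map H.γ H.γ_right (AddMonoidHom.id _) (leftLin_id α) (H.γ x)) = w
    induction w using Tens.induction with
    | zero => simp only [map_zero]
    | add x y hx hy => simp only [map_add, hx, hy]
    | tmul t z =>
      change tmul α α t (assoc.symm (assoc z)) = _
      rw [AddEquiv.symm_apply_apply]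

theorem penC_map {K' : Type*} [Ring K'] {σ' : R →+* K'} {N' : Type*} [AddCommGroup N']
    [Module K' N']
    (g : N →+ N') (hg : LeftLin σ σ' g) (x' : T') (z : Tens α σ T N) :
    penC β σ' N' x' (map (AddMonoidHom.id T) (rightLin_id α) g hg z) =
      map (AddMonoidHom.id _) (rightLin_id α) g hg (penC β σ N x' z) :=
  map_comm ..

theorem evC_map {K' : Type*} [Ring K'] {σ' : R →+* K'} {N' : Type*} [AddCommGroup N']
    [Module K' N']
    (g : N →+ N') (hg : LeftLin σ σ' g) (x' : T') (z : Tens α σ T N) :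
    H.evC σ' N' x' (map (AddMonoidHom.id T) (rightLin_id α) g hg z) =
      map (AddMonoidHom.id _) (rightLin_id α) g hg (H.evC σ N x' z) :=
  map_comm ..

theorem penC_assoc {L : Type*} [Ring L] {τ : R →+* L} {Q : Type*} [AddCommGroup Q]
    [Module L Q] [Module Aᵐᵒᵖ N] [SMulCommClass K Aᵐᵒᵖ N] (x' : T')
    (z : Tens α τ (Tens α σ T N) Q) :
    penC β σ _ x' (assoc z) = assoc (map (penC β σ N x') (rightLin_map _ _ _ _ (rightLin_id α))
      (AddMonoidHom.id Q) (leftLin_id τ) z) := by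
  induction z using Tens.induction with
  | zero => simp only [map_zero]
  | add x y hx hy => simp only [map_add, hx, hy]
  | tmul w p =>
    induction w using Tens.induction with
    | zero => simp only [map_zero, zero_tmul]
    | add x y hx hy => simp only [map_add, tmul_add_left, hx, hy]
    | tmul m n => rfl

theorem comulC_coassoc (z : Tens β β T' T) :
    map (AddMonoidHom.id _) (rightLin_id α) H.comulC H.comulC_left (H.comulC z) =
      assoc (map H.comulC H.comulC_right (AddMonoidHom.id _) (leftLin_id α) (H.comulC z)) := by
  induction z using Tens.induction with
  | zero => simp only [map_zero]
  | add x y hx hy => simp only [map_add, hx, hy]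
  | tmul x' x =>
    rw [comulC_tmul, ← penC_map, γ_comulC, penC_assoc]
    congr 1
    generalize H.γ x = w
    refine (map_comp (f'' := H.comulC.comp (tmulLeft β β T x')) (g'' := AddMonoidHom.id _)
      (fun r x => H.comulC_right r (tmul β β x' x)) (leftLin_id α) (fun _ => rfl)
      (fun _ => rfl) w).trans ?_
    symm
    exact map_comp _ _ (fun _ => rfl) (fun _ => rfl) w

theorem map_ev_assoc {L : Type*} [Ring L] {τ : R →+* L} {Q : Type*} [AddCommGroup Q]
    [Module L Q] [Module Aᵐᵒᵖ N] [SMulCommClass K Aᵐᵒᵖ N]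
    (z : Tens α τ (Tens α σ (Tens β β T' T) N) Q) :
    map H.ev H.ev_rightLin (AddMonoidHom.id _) (leftLin_id σ) (assoc z) =
      assoc (map (map H.ev H.ev_rightLin (AddMonoidHom.id N) (leftLin_id σ))
        (rightLin_map _ _ _ _ (rightLin_id α)) (AddMonoidHom.id Q) (leftLin_id τ) z) := by
  induction z using Tens.induction with
  | zero => simp only [map_zero]
  | add x y hx hy => simp only [map_add, hx, hy]
  | tmul w p =>
    induction w using Tens.induction with
    | zero => simp only [map_zero, zero_tmul]
    | add x y hx hy => simp only [map_add, tmul_add_left, hx, hy]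
    | tmul m n => rfl

/-- Coassociativity of `comulC` with `ev` applied to the first factor. For `c` in `C` the left side
is `1 ⊗ comulC(c)`, which is what pushes the first leg of the coproduct into `C`. -/
theorem ξC_comulC (z : Tens β β T' T) :
    map (AddMonoidHom.id A) (rightLin_id α) H.comulC H.comulC_left (H.ξC z) =
      assoc (map H.ξC H.ξC_right (AddMonoidHom.id _) (leftLin_id α) (H.comulC z)) := by
  have h := congrArg (map H.ev H.ev_rightLin (AddMonoidHom.id _) (leftLin_id α))
    (H.comulC_coassoc z)
  rw [map_comm, map_ev_assoc, map_comp H.ξC_right (leftLin_id α) (fun _ => rfl)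
    (fun _ => rfl)] at h
  exact h

/-- Applying `ev` in the middle of coassociativity gives `x¹ ⊗ ξ(x² ⊗ x³) = x¹¹ ⊗ ev(x¹² ⊗ x¹³) ⊗ x²
⊗ x³`, and the `ev` law contracts this to `x¹ ⊗ 1 ⊗ x² ⊗ x³`. So `γ` takes values where `C` is
expected in the last two factors. -/
theorem γ_ξC (x : T) :
    map (AddMonoidHom.id T) (rightLin_id α) H.ξC H.ξC_left (H.γ x) =
      map (AddMonoidHom.id T) (rightLin_id α) (unitL α _) (unitL_left α _) (H.γ x) := by
  have hev : LeftLin α α (map H.ev H.ev_rightLin (AddMonoidHom.id (Tens β β T' T))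
    (leftLin_id α)) := leftLin_map _ _ _ _ H.ev_leftLin
  have h := congrArg (map (AddMonoidHom.id T) (rightLin_id α) _ hev) (H.γ_comulC x)
  rw [map_comp (rightLin_id α) H.ξC_left (fun _ => rfl) (fun _ => rfl)] at h
  rw [h]
  generalize H.γ x = w
  induction w using Tens.induction with
  | zero => simp only [map_zero]
  | add x y hx hy => simp only [map_add, hx, hy]
  | tmul t z =>
    exact H.apply_γ_of_ev ((map (AddMonoidHom.id T) (rightLin_id α) _ hev).comp
      (assoc.toAddMonoidHom.comp (tmulRight α α _ z)))
      (assoc.toAddMonoidHom.comp (tmulRight α α _ z)) (fun t w => rfl) t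

/-- The cocycle condition of the descent datum, obtained from `γ_ξC` by applying `ev(x' ⊗ -)` to the
first factor. -/
theorem ξC_ξC (z : Tens β β T' T) :
    map (AddMonoidHom.id A) (rightLin_id α) H.ξC H.ξC_left (H.ξC z) =
      map (AddMonoidHom.id A) (rightLin_id α) (unitL α _) (unitL_left α _) (H.ξC z) := by
  induction z using Tens.induction with
  | zero => simp only [map_zero]
  | add x y hx hy => simp only [map_add, hx, hy]
  | tmul x' x => rw [ξC_tmul, ← evC_map, ← evC_map, γ_ξC]

theorem comulC_ev (z : Tens β β T' T) :
    map (AddMonoidHom.id _) (rightLin_id α) H.ev H.ev_leftLin (H.comulC z) = tmul α α z 1 := by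
  induction z using Tens.induction with
  | zero => simp only [map_zero, zero_tmul]
  | add x y hx hy => simp only [map_add, tmul_add_left, hx, hy]
  | tmul x' x =>
    rw [comulC_tmul, ← penC_map, H.ev_γ]
    rfl

/-- When `z` lies in `C` the left side is `1 ⊗ ev(z)`, so `ev(z)` lies in the equaliser of `A ⇉ A
⊗_R A`. -/
theorem ξC_ev (z : Tens β β T' T) :
    map (AddMonoidHom.id _) (rightLin_id α) H.ev H.ev_leftLin (H.ξC z) = tmul α α (H.ev z) 1 := by
  have h := congrArg (map H.ev H.ev_rightLin (AddMonoidHom.id A) (leftLin_id α)) (H.comulC_ev z)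
  rw [map_comm] at h
  exact h

/-- `z ↦ ξ(z a)`. -/
def ξCMul (a : A) : Tens β β T' T →+ Tens α α A (Tens β β T' T) :=
  H.ξC.comp (DistribSMul.toAddMonoidHom _ (op a))

theorem ξCMul_apply (a : A) (z : Tens β β T' T) : H.ξCMul a z = H.ξC (op a • z) := rfl

theorem ξCMul_left (a : A) : LeftLin α α (H.ξCMul a) := fun r z => by
  rw [ξCMul_apply, ξCMul_apply, ← H.ξC_left, smul_comm (α r) (op a) z]

/-- `m ⊗ z ↦ m ξ(z a)`. -/
def entC (M : Type*) [AddCommGroup M] [Module Aᵐᵒᵖ M] (a : A) :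
    Tens α α M (Tens β β T' T) →+ Tens α α M (Tens β β T' T) :=
  (actR α α M _).comp (map (AddMonoidHom.id M) (rightLin_id α) (H.ξCMul a) (H.ξCMul_left a))

theorem entC_tmul (M : Type*) [AddCommGroup M] [Module Aᵐᵒᵖ M] (a : A) (m : M)
    (z : Tens β β T' T) : H.entC M a (tmul α α m z) =
      actR α α M _ (tmul α α m (H.ξC (op a • z))) := rfl

/-- With `y = x³ a` one has `x¹ ev(x² ⊗ y¹) ⊗ y² ⊗ y³ = ev'(x¹ ⊗ x²) y¹ ⊗ y² ⊗ y³`, which is `ev'(x¹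
⊗ x²) γ(x³ a)`. The `ev'` law turns it into `γ(x a)`. This is the entwined module condition before
restriction to `C`. -/
theorem entC_γ (x : T) (a : A) : H.entC T a (H.γ x) = H.γ (op a • x) := by
  have hl : LeftLin β β (H.γ.comp (DistribSMul.toAddMonoidHom _ (op a))) := fun s y => by
    simp only [AddMonoidHom.comp_apply, DistribSMul.toAddMonoidHom_apply]
    rw [← H.γ_left, smul_comm (β s) (op a) y]
  refine (H.apply_γ_of_ev' (H.entC T a) ((lact β _).comp (map
    (AddMonoidHom.id B) (rightLin_id β) _ hl)) (fun t t' y => ?_) x).trans ?_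
  · change actR α α T _ (tmul α α t (H.ξC (tmul β β t' (op a • y)))) =
      H.ev' (tmul α α t t') • H.γ (op a • y)
    rw [ξC_tmul]
    generalize H.γ (op a • y) = w
    induction w using Tens.induction with
    | zero => simp only [map_zero, tmul_zero, smul_zero]
    | add x y hx hy => simp only [map_add, tmul_add_right, hx, hy, smul_add]
    | tmul s w =>
      change tmul α α (op (H.ev (tmul β β t' s)) • t) w = tmul α α (H.ev' (tmul α α t t') • s) w
      rw [H.ev'_smul]
  · change (1 : B) • H.γ (op a • x) = _
    rw [one_smul]

theorem penC_actR (x' : T') (z : Tens α α T (Tens α σ A N)) :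
    penC β σ N x' (actR α σ T N z) = actR α σ _ N (penC β α _ x' z) := by
  induction z using Tens.induction with
  | zero => simp only [map_zero]
  | add x y hx hy => simp only [map_add, hx, hy]
  | tmul t w =>
    induction w using Tens.induction with
    | zero => simp only [map_zero, tmul_zero]
    | add x y hx hy => simp only [map_add, tmul_add_right, hx, hy]
    | tmul m n => rfl

theorem entC_comulC (z : Tens β β T' T) (a : A) :
    H.entC _ a (H.comulC z) = H.comulC (op a • z) := by
  induction z using Tens.induction with
  | zero => simp only [map_zero, smul_zero]
  | add x y hx hy => simp only [map_add, smul_add, hx, hy]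
  | tmul x' x =>
    rw [op_smul_tmul, comulC_tmul, comulC_tmul, ← entC_γ]
    simp only [entC, AddMonoidHom.comp_apply]
    rw [penC_actR, penC_map]

end Right

end Herd

namespace Tens

variable {R A K : Type*} [Ring R] [Ring A] [Ring K] {α : R →+* A} {σ : R →+* K}
  {M N : Type*} [AddCommGroup M] [AddCommGroup N] [Module Aᵐᵒᵖ M] [Module K N]

theorem actR_right {Q L : Type*} [Ring Q] [Ring L] (τ : Q →+* L) [Module Lᵐᵒᵖ N]
    [SMulCommClass K Lᵐᵒᵖ N] : RightLin τ τ (actR α σ M N) := fun r z => by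
  simp only [actR, AddMonoidHom.comp_apply, AddEquiv.coe_toAddMonoidHom]
  rw [assoc_symm_op_smul]
  exact rightLin_map (τ := τ) (τ' := τ) _ _ _ _ (rightLin_id τ) r _

theorem actR_map {K' N' : Type*} [Ring K'] {σ' : R →+* K'} [AddCommGroup N'] [Module K' N']
    (g : N →+ N') (hg : LeftLin σ σ' g) (hg' : LeftLin α α (map (AddMonoidHom.id A)
      (rightLin_id α) g hg)) (z : Tens α α M (Tens α σ A N)) :
    actR α σ' M N' (map (AddMonoidHom.id M) (rightLin_id α) _ hg' z) =
      map (AddMonoidHom.id M) (rightLin_id α) g hg (actR α σ M N z) := by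
  induction z using Tens.induction with
  | zero => simp only [map_zero]
  | add x y hx hy => simp only [map_add, hx, hy]
  | tmul t w =>
    induction w using Tens.induction with
    | zero => simp only [map_zero, tmul_zero]
    | add x y hx hy => simp only [map_add, tmul_add_right, hx, hy]
    | tmul m n => rfl

theorem map_id_apply {R A₁ A₂ M N : Type*} [Ring R] [Ring A₁] [Ring A₂] {ρ : R →+* A₁}
    {σ : R →+* A₂} [AddCommGroup M] [AddCommGroup N] [Module A₁ᵐᵒᵖ M] [Module A₂ N]
    (z : Tens ρ σ M N) :
    map (AddMonoidHom.id M) (rightLin_id ρ) (AddMonoidHom.id N) (leftLin_id σ) z = z :=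
  hom_congr (f := map _ (rightLin_id ρ) _ (leftLin_id σ)) (g := AddMonoidHom.id _)
    (fun _ _ => rfl) z

theorem actR_unitL {N : Type*} [AddCommGroup N] [Module A N] (z : Tens α α M N) :
    actR α α M N (map (AddMonoidHom.id M) (rightLin_id α) (unitL α N) (unitL_left α N) z) = z := by
  induction z using Tens.induction with
  | zero => simp only [map_zero]
  | add x y hx hy => simp only [map_add, hx, hy]
  | tmul m n =>
    change tmul α α (op (1 : A) • m) n = _
    rw [op_one, one_smul]

end Tens

/-! ### Consequences of factoring `ξ` through `A ⊗_R C` -/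

namespace Herd

variable {R S A B : Type*} [Ring R] [Ring S] [Ring A] [Ring B] {α : R →+* A} {β : S →+* B}
  {T T' : Type*} [AddCommGroup T] [Module B T] [Module Aᵐᵒᵖ T] [SMulCommClass B Aᵐᵒᵖ T]
  [AddCommGroup T'] [Module A T'] [Module Bᵐᵒᵖ T'] [SMulCommClass A Bᵐᵒᵖ T'] (H : Herd α β T T')

/-- A factorisation of `ξC` through `A ⊗_R C`. -/
structure LiftC where
  ξ : Tens β β T' T →+ Tens α (RingHom.id R) A H.C
  incl_ξ : ∀ z, H.inclC A (ξ z) = H.ξC z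
  ξ_ιC : ∀ c, ξ (H.ιC c) = tmul α (RingHom.id R) 1 c
  left : ∀ (a : A) z, ξ (a • z) = a • ξ z
  right : RightLin α (RingHom.id R) ξ

theorem ξC_ιC (c : H.C) : H.ξC (H.ιC c) = tmul α α (1 : A) (H.ιC c) := c.2

theorem inclC_right (M : Type*) [AddCommGroup M] [Module Aᵐᵒᵖ M] :
    RightLin (RingHom.id R) α (H.inclC M) :=
  rightLin_map _ _ _ _ H.ιC_right

theorem inclC_smul (M : Type*) [AddCommGroup M] [Module Aᵐᵒᵖ M] {K : Type*} [Ring K] [Module K M]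
    [SMulCommClass K Aᵐᵒᵖ M] (a : K) (z : Tens α (RingHom.id R) M H.C) :
    H.inclC M (a • z) = a • H.inclC M z :=
  leftLin_map (τ := RingHom.id K) (τ' := RingHom.id K) _ _ _ _ (leftLin_id _) a z

variable {H} in
-- Only the image of `ξ` has to be controlled. Linearity and the value on `C` are equations that may
-- be checked after the injection into `A ⊗_R X`.
theorem exists_liftC (hi : Function.Injective (H.inclC A))
    (hl : ∀ z, ∃ w, H.inclC A w = H.ξC z) : Nonempty H.LiftC := by
  obtain ⟨ξ, hξ⟩ := exists_lift_of_injective hi H.ξC hl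
  refine ⟨⟨ξ, hξ, fun c => hi ?_, fun a z => hi ?_, fun r z => hi ?_⟩⟩
  · rw [hξ, ξC_ιC]; rfl
  · rw [hξ, inclC_smul, hξ, ξC_smul]
  · rw [hξ, H.inclC_right A r, hξ, ξC_right]

namespace LiftC

variable {H} (E : H.LiftC)

theorem ξ_left : LeftLin α α E.ξ := fun r z => E.left (α r) z

/-- `m ⊗ z ↦ m ξ(z)`, a retraction of `M ⊗_R C → M ⊗_R (T' ⊗_S T)`. -/
def retr (M : Type*) [AddCommGroup M] [Module Aᵐᵒᵖ M] :
    Tens α α M (Tens β β T' T) →+ Tens α (RingHom.id R) M H.C :=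
  (actR α (RingHom.id R) M H.C).comp (map (AddMonoidHom.id M) (rightLin_id α) E.ξ E.ξ_left)

variable (M : Type*) [AddCommGroup M] [Module Aᵐᵒᵖ M]

theorem retr_right : RightLin α (RingHom.id R) (E.retr M) := fun r z => by
  simp only [retr, AddMonoidHom.comp_apply]
  rw [← actR_right (RingHom.id R), rightLin_map (τ := α) (τ' := RingHom.id R) _ _ _ _ E.right]

theorem inclC_retr (z : Tens α α M (Tens β β T' T)) : H.inclC M (E.retr M z) =
    actR α α M _ (map (AddMonoidHom.id M) (rightLin_id α) H.ξC H.ξC_left z) := by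
  simp only [retr, AddMonoidHom.comp_apply]
  refine (actR_map H.ιC H.ιC_left (leftLin_map _ _ _ _ (leftLin_id α)) _).symm.trans ?_
  congr 1
  exact map_comp (rightLin_id α) H.ξC_left (fun _ => rfl) E.incl_ξ z

theorem retr_inclC (z : Tens α (RingHom.id R) M H.C) : E.retr M (H.inclC M z) = z := by
  induction z using Tens.induction with
  | zero => simp only [map_zero]
  | add x y hx hy => simp only [map_add, hx, hy]
  | tmul m c =>
    change actR α _ M _ (tmul α α m (E.ξ (H.ιC c))) = _
    rw [E.ξ_ιC, actR_tmul, op_one, one_smul]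

/-- The retraction is `m ⊗ z ↦ m ξ(z)`, which returns `m ⊗ c` because `ξ(c) = 1 ⊗ c`. No flatness of
`M` is required. -/
theorem inclC_injective (E : H.LiftC) (M : Type*) [AddCommGroup M] [Module Aᵐᵒᵖ M] :
    Function.Injective (H.inclC M) :=
  Function.LeftInverse.injective (E.retr_inclC M)

/-- The retraction `retr` is right `R`-linear, so it may be tensored with `N`; the rest is
rebracketing. -/
theorem map_map_ιC_injective (E : H.LiftC) (M : Type*) [AddCommGroup M] [Module Aᵐᵒᵖ M]
    {K N : Type*} [Ring K] [AddCommGroup N] [Module K N] (σ : R →+* K) :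
    Function.Injective (map (AddMonoidHom.id M) (rightLin_id α)
      (map H.ιC H.ιC_right (AddMonoidHom.id N) (leftLin_id σ))
      (leftLin_map _ _ _ _ H.ιC_left)) := by
  refine Function.LeftInverse.injective (g := fun z => assoc (map (E.retr M) (E.retr_right M)
    (AddMonoidHom.id N) (leftLin_id σ) (assoc.symm z))) fun z => ?_
  obtain ⟨w, rfl⟩ := assoc.surjective z
  beta_reduce
  rw [← map_assoc (H.inclC_right M), AddEquiv.symm_apply_apply]
  congr 1
  exact (map_comp (rightLin_id _) (leftLin_id _) (E.retr_inclC M) (fun _ => rfl) w).trans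
    (map_id_apply w)

/-- Contract both sides of `hw` by `actR`. The `ξ` side becomes `inclC` after `retr`, and the unit
side becomes the identity, so `w` is the image of its own retraction. -/
theorem exists_map_inclC_eq (E : H.LiftC) {M : Type*} [AddCommGroup M] [Module Aᵐᵒᵖ M]
    {K N : Type*} [Ring K] [AddCommGroup N] [Module K N] {σ : R →+* K}
    (w : Tens α σ (Tens α α M (Tens β β T' T)) N)
    (hw : map (map (AddMonoidHom.id M) (rightLin_id α) H.ξC H.ξC_left)
        (rightLin_map _ _ _ _ H.ξC_right) (AddMonoidHom.id N) (leftLin_id σ) w =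
      map (map (AddMonoidHom.id M) (rightLin_id α) (unitL α _) (unitL_left α _))
        (rightLin_map _ _ _ _ (unitL_right α _ α)) (AddMonoidHom.id N) (leftLin_id σ) w) :
    ∃ w', map (H.inclC M) (H.inclC_right M) (AddMonoidHom.id N) (leftLin_id σ) w' = w := by
  refine ⟨map (E.retr M) (E.retr_right M) (AddMonoidHom.id N) (leftLin_id σ) w, ?_⟩
  have h := congrArg (map (actR α α M (Tens β β T' T)) (actR_right α)
    (AddMonoidHom.id N) (leftLin_id σ)) hw
  have hr : RightLin α α ((H.inclC M).comp (E.retr M)) := fun r z => by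
    rw [AddMonoidHom.comp_apply, E.retr_right, H.inclC_right]; rfl
  refine Eq.trans (map_comp hr (leftLin_id _) (fun _ => rfl) (fun _ => rfl) _)
      (Eq.trans (Eq.trans ?_ h) ?_)
  · exact (map_comp hr (leftLin_id _) (fun z => (E.inclC_retr M z).symm) (fun _ => rfl) _).symm
  · exact (map_comp (rightLin_id _) (leftLin_id _) (fun z => actR_unitL z) (fun _ => rfl) _).trans
      (map_id_apply _)

end LiftC

end Herd

/-! ### Purity and the factorisation of `ξ`, in the split and the flat case -/

namespace Herd

variable {R S A B T T' : Type u} [Ring R] [Ring S] [Ring A] [Ring B] {α : R →+* A} {β : S →+* B}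
  [AddCommGroup T] [Module B T] [Module Aᵐᵒᵖ T] [SMulCommClass B Aᵐᵒᵖ T]
  [AddCommGroup T'] [Module A T'] [Module Bᵐᵒᵖ T'] [SMulCommClass A Bᵐᵒᵖ T'] (H : Herd α β T T')

/-- For every left `R`-module `N` the sequence `0 → C ⊗ N → X ⊗ N → (A ⊗ X) ⊗ N` is exact, where
`X = T' ⊗_S T`. -/
structure IsPureC : Prop where
  injective (N : Type u) [AddCommGroup N] [Module R N] :
    Function.Injective (map H.ιC H.ιC_right (AddMonoidHom.id N) (leftLin_id (RingHom.id R)))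
  exact (N : Type u) [AddCommGroup N] [Module R N] (y : Tens α (RingHom.id R) (Tens β β T' T) N) :
    map H.ξC H.ξC_right (AddMonoidHom.id N) (leftLin_id (RingHom.id R)) y =
      map (unitL α _) (unitL_right α _ α) (AddMonoidHom.id N) (leftLin_id (RingHom.id R)) y →
    ∃ w, map H.ιC H.ιC_right (AddMonoidHom.id N) (leftLin_id (RingHom.id R)) w = y

section Split

variable {N : Type*} [AddCommGroup N] [Module A N] {π : A →+ R}

/-- `a ⊗ n ↦ π(a) n`. -/
def splitL (hr : RightLin α (RingHom.id R) π) (N : Type*) [AddCommGroup N] [Module A N] :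
    Tens α α A N →+ N :=
  (lid α N).comp (map π hr (AddMonoidHom.id N) (leftLin_id α))

theorem splitL_tmul (hr : RightLin α (RingHom.id R) π) (a : A) (n : N) :
    splitL hr N (tmul α α a n) = α (π a) • n := rfl

theorem splitL_unitL (hr : RightLin α (RingHom.id R) π) (h1 : ∀ r, π (α r) = r) (n : N) :
    splitL hr N (unitL α N n) = n := by
  have e1 : π 1 = 1 := by simpa using h1 1
  rw [unitL_apply, splitL_tmul, e1, map_one, one_smul]

theorem splitL_left (hr : RightLin α (RingHom.id R) π) (hl : LeftLin α (RingHom.id R) π) :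
    LeftLin α α (splitL hr N) := fun r z => by
  induction z using Tens.induction with
  | zero => simp only [map_zero, smul_zero]
  | add x y hx hy => simp only [map_add, smul_add, hx, hy]
  | tmul a n =>
    rw [smul_tmul, splitL_tmul, splitL_tmul, hl, smul_smul, ← map_mul]
    rfl

theorem splitL_right (hr : RightLin α (RingHom.id R) π) {L : Type*} [Ring L] (τ : R →+* L)
    [Module Lᵐᵒᵖ N] [SMulCommClass A Lᵐᵒᵖ N] : RightLin τ τ (splitL hr N) := fun r z => by
  induction z using Tens.induction with
  | zero => simp only [map_zero, smul_zero]
  | add x y hx hy => simp only [map_add, smul_add, hx, hy]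
  | tmul a n =>
    rw [op_smul_tmul, splitL_tmul, splitL_tmul, smul_comm]

theorem splitL_map (hr : RightLin α (RingHom.id R) π) {N' : Type*} [AddCommGroup N'] [Module A N']
    (g : N →+ N') (hg : LeftLin α α g) (z : Tens α α A N) :
    splitL hr N' (map (AddMonoidHom.id A) (rightLin_id α) g hg z) = g (splitL hr N z) := by
  induction z using Tens.induction with
  | zero => simp only [map_zero]
  | add x y hx hy => simp only [map_add, hx, hy]
  | tmul a n => rw [map_tmul, splitL_tmul, splitL_tmul, hg]; rfl

/-- `π ⊗ -` is natural for left `R`-linear maps, so `ξ((π ⊗ X) ξ(z)) = (π ⊗ A ⊗ X)(A ⊗ ξ) ξ(z)`. The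
cocycle condition replaces the inner `ξ` by `1 ⊗ -`. -/
theorem splitL_ξC_mem (hr : RightLin α (RingHom.id R) π) (z : Tens β β T' T) :
    splitL hr _ (H.ξC z) ∈ H.C := by
  change H.ξC _ = unitL α _ _
  rw [← splitL_map hr _ H.ξC_left, ξC_ξC, splitL_map]

/-- `z ↦ (π ⊗ id)(ξ z)`, a retraction of `C → T' ⊗_S T`. -/
def projC (hr : RightLin α (RingHom.id R) π) : Tens β β T' T →+ H.C :=
  ((splitL hr _).comp H.ξC).codRestrict H.C (H.splitL_ξC_mem hr)

theorem projC_ιC (hr : RightLin α (RingHom.id R) π) (h1 : ∀ r, π (α r) = r) (c : H.C) :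
    H.projC hr (H.ιC c) = c :=
  Subtype.ext <| by
    change splitL hr _ (H.ξC (H.ιC c)) = H.ιC c
    rw [ξC_ιC, ← unitL_apply, splitL_unitL hr h1]

theorem projC_left (hr : RightLin α (RingHom.id R) π) (hl : LeftLin α (RingHom.id R) π) :
    LeftLin α (RingHom.id R) (H.projC hr) := fun r z =>
  Subtype.ext <| by
    change splitL hr _ (H.ξC (α r • z)) = α r • splitL hr _ (H.ξC z)
    rw [ξC_left, splitL_left hr hl]

theorem projC_right (hr : RightLin α (RingHom.id R) π) :
    RightLin α (RingHom.id R) (H.projC hr) := fun r z =>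
  Subtype.ext <| by
    change splitL hr _ (H.ξC (op (α r) • z)) = op (α r) • splitL hr _ (H.ξC z)
    rw [ξC_right, splitL_right hr α]

/-- `C` is an `R`-bimodule summand of `X`, so `A ⊗_R C → A ⊗_R X` is split. The preimage of `ξ(z)`
is its projection, and the cocycle condition shows that projecting changes nothing. -/
theorem liftC_of_split (h : SplitExtension α) : Nonempty H.LiftC := by
  obtain ⟨π, hl, hr, h1⟩ := h
  have hl : LeftLin α (RingHom.id R) π := hl
  have hr : RightLin α (RingHom.id R) π := fun r a => hr a r
  refine exists_liftC (Function.LeftInverse.injective (g := map (AddMonoidHom.id A) (rightLin_id α)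
    (H.projC hr) (H.projC_left hr hl)) fun z => ?_) fun z => ⟨map (AddMonoidHom.id A)
      (rightLin_id α) (H.projC hr) (H.projC_left hr hl) (H.ξC z), ?_⟩
  · exact (map_comp (rightLin_id _) (leftLin_id _) (fun _ => rfl) (H.projC_ιC hr h1) z).trans
      (map_id_apply z)
  · have h := congrArg (map (AddMonoidHom.id A) (rightLin_id α) (splitL hr (Tens β β T' T))
      (splitL_left hr hl)) (H.ξC_ξC z)
    have hp : LeftLin α α ((splitL hr _).comp H.ξC) := fun r z => by
      rw [AddMonoidHom.comp_apply, AddMonoidHom.comp_apply, ξC_left, splitL_left hr hl]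
    refine Eq.trans (map_comp (rightLin_id _) hp (fun _ => rfl) (fun _ => rfl) _)
      (Eq.trans (Eq.trans ?_ h) ?_)
    · exact (map_comp (rightLin_id _) hp (fun _ => rfl) (fun _ => rfl) _).symm
    · exact (map_comp (rightLin_id _) (leftLin_id _) (fun _ => rfl) (splitL_unitL hr h1) _).trans
        (map_id_apply _)

theorem isPureC_of_split (h : SplitExtension α) : H.IsPureC := by
  obtain ⟨π, hl, hr, h1⟩ := h
  have hl : LeftLin α (RingHom.id R) π := hl
  have hr : RightLin α (RingHom.id R) π := fun r a => hr a r
  refine ⟨fun N _ _ => Function.LeftInverse.injective (g := map (H.projC hr) (H.projC_right hr)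
    (AddMonoidHom.id N) (leftLin_id _)) fun z => ?_, fun N _ _ y hy => ⟨map (H.projC hr)
      (H.projC_right hr) (AddMonoidHom.id N) (leftLin_id _) y, ?_⟩⟩
  · exact (map_comp (rightLin_id _) (leftLin_id _) (H.projC_ιC hr h1) (fun _ => rfl) z).trans
      (map_id_apply z)
  · have h := congrArg (map (splitL hr (Tens β β T' T)) (splitL_right hr α)
      (AddMonoidHom.id N) (leftLin_id _)) hy
    have hp : RightLin α α ((splitL hr _).comp H.ξC) := fun r z => by
      rw [AddMonoidHom.comp_apply, AddMonoidHom.comp_apply, ξC_right, splitL_right hr α]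
    refine Eq.trans (map_comp hp (leftLin_id _) (fun _ => rfl) (fun _ => rfl) _)
      (Eq.trans (Eq.trans ?_ h) ?_)
    · exact (map_comp hp (leftLin_id _) (fun _ => rfl) (fun _ => rfl) _).symm
    · exact (map_comp (rightLin_id _) (leftLin_id _) (splitL_unitL hr h1) (fun _ => rfl) _).trans
        (map_id_apply _)

end Split

section FaithfullyFlat

/-- `ξ - (1 ⊗ -)`, whose kernel is `C`. -/
def diffC : Tens β β T' T →+ Tens α α A (Tens β β T' T) := H.ξC - unitL α _

theorem diffC_left : LeftLin α α H.diffC := fun r z => by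
  simp only [diffC, AddMonoidHom.sub_apply]
  rw [ξC_left, unitL_left, smul_sub]

theorem exact_ιC_diffC : Function.Exact H.ιC H.diffC := fun z => by
  rw [diffC, AddMonoidHom.sub_apply, sub_eq_zero]
  exact ⟨fun hz => ⟨⟨z, hz⟩, rfl⟩, by rintro ⟨c, rfl⟩; exact c.2⟩

variable {H}

theorem inclC_injective_of_rightFaithfullyFlat (h : RightFaithfullyFlat α T) :
    Function.Injective (H.inclC T) :=
  (h.injective_iff H.ιC H.ιC_left).1 Subtype.val_injective

/-- Flatness identifies the kernel of `T ⊗ diffC` with the image of `T ⊗_R C`, and `γ_ξC` says that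
`γ(x)` is in this kernel. -/
theorem exists_inclC_eq_γ (h : RightFaithfullyFlat α T) (x : T) : ∃ w, H.inclC T w = H.γ x := by
  refine ((h.exact_iff H.ιC H.diffC H.ιC_left H.diffC_left).1 H.exact_ιC_diffC (H.γ x)).1 ?_
  exact (map_sub_right _ _ _ _ H.ξC_left (unitL_left α _) H.diffC_left _).trans
    (sub_eq_zero.2 (H.γ_ξC x))

/-- For `x` in `T`, the map `a ↦ x a` moves `k` to `T ⊗_R C`. There its image in `T ⊗_R X` vanishes,
hence so does the element itself, since `T` is flat. Applying `ev(x' ⊗ -)` brings it back to `A ⊗_R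
C` as `ev(x' ⊗ x) k`. -/
theorem ev_smul_eq_zero (h : RightFaithfullyFlat α T) {k : Tens α (RingHom.id R) A H.C}
    (hk : H.inclC A k = 0) (z : Tens β β T' T) : H.ev z • k = 0 := by
  induction z using Tens.induction with
  | zero => rw [map_zero, zero_smul]
  | add x y hx hy => rw [map_add, add_smul, hx, hy, add_zero]
  | tmul x' x =>
    have hx : RightLin α α (AddMonoidHom.mk' (fun a : A => op a • x) fun b c => by
          rw [op_add, add_smul]) := fun r b => by simp [mul_smul]
    have h0 : map _ hx (AddMonoidHom.id H.C) (leftLin_id _) k = 0 := by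
      refine inclC_injective_of_rightFaithfullyFlat (H := H) h ((map_comm ..).symm.trans ?_)
      exact (congrArg (map _ hx (AddMonoidHom.id (Tens β β T' T)) (leftLin_id α)) hk).trans
        (by rw [map_zero, map_zero])
    refine Eq.trans ?_ ((congrArg (H.evC (RingHom.id R) H.C x') h0).trans (map_zero _))
    clear hk h0
    induction k using Tens.induction with
    | zero => simp only [map_zero, smul_zero]
    | add x y hx hy => simp only [map_add, smul_add, hx, hy]
    | tmul a c =>
      change tmul α _ (H.ev (tmul β β x' x) * a) c = tmul α _ (H.ev (op a • tmul β β x' x)) c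
      rw [H.ev_right]

/-- The `ev` law writes `t ⊗ k` as `t¹ ⊗ ev(t² ⊗ t³) k`, and each such multiple of `k` is zero. -/
theorem tmul_eq_zero_of_inclC (h : RightFaithfullyFlat α T) {k : Tens α (RingHom.id R) A H.C}
    (hk : H.inclC A k = 0) (t : T) : tmul α α t k = 0 := by
  have hG : LeftLin α α (AddMonoidHom.mk' (fun a : A => a • k) fun b c => add_smul b c k) :=
    fun r b => by simp [mul_smul]
  have h1 := H.apply_γ_of_ev 0 (map (AddMonoidHom.id T) (rightLin_id α) _ hG) (fun t z => by
    change _ = tmul α α t (H.ev z • k)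
    rw [ev_smul_eq_zero h hk, tmul_zero, AddMonoidHom.zero_apply]) t
  have h2 : tmul α α t ((1 : A) • k) = 0 := h1.symm
  rwa [one_smul] at h2

/-- `A` need not be flat here. For the kernel `K`, the map `T ⊗ K → T ⊗ (A ⊗ C)` is zero by the
preceding lemma. Exactness then makes `T ⊗ (A ⊗ C) → T ⊗ (A ⊗ X)` injective, and `T` reflects
injectivity. -/
theorem inclC_injective_of_flat (h : RightFaithfullyFlat α T) :
    Function.Injective (H.inclC A) := by
  let K : Submodule A (Tens α (RingHom.id R) A H.C) :=
    { carrier := {k | H.inclC A k = 0}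
      zero_mem' := map_zero _
      add_mem' := fun {x y} hx hy => by
        change H.inclC A (x + y) = 0
        rw [map_add, show H.inclC A x = 0 from hx, show H.inclC A y = 0 from hy, add_zero]
      smul_mem' := fun a x hx => by
        change H.inclC A (a • x) = 0
        rw [inclC_smul, show H.inclC A x = 0 from hx, smul_zero] }
  have hj : LeftLin α α K.subtype.toAddMonoidHom := fun _ _ => rfl
  have hi : LeftLin α α (H.inclC A) := fun r z => H.inclC_smul A (α r) z
  have hex : Function.Exact K.subtype.toAddMonoidHom (H.inclC A) := fun k =>
    ⟨fun hk => ⟨⟨k, hk⟩, rfl⟩, by rintro ⟨k, rfl⟩; exact k.2⟩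
  rw [h.exact_iff _ _ hj hi, show map (AddMonoidHom.id T) (rightLin_id α) _ hj = 0 from
    hom_ext fun t k => tmul_eq_zero_of_inclC h k.2 t, exact_zero_iff, ← h.injective_iff] at hex
  exact hex

/-- `ξ(x' ⊗ x)` is `γ(x)` with `ev(x' ⊗ -)` applied to its first factor; the same operation on the
preimage of `γ(x)` in `T ⊗_R C` gives a preimage in `A ⊗_R C`. -/
theorem liftC_of_flat (h : RightFaithfullyFlat α T) : Nonempty H.LiftC := by
  refine exists_liftC (inclC_injective_of_flat h) fun z => ?_
  induction z using Tens.induction with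
  | zero => exact ⟨0, by rw [map_zero, map_zero]⟩
  | add x y hx hy =>
    obtain ⟨v, hv⟩ := hx
    obtain ⟨w, hw⟩ := hy
    exact ⟨v + w, by rw [map_add, map_add, hv, hw]⟩
  | tmul x' x =>
    obtain ⟨w, hw⟩ := exists_inclC_eq_γ (H := H) h x
    exact ⟨H.evC (RingHom.id R) H.C x' w, by
      rw [ξC_tmul, ← hw]
      exact (H.evC_map H.ιC H.ιC_left x' w).symm⟩

/-- Both claims are reflected by `T ⊗ -`. After it, the right `A`-module `T` stands to the left of
`C`, and `retr` supplies the splittings whatever `N` is. -/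
theorem isPureC_of_flat (h : RightFaithfullyFlat α T) : H.IsPureC := by
  obtain ⟨E⟩ := liftC_of_flat (H := H) h
  have hι (N : Type u) [AddCommGroup N] [Module R N] : LeftLin (RingHom.id R) α
      (map H.ιC H.ιC_right (AddMonoidHom.id N) (leftLin_id (RingHom.id R))) :=
    leftLin_map _ _ _ _ H.ιC_left
  have hξ (N : Type u) [AddCommGroup N] [Module R N] : LeftLin α α
      (map H.ξC H.ξC_right (AddMonoidHom.id N) (leftLin_id (RingHom.id R))) :=
    leftLin_map _ _ _ _ H.ξC_left
  have hu (N : Type u) [AddCommGroup N] [Module R N] : LeftLin α α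
      (map (unitL α (Tens β β T' T)) (unitL_right α _ α) (AddMonoidHom.id N)
        (leftLin_id (RingHom.id R))) :=
    leftLin_map _ _ _ _ (unitL_left α _)
  have hd (N : Type u) [AddCommGroup N] [Module R N] : LeftLin α α
      (map H.ξC H.ξC_right (AddMonoidHom.id N) (leftLin_id (RingHom.id R)) -
        map (unitL α (Tens β β T' T)) (unitL_right α _ α) (AddMonoidHom.id N)
          (leftLin_id (RingHom.id R))) := fun r z => by
    rw [AddMonoidHom.sub_apply, AddMonoidHom.sub_apply, hξ, hu, smul_sub]
  refine ⟨fun N _ _ => (h.injective_iff _ (hι N)).2 (E.map_map_ιC_injective T _),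
    fun N _ _ y hy => ?_⟩
  have hex := (h.exact_iff (map H.ιC H.ιC_right (AddMonoidHom.id N) (leftLin_id (RingHom.id R)))
    (map H.ξC H.ξC_right (AddMonoidHom.id N) (leftLin_id (RingHom.id R)) -
        map (unitL α (Tens β β T' T)) (unitL_right α _ α) (AddMonoidHom.id N)
          (leftLin_id (RingHom.id R))) (hι N) (hd N)).2 fun v => ⟨fun hv => ?_, ?_⟩
  · refine (hex y).1 ?_
    rw [AddMonoidHom.sub_apply, hy, sub_self]
  · rw [map_sub_right _ _ _ _ (hξ N) (hu N), sub_eq_zero] at hv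
    -- Rebracketing moves `hv` to `(T ⊗ X) ⊗ N`, where `exists_map_inclC_eq` applies.
    obtain ⟨w, rfl⟩ := assoc.surjective v
    rw [← map_assoc (rightLin_map _ _ _ H.ξC_left H.ξC_right),
      ← map_assoc (rightLin_map _ _ _ (unitL_left α _) (unitL_right α _ α))] at hv
    obtain ⟨w', rfl⟩ := E.exists_map_inclC_eq w (assoc.injective hv)
    exact ⟨assoc w', (map_assoc (H.inclC_right T) (hι N) w').symm⟩
  · rintro ⟨w, rfl⟩
    induction w using Tens.induction with
    | zero => simp only [map_zero]
    | add x y hx hy => simp only [map_add, hx, hy, add_zero]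
    | tmul t w =>
      rw [map_tmul, map_tmul]
      refine (congrArg _ ?_).trans (tmul_zero ..)
      induction w using Tens.induction with
      | zero => simp only [map_zero]
      | add x y hx hy => simp only [map_add, hx, hy, add_zero]
      | tmul c n =>
        rw [AddMonoidHom.sub_apply, sub_eq_zero, map_tmul, map_tmul, map_tmul, ξC_ιC]
        rfl

end FaithfullyFlat

end Herd

namespace Tens

variable {R A K : Type*} [Ring R] [Ring A] [Ring K] {α : R →+* A} {σ : R →+* K}
  {N : Type*} [AddCommGroup N]

theorem actR_self [Module K N] (a : A) (v : Tens α σ A N) :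
    actR α σ A N (tmul α α a v) = a • v := by
  induction v using Tens.induction with
  | zero => simp only [tmul_zero, map_zero, smul_zero]
  | add x y hx hy => simp only [tmul_add_right, map_add, smul_add, hx, hy]
  | tmul m n => rfl

theorem assoc_unitL [Module A N] {L Q : Type*} [Ring L] [AddCommGroup Q] [Module L Q]
    {Q' L' : Type*} [Ring Q'] [Ring L'] {τ : Q' →+* L'} {τ' : Q' →+* L}
    [Module L'ᵐᵒᵖ N] [SMulCommClass A L'ᵐᵒᵖ N] (h : RightLin τ τ (unitL α N))
    (z : Tens τ τ' N Q) :
    assoc (map (unitL α N) h (AddMonoidHom.id Q) (leftLin_id τ') z) = tmul α α 1 z := by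
  induction z using Tens.induction with
  | zero => simp only [tmul_zero, map_zero]
  | add x y hx hy => simp only [tmul_add_right, map_add, hx, hy]
  | tmul m n => rfl

end Tens

/-! ### The coring `C`, its entwining with `A`, and the entwined module `T` -/

namespace Herd

variable {R S A B T T' : Type u} [Ring R] [Ring S] [Ring A] [Ring B] {α : R →+* A} {β : S →+* B}
  [AddCommGroup T] [Module B T] [Module Aᵐᵒᵖ T] [SMulCommClass B Aᵐᵒᵖ T]
  [AddCommGroup T'] [Module A T'] [Module Bᵐᵒᵖ T'] [SMulCommClass A Bᵐᵒᵖ T'] {H : Herd α β T T'}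

theorem comulC_ξC (H : Herd α β T T') (z : Tens β β T' T) :
    map (AddMonoidHom.id _) (rightLin_id α) H.ξC H.ξC_left (H.comulC z) =
      map (AddMonoidHom.id _) (rightLin_id α) (unitL α _) (unitL_left α _) (H.comulC z) := by
  induction z using Tens.induction with
  | zero => simp only [map_zero]
  | add x y hx hy => simp only [map_add, hx, hy]
  | tmul x' x => rw [comulC_tmul, ← penC_map, ← penC_map, γ_ξC]

theorem inclCC_left (H : Herd α β T T') : LeftLin (RingHom.id R) α H.inclCC :=
  leftLin_map _ _ _ _ H.ιC_left

theorem inclCC_right (H : Herd α β T T') : RightLin (RingHom.id R) α H.inclCC :=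
  rightLin_map _ _ _ _ H.ιC_right

/-- Factor through `X ⊗_R C`: purity handles the first step, and the second is `inclC` for the right
`A`-module `X`. -/
theorem inclCC_injective (E : H.LiftC) (hp : H.IsPureC) : Function.Injective H.inclCC := by
  have h := (E.inclC_injective (Tens β β T' T)).comp (hp.injective H.C)
  convert h using 1
  funext z
  symm
  exact map_comp H.ιC_right H.ιC_left (fun _ => rfl) (fun _ => rfl) z

/-- Again through `M ⊗ X ⊗ C`. With a right `A`-module in front both steps are split by `retr`, for
`M` and then for `M ⊗ X`, so purity does not enter. -/
theorem map_inclCC_injective (E : H.LiftC) (M : Type*) [AddCommGroup M] [Module Aᵐᵒᵖ M] :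
    Function.Injective (map (AddMonoidHom.id M) (rightLin_id α) H.inclCC H.inclCC_left) := by
  have hX : LeftLin α α (H.inclC (Tens β β T' T)) := fun r z => H.inclC_smul _ (α r) z
  have h2 : Function.Injective (map (AddMonoidHom.id M) (rightLin_id α)
      (H.inclC (Tens β β T' T)) hX) := by
    have h3 := assoc.injective.comp ((E.inclC_injective
      (Tens α α M (Tens β β T' T))).comp (assoc (ρ := α) (σ := α)).symm.injective)
    convert h3 using 1
    funext z
    obtain ⟨w, rfl⟩ := assoc.surjective z
    simp only [Function.comp_apply, AddEquiv.symm_apply_apply]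
    induction w using Tens.induction with
    | zero => simp only [map_zero]
    | add x y hx hy => simp only [map_add, hx, hy]
    | tmul w c =>
      induction w using Tens.induction with
      | zero => simp only [zero_tmul, map_zero]
      | add x y hx hy => simp only [map_add, tmul_add_left, hx, hy]
      | tmul m z => rfl
  have h := h2.comp (E.map_map_ιC_injective M (N := H.C) (RingHom.id R))
  convert h using 1
  funext z
  symm
  exact map_comp (rightLin_id _) H.inclCC_left (fun _ => rfl)
    (fun z => map_comp H.ιC_right H.ιC_left (fun _ => rfl) (fun _ => rfl) z) z

theorem map_ιC_inclCC_injective (E : H.LiftC) (hp : H.IsPureC) :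
    Function.Injective (map H.ιC H.ιC_right H.inclCC H.inclCC_left) := by
  have h := (map_inclCC_injective E (Tens β β T' T)).comp
    (hp.injective (Tens (RingHom.id R) (RingHom.id R) H.C H.C))
  convert h using 1
  funext z
  symm
  exact map_comp H.ιC_right H.inclCC_left (fun _ => rfl) (fun _ => rfl) z

theorem LiftC.inclC_retr_comulC (E : H.LiftC) (z : Tens β β T' T) :
    H.inclC _ (E.retr _ (H.comulC z)) = H.comulC z := by
  rw [E.inclC_retr, comulC_ξC, actR_unitL]

theorem LiftC.inclC_retr_γ (E : H.LiftC) (x : T) :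
    H.inclC _ (E.retr _ (H.γ x)) = H.γ x := by
  rw [E.inclC_retr, γ_ξC, actR_unitL]

/-- The legs are restricted one at a time. `γ_ξC` puts the second leg in `C`, so the element lives
in `X ⊗_R C`. Purity with `N = C` then restricts the first leg, and its hypothesis, checked in `A ⊗
X ⊗ X`, is `ξC_comulC` together with `ξ(c) = 1 ⊗ c`. -/
theorem exists_inclCC_eq_comulC (E : H.LiftC) (hp : H.IsPureC) (c : H.C) :
    ∃ w, H.inclCC w = H.comulC (H.ιC c) := by
  obtain ⟨w, hw⟩ := hp.exact H.C (E.retr _ (H.comulC (H.ιC c))) (by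
    refine E.inclC_injective _ ?_
    refine (map_comm ..).symm.trans (Eq.trans ?_ (map_comm ..))
    refine (congrArg (map H.ξC _ _ _) (E.inclC_retr_comulC _)).trans (Eq.trans ?_
      (congrArg (map (unitL α _) (unitL_right α _ α) _ _) (E.inclC_retr_comulC _)).symm)
    apply assoc.injective
    rw [assoc_unitL, ← ξC_comulC, ξC_ιC]
    rfl)
  refine ⟨w, ?_⟩
  rw [← E.inclC_retr_comulC, ← hw]
  exact (map_comp H.ιC_right H.ιC_left (fun _ => rfl) (fun _ => rfl) w).symm

/-- By `ξC_ev`, `ev(c) ⊗ 1 = 1 ⊗ ev(c)` on `C`, so `ev(c)` comes from a unique element of `R`. -/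
theorem exists_counitC (H : Herd α β T T') (hm : IsEffectiveMono α) :
    ∃ ε : H.C →+ R, ∀ c, α (ε c) = H.ev (H.ιC c) := by
  refine exists_lift_of_injective (i := α.toAddMonoidHom) hm.1 (H.ev.comp H.ιC) fun c => hm.2 _ ?_
  have h := H.ξC_ev (H.ιC c)
  rw [ξC_ιC] at h
  exact h.symm

theorem ιC_lid_counit {ε : H.C →+ R} (hε : ∀ c, α (ε c) = H.ev (H.ιC c))
    (hr : RightLin (RingHom.id R) (RingHom.id R) ε)
    (w : Tens (RingHom.id R) (RingHom.id R) H.C H.C) :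
    H.ιC (lid (RingHom.id R) H.C (map ε hr (AddMonoidHom.id H.C) (leftLin_id _) w)) =
      lact α _ (map H.ev H.ev_rightLin (AddMonoidHom.id _) (leftLin_id α) (H.inclCC w)) := by
  induction w using Tens.induction with
  | zero => simp only [map_zero]
  | add x y hx hy => simp only [map_add, hx, hy]
  | tmul c d =>
    change α (ε c) • H.ιC d = H.ev (H.ιC c) • H.ιC d
    rw [hε]

theorem ιC_rid_counit {ε : H.C →+ R} (hε : ∀ c, α (ε c) = H.ev (H.ιC c))
    (hl : LeftLin (RingHom.id R) (RingHom.id R) ε)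
    (w : Tens (RingHom.id R) (RingHom.id R) H.C H.C) :
    H.ιC (rid (RingHom.id R) H.C (map (AddMonoidHom.id H.C) (rightLin_id _) ε hl w)) =
      ract α _ (map (AddMonoidHom.id _) (rightLin_id α) H.ev H.ev_leftLin (H.inclCC w)) := by
  induction w using Tens.induction with
  | zero => simp only [map_zero]
  | add x y hx hy => simp only [map_add, hx, hy]
  | tmul c d =>
    change op (α (ε d)) • H.ιC c = op (H.ev (H.ιC d)) • H.ιC c
    rw [hε]

theorem rid_counit {ε : H.C →+ R} (hε : ∀ c, α (ε c) = H.ev (H.ιC c))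
    (hl : LeftLin (RingHom.id R) (RingHom.id R) ε) (M : Type*) [AddCommGroup M]
    [Module Aᵐᵒᵖ M] (w : Tens α (RingHom.id R) M H.C) :
    rid α M (map (AddMonoidHom.id M) (rightLin_id _) ε hl w) =
      ract α _ (map (AddMonoidHom.id _) (rightLin_id α) H.ev H.ev_leftLin (H.inclC M w)) := by
  induction w using Tens.induction with
  | zero => simp only [map_zero]
  | add x y hx hy => simp only [map_add, hx, hy]
  | tmul c d =>
    change op (α (ε d)) • c = op (H.ev (H.ιC d)) • c
    rw [hε]

theorem ract_unit {M : Type*} [AddCommGroup M] [Module Aᵐᵒᵖ M] (m : M) :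
    ract α M (tmul α α m 1) = m := by
  change op (1 : A) • m = m
  rw [op_one, one_smul]

/-- The coring structure on `C`. -/
def coringC (E : H.LiftC) (hp : H.IsPureC) (hm : IsEffectiveMono α)
    {Δ : H.C →+ Tens (RingHom.id R) (RingHom.id R) H.C H.C}
    (hΔ : ∀ c, H.inclCC (Δ c) = H.comulC (H.ιC c)) {ε : H.C →+ R}
    (hε : ∀ c, α (ε c) = H.ev (H.ιC c)) : Coring R H.C where
  comul := Δ
  comul_left r c := inclCC_injective E hp <| by
    rw [H.inclCC_left, hΔ, hΔ, H.ιC_left, H.comulC_left]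
  comul_right r c := inclCC_injective E hp <| by
    rw [H.inclCC_right, hΔ, hΔ, H.ιC_right, H.comulC_right]
  counit := ε
  counit_left r c := hm.1 <| by
    rw [hε, H.ιC_left, H.ev_leftLin, smul_eq_mul, smul_eq_mul, map_mul, hε]; rfl
  counit_right r c := hm.1 <| by
    rw [hε, H.ιC_right, H.ev_rightLin, op_smul_eq_mul, op_smul_eq_mul, map_mul, hε]; rfl
  coassoc c := by
    -- The identity is checked in `X ⊗ X ⊗ X`, where it is `comulC_coassoc`.
    apply map_ιC_inclCC_injective E hp
    have hl : LeftLin (RingHom.id R) α (H.comulC.comp H.ιC) := fun r c => by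
      rw [AddMonoidHom.comp_apply, AddMonoidHom.comp_apply, H.ιC_left, H.comulC_left]
    have hr : RightLin (RingHom.id R) α (H.comulC.comp H.ιC) := fun r c => by
      rw [AddMonoidHom.comp_apply, AddMonoidHom.comp_apply, H.ιC_right, H.comulC_right]
    refine (map_assoc H.inclCC_right H.inclCC_left _).symm.trans (Eq.trans ?_
      (map_comp (f'' := H.ιC) (g'' := H.comulC.comp H.ιC) H.ιC_right hl (fun _ => rfl) hΔ _).symm)
    refine Eq.trans ?_ (map_comp (f := H.ιC) (g := H.ιC) (f' := AddMonoidHom.id _) H.ιC_right hl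
      (hf := H.ιC_right) (hg := H.ιC_left) (hf' := rightLin_id α) (hg' := H.comulC_left)
      (fun _ => rfl) (fun _ => rfl) _)
    refine Eq.trans ?_ (congrArg _ (hΔ c)).symm
    rw [comulC_coassoc, ← hΔ]
    congr 1
    exact (map_comp (f'' := H.comulC.comp H.ιC) hr H.ιC_left hΔ (fun _ => rfl) _).trans
      (map_comp hr H.ιC_left (fun _ => rfl) (fun _ => rfl) _).symm
  counit_comul c := Subtype.val_injective <| by
    refine (ιC_lid_counit hε _ _).trans ?_
    rw [hΔ]
    -- `ξ` is by definition `comulC` followed by `ev` on the first factor, so the left counit law is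
    -- the section property of `ξ`.
    exact H.lact_ξC _
  comul_counit c := Subtype.val_injective <| by
    refine (ιC_rid_counit hε _ _).trans ?_
    rw [hΔ, comulC_ev, ract_unit]; rfl

/-- The entwining map `c ⊗ a ↦ ξ(c a)`. -/
def LiftC.ψ (E : H.LiftC) : Tens (RingHom.id R) α H.C A →+ Tens α (RingHom.id R) A H.C :=
  lift (fun c a => E.ξ (op a • H.ιC c)) (fun c c' a => by rw [map_add, smul_add, map_add])
    (fun c a a' => by rw [op_add, add_smul, map_add])
    (fun r c a => by
      rw [H.ιC_right, smul_smul, ← op_mul]; rfl)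

namespace LiftC

variable (E : H.LiftC)

theorem ψ_tmul (c : H.C) (a : A) : E.ψ (tmul _ _ c a) = E.ξ (op a • H.ιC c) := rfl

theorem inclC_ψ (c : H.C) (a : A) : H.inclC A (E.ψ (tmul _ _ c a)) = H.ξC (op a • H.ιC c) :=
  E.incl_ξ _

theorem ψ_left : LeftLin (RingHom.id R) α E.ψ := fun r z => by
  induction z using Tens.induction with
  | zero => simp only [map_zero, smul_zero]
  | add x y hx hy => simp only [map_add, smul_add, hx, hy]
  | tmul c a =>
    rw [smul_tmul, ψ_tmul, ψ_tmul, H.ιC_left, ← smul_comm (α r) (op a) (H.ιC c), E.left]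

theorem ψ_right : RightLin α (RingHom.id R) E.ψ := fun r z => by
  induction z using Tens.induction with
  | zero => simp only [map_zero, smul_zero]
  | add x y hx hy => simp only [map_add, smul_add, hx, hy]
  | tmul c a =>
    rw [op_smul_tmul, ψ_tmul, ψ_tmul, op_smul_eq_mul, op_mul, mul_smul, E.right]

theorem inclC_actR (M : Type*) [AddCommGroup M] [Module Aᵐᵒᵖ M] (m : M)
    (v : Tens α (RingHom.id R) A H.C) :
    H.inclC M (actR α (RingHom.id R) M H.C (tmul α α m v)) =
      actR α α M _ (tmul α α m (H.inclC A v)) := by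
  induction v using Tens.induction with
  | zero => simp only [map_zero, tmul_zero]
  | add x y hx hy => simp only [map_add, tmul_add_right, hx, hy]
  | tmul a c => rfl

/-- Under the identification of `A ⊗_R C` with `X` by the action, the entwined right action of `b`
is ordinary right multiplication on `X`; this is left `A`-linearity of `ξ`. -/
theorem rightEntwinedAct_self (w : Tens α (RingHom.id R) A H.C) (b : A) :
    rightEntwinedAct α E.ψ E.ψ_left A (tmul _ _ w b) =
      E.ξ (op b • lact α _ (H.inclC A w)) := by
  induction w using Tens.induction with
  | zero => simp only [map_zero, zero_tmul, smul_zero]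
  | add x y hx hy => simp only [map_add, tmul_add_left, smul_add, hx, hy]
  | tmul a c =>
    change actR α (RingHom.id R) A H.C (tmul α α a (E.ξ (op b • H.ιC c))) =
      E.ξ (op b • a • H.ιC c)
    rw [actR_self, ← smul_comm a (op b) (H.ιC c), E.left]

theorem inclC_rightEntwinedAct (M : Type*) [AddCommGroup M] [Module Aᵐᵒᵖ M]
    (w : Tens α (RingHom.id R) M H.C) (a : A) :
    H.inclC M (rightEntwinedAct α E.ψ E.ψ_left M (tmul _ _ w a)) =
      H.entC M a (H.inclC M w) := by
  induction w using Tens.induction with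
  | zero => simp only [map_zero, zero_tmul]
  | add x y hx hy => simp only [map_add, tmul_add_left, hx, hy]
  | tmul m c =>
    change H.inclC M (actR α (RingHom.id R) M H.C (tmul α α m (E.ξ (op a • H.ιC c)))) =
      H.entC M a (tmul α α m (H.ιC c))
    rw [inclC_actR, E.incl_ξ, entC_tmul]

theorem map_inclCC_assoc (v : Tens α (RingHom.id R) A H.C) (c : H.C) :
    map (AddMonoidHom.id A) (rightLin_id α) H.inclCC H.inclCC_left
        (assoc (tmul (RingHom.id R) (RingHom.id R) v c)) =
      assoc (tmul α α (H.inclC A v) (H.ιC c)) := by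
  induction v using Tens.induction with
  | zero => simp only [map_zero, zero_tmul]
  | add x y hx hy => simp only [map_add, tmul_add_left, hx, hy]
  | tmul a c => rfl

theorem map_inclCC_ψ_assoc (c : H.C) (v : Tens α (RingHom.id R) A H.C) :
    map (AddMonoidHom.id A) (rightLin_id α) H.inclCC H.inclCC_left
        (assoc (map E.ψ E.ψ_right (AddMonoidHom.id H.C) (leftLin_id (RingHom.id R))
          (assoc.symm (tmul (RingHom.id R) α c v)))) =
      assoc (map H.ξC H.ξC_right (AddMonoidHom.id _) (leftLin_id α)
        (actR α α _ _ (tmul α α (H.ιC c) (H.inclC A v)))) := by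
  induction v using Tens.induction with
  | zero => simp only [map_zero, tmul_zero]
  | add x y hx hy => simp only [map_add, tmul_add_right, hx, hy]
  | tmul a d =>
    refine (map_inclCC_assoc (E.ξ (op a • H.ιC c)) d).trans ?_
    rw [E.incl_ξ]
    rfl

/-- Passing `a` through `c ⊗ d` from the right: the inner `ψ` gives `c ξ(d a)`, which is `entC`, and
the outer one is `ξ` on the first factor. Read in `A ⊗ X ⊗ X` this no longer mentions `C`. -/
theorem map_inclCC_ψ_ψ (w : Tens (RingHom.id R) (RingHom.id R) H.C H.C) (a : A) :
    map (AddMonoidHom.id A) (rightLin_id α) H.inclCC H.inclCC_left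
        (assoc (map E.ψ E.ψ_right (AddMonoidHom.id H.C) (leftLin_id (RingHom.id R))
          (assoc.symm (map (AddMonoidHom.id H.C) (rightLin_id _) E.ψ E.ψ_left
            (assoc (tmul (RingHom.id R) α w a)))))) =
      assoc (map H.ξC H.ξC_right (AddMonoidHom.id _) (leftLin_id α)
        (H.entC _ a (H.inclCC w))) := by
  induction w using Tens.induction with
  | zero => simp only [map_zero, zero_tmul]
  | add x y hx hy => simp only [map_add, tmul_add_left, hx, hy]
  | tmul c d =>
    refine (E.map_inclCC_ψ_assoc c (E.ξ (op a • H.ιC d))).trans ?_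
    rw [E.incl_ξ]
    rfl

end LiftC

/-- The entwining of `C` with `A`. -/
def entwiningC (E : H.LiftC) (hp : H.IsPureC) (hm : IsEffectiveMono α)
    {Δ : H.C →+ Tens (RingHom.id R) (RingHom.id R) H.C H.C}
    (hΔ : ∀ c, H.inclCC (Δ c) = H.comulC (H.ιC c)) {ε : H.C →+ R}
    (hε : ∀ c, α (ε c) = H.ev (H.ιC c)) : RightEntwining α (coringC E hp hm hΔ hε) where
  ψ := E.ψ
  left_lin := E.ψ_left
  right_lin := E.ψ_right
  ψ_mul c a b := by
    -- Both sides are `ξ` of an element of `X`, namely `c(ab)` and `(ca)b`; `lact_ξC` recovers `ca`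
    -- from `ψ(c ⊗ a)`.
    rw [E.rightEntwinedAct_self, E.inclC_ψ, lact_ξC, smul_smul, E.ψ_tmul]
    rfl
  ψ_one c := by rw [E.ψ_tmul, op_one, one_smul, E.ξ_ιC]
  ψ_comul z := by
    apply map_inclCC_injective E A
    induction z using Tens.induction with
    | zero => simp only [map_zero]
    | add x y hx hy => simp only [map_add, hx, hy]
    | tmul c a =>
      have hl : LeftLin (RingHom.id R) α (H.comulC.comp H.ιC) := fun r c => by
        rw [AddMonoidHom.comp_apply, AddMonoidHom.comp_apply, H.ιC_left, H.comulC_left]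
      refine Eq.trans ?_ (E.map_inclCC_ψ_ψ (Δ c) a).symm
      -- Both sides are the image of `c a`: the right one reduces to `(ξ ⊗ X) comulC(c a)`, and
      -- `ξC_comulC` rewrites that as `(A ⊗ comulC) ξ(c a)`.
      rw [hΔ, entC_comulC, ← ξC_comulC, ← E.inclC_ψ]
      exact (map_comp (rightLin_id _) hl (fun _ => rfl) hΔ _).trans
        (map_comp (rightLin_id _) hl (fun _ => rfl) (fun _ => rfl) _).symm
  ψ_counit z := by
    refine (rid_counit hε _ A _).trans ?_
    induction z using Tens.induction with
    | zero => simp only [map_zero]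
    | add x y hx hy => simp only [map_add, hx, hy]
    | tmul c a =>
      rw [E.inclC_ψ, ξC_ev, ract_unit]
      change H.ev (op a • H.ιC c) = α (ε c) * a
      rw [H.ev_right, hε]

/-- The entwined module `T`. -/
def moduleC (E : H.LiftC) (hp : H.IsPureC) (hm : IsEffectiveMono α)
    {Δ : H.C →+ Tens (RingHom.id R) (RingHom.id R) H.C H.C}
    (hΔ : ∀ c, H.inclCC (Δ c) = H.comulC (H.ιC c)) {ε : H.C →+ R}
    (hε : ∀ c, α (ε c) = H.ev (H.ιC c)) : RightEntwinedModule (entwiningC E hp hm hΔ hε) T where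
  -- By `γ_ξC` the element `γ(x)` already comes from `T ⊗_R C`; the retraction merely selects its
  -- preimage.
  coact := (E.retr T).comp H.γ
  right_lin r x := by
    rw [AddMonoidHom.comp_apply, AddMonoidHom.comp_apply, H.γ_right, E.retr_right]
  coassoc x := by
    apply map_inclCC_injective E T
    have hl : LeftLin (RingHom.id R) α (H.comulC.comp H.ιC) := fun r c => by
      rw [AddMonoidHom.comp_apply, AddMonoidHom.comp_apply, H.ιC_left, H.comulC_left]
    refine (map_assoc (H.inclC_right T) H.inclCC_left _).symm.trans (Eq.trans ?_
      (map_comp (f'' := AddMonoidHom.id T) (g'' := H.comulC.comp H.ιC) (rightLin_id _) hl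
        (fun _ => rfl) hΔ _).symm)
    refine Eq.trans ?_ (map_comp (f := AddMonoidHom.id T) (g := H.ιC) (f' := AddMonoidHom.id _)
      (rightLin_id _) hl (hf := rightLin_id _) (hg := H.ιC_left) (hf' := rightLin_id α)
      (hg' := H.comulC_left) (fun _ => rfl) (fun _ => rfl) _)
    refine Eq.trans ?_ (congrArg _ (E.inclC_retr_γ x)).symm
    rw [γ_comulC, ← E.inclC_retr_γ x]
    congr 1
    exact (map_comp H.γ_right H.ιC_left E.inclC_retr_γ (fun _ => rfl) _).trans
      (map_comp H.γ_right H.ιC_left (fun _ => rfl) (fun _ => rfl) _).symm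
  counit x := by
    refine (rid_counit hε _ T _).trans ?_
    rw [AddMonoidHom.comp_apply, E.inclC_retr_γ, H.ev_γ, ract_unit]
  entwined x a := E.inclC_injective T <| by
    refine Eq.trans ?_ (E.inclC_rightEntwinedAct T _ a).symm
    rw [AddMonoidHom.comp_apply, AddMonoidHom.comp_apply, E.inclC_retr_γ, E.inclC_retr_γ, entC_γ]

theorem exists_entwining_right (E : H.LiftC) (hp : H.IsPureC) (hm : IsEffectiveMono α) :
    Function.Injective H.inclCC ∧ Function.Injective (H.inclC A) ∧
      Function.Injective (H.inclC T) ∧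
      ∃ 𝒞 : Coring R H.C,
        (∀ c : H.C, H.inclCC (𝒞.comul c) = H.comulC (H.ιC c)) ∧
        (∀ c : H.C, α (𝒞.counit c) = H.ev (H.ιC c)) ∧
        ∃ E : RightEntwining α 𝒞,
          (∀ (c : H.C) (a : A), H.inclC A (E.ψ (Tens.tmul (RingHom.id R) α c a)) =
            H.ξC (op a • H.ιC c)) ∧
          ∃ M : RightEntwinedModule E T, ∀ x : T, H.inclC T (M.coact x) = H.γ x := by
  obtain ⟨Δ, hΔ⟩ := exists_lift_of_injective (inclCC_injective E hp) (H.comulC.comp H.ιC)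
    (exists_inclCC_eq_comulC E hp)
  obtain ⟨ε, hε⟩ := H.exists_counitC hm
  exact ⟨inclCC_injective E hp, E.inclC_injective A, E.inclC_injective T,
    coringC E hp hm hΔ hε, hΔ, hε, entwiningC E hp hm hΔ hε, E.inclC_ψ, moduleC E hp hm hΔ hε,
    E.inclC_retr_γ⟩

/-- Faithful flatness of `T` yields the factorisation and purity; faithful flatness of `A`, on
either side, is what gives the effective monomorphism for the counit. A splitting of `α` gives all
three. -/
theorem entwining_right (H : Herd α β T T')
    (h : (RightFaithfullyFlat α T ∧ (RightFaithfullyFlat α A ∨ LeftFaithfullyFlat α A)) ∨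
      SplitExtension α) :
    Function.Injective H.inclCC ∧ Function.Injective (H.inclC A) ∧
      Function.Injective (H.inclC T) ∧
      ∃ 𝒞 : Coring R H.C,
        (∀ c : H.C, H.inclCC (𝒞.comul c) = H.comulC (H.ιC c)) ∧
        (∀ c : H.C, α (𝒞.counit c) = H.ev (H.ιC c)) ∧
        ∃ E : RightEntwining α 𝒞,
          (∀ (c : H.C) (a : A), H.inclC A (E.ψ (Tens.tmul (RingHom.id R) α c a)) =
            H.ξC (op a • H.ιC c)) ∧
          ∃ M : RightEntwinedModule E T, ∀ x : T, H.inclC T (M.coact x) = H.γ x := by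
  rcases h with ⟨hT, hA⟩ | hs
  · obtain ⟨E⟩ := liftC_of_flat (H := H) hT
    exact exists_entwining_right E (isPureC_of_flat hT)
      (hA.elim (fun h => h.isEffectiveMono) fun h => h.isEffectiveMono)
  · obtain ⟨E⟩ := H.liftC_of_split hs
    exact exists_entwining_right E (H.isPureC_of_split hs) hs.isEffectiveMono

end Herd

namespace Tens

theorem map_comm_symm {R A₁ A₂ A₁' A₂' M N M' N' : Type*} [Ring R] [Ring A₁]
    [Ring A₂] [Ring A₁'] [Ring A₂'] {ρ : R →+* A₁} {σ : R →+* A₂}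
    {ρ' : R →+* A₁'} {σ' : R →+* A₂'}
    [AddCommGroup M] [AddCommGroup N] [AddCommGroup M'] [AddCommGroup N']
    [Module A₁ᵐᵒᵖ M] [Module A₂ N] [Module A₁'ᵐᵒᵖ M'] [Module A₂' N']
    (f : M →+ M') (hf : RightLin ρ ρ' f) (g : N →+ N') (hg : LeftLin σ σ' g) (z : Tens ρ σ M N) :
    map (AddMonoidHom.id M') (rightLin_id ρ') g hg
        (map f hf (AddMonoidHom.id N) (leftLin_id σ) z) =
      map f hf (AddMonoidHom.id N') (leftLin_id σ')
        (map (AddMonoidHom.id M) (rightLin_id ρ) g hg z) :=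
  (map_comm f hf g hg z).symm

theorem map_assoc_symm {S R' A₁ A₂ A₃ A₄ A₁' A₂' A₃' A₄' M N P M' N' P' : Type*} [Ring S] [Ring R']
    [Ring A₁] [Ring A₂] [Ring A₃] [Ring A₄] [Ring A₁'] [Ring A₂'] [Ring A₃'] [Ring A₄']
    {ρ : S →+* A₁} {σ : S →+* A₂} {τ : R' →+* A₃} {υ : R' →+* A₄}
    {ρ' : S →+* A₁'} {σ' : S →+* A₂'} {τ' : R' →+* A₃'} {υ' : R' →+* A₄'}
    [AddCommGroup M] [AddCommGroup N] [AddCommGroup P]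
    [AddCommGroup M'] [AddCommGroup N'] [AddCommGroup P']
    [Module A₁ M] [Module A₂ᵐᵒᵖ N] [Module A₃ N] [SMulCommClass A₃ A₂ᵐᵒᵖ N] [Module A₄ᵐᵒᵖ P]
    [Module A₁' M'] [Module A₂'ᵐᵒᵖ N'] [Module A₃' N'] [SMulCommClass A₃' A₂'ᵐᵒᵖ N']
    [Module A₄'ᵐᵒᵖ P']
    {f : M →+ M'} {hf : LeftLin ρ ρ' f} {g : N →+ N'} {hg : RightLin σ σ' g}
    {hg' : LeftLin τ τ' g} {h : P →+ P'} {hh : RightLin υ υ' h}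
    (hfg : LeftLin τ τ' (map g hg f hf)) (hgh : RightLin σ σ' (map h hh g hg'))
    (z : Tens υ τ P (Tens σ ρ N M)) :
    assoc.symm (map h hh (map g hg f hf) hfg z) = map (map h hh g hg') hgh f hf (assoc.symm z) := by
  induction z using Tens.induction with
  | zero => simp only [map_zero]
  | add x y hx hy => simp only [map_add, hx, hy]
  | tmul p w =>
    induction w using Tens.induction with
    | zero => simp only [map_zero, tmul_zero]
    | add x y hx hy => simp only [map_add, tmul_add_right, hx, hy]
    | tmul n m => rfl

end Tens

/-! ### Herd identities for `ξ`, `γ'` and the evaluations: the `D` side -/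

namespace Herd

variable {S R B A : Type*} [Ring S] [Ring R] [Ring B] [Ring A] {β : S →+* B} {α : R →+* A}
  {T T' : Type*} [AddCommGroup T] [Module Aᵐᵒᵖ T] [Module B T] [SMulCommClass B Aᵐᵒᵖ T]
  [AddCommGroup T'] [Module Bᵐᵒᵖ T'] [Module A T'] [SMulCommClass A Bᵐᵒᵖ T'] (H : Herd α β T T')

/-- The mirror of `apply_γ_of_ev'`: in the bracketing `(T ⊗ T') ⊗ T` it is the `ev` law that needs
rebracketing, since it contracts the last two factors. -/
theorem apply_γ'_of_ev {N : Type*} [AddCommGroup N] (F : Tens β β (Tens α α T T') T →+ N)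
    (G : Tens α α T A →+ N)
    (h : ∀ t t' y, F (tmul β β (tmul α α y t') t) = G (tmul α α y (H.ev (tmul β β t' t))))
    (x : T) : F (H.γ' x) = G (tmul α α x 1) := by
  rw [← H.ev_γ, ← assoc.apply_symm_apply (H.γ x)]
  change F (H.γ' x) = G (map _ _ _ _ (assoc (H.γ' x)))
  generalize H.γ' x = w
  induction w using Tens.induction with
  | zero => simp only [map_zero]
  | add x y hx hy => simp only [map_add, hx, hy]
  | tmul z t =>
    induction z using Tens.induction with
    | zero => simp only [zero_tmul, map_zero]
    | add x y hx hy => simp only [map_add, tmul_add_left, hx, hy]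
    | tmul y t' => exact h t t' y

theorem apply_γ'_of_ev' {N : Type*} [AddCommGroup N] (F : Tens β β (Tens α α T T') T →+ N)
    (G : Tens β β B T →+ N)
    (h : ∀ t z, F (tmul β β z t) = G (tmul β β (H.ev' z) t))
    (x : T) : F (H.γ' x) = G (tmul β β 1 x) := by
  rw [← H.ev'_γ]
  change F (H.γ' x) = G (map _ _ _ _ (H.γ' x))
  generalize H.γ' x = w
  induction w using Tens.induction with
  | zero => simp only [map_zero]
  | add x y hx hy => simp only [map_add, hx, hy]
  | tmul z t => exact h t z

section Left

variable {K : Type*} [Ring K] {σ : S →+* K} {N : Type*} [AddCommGroup N] [Module Kᵐᵒᵖ N]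

/-- `n ⊗ t ↦ n ⊗ (t ⊗ x')`. -/
def penD (α : R →+* A) (σ : S →+* K) (N : Type*) [AddCommGroup N] [Module Kᵐᵒᵖ N] (x' : T') :
    Tens σ β N T →+ Tens σ β N (Tens α α T T') :=
  map (AddMonoidHom.id N) (rightLin_id σ) (tmulRight α α T x') (tmulRight_left β x')

/-- `n ⊗ t ↦ n ⊗ ev'(t ⊗ x')`. -/
def evD (σ : S →+* K) (N : Type*) [AddCommGroup N] [Module Kᵐᵒᵖ N] (x' : T') :
    Tens σ β N T →+ Tens σ β N B :=
  map (AddMonoidHom.id N) (rightLin_id σ)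
    (H.ev'.comp (tmulRight α α T x')) (fun r m => H.ev'_left (β r) (tmul α α m x'))

theorem comulD_tmul (x' : T') (x : T) : H.comulD (tmul α α x x') = penD α β _ x' (H.γ' x) := rfl

theorem map_ev'_penD (x' : T') (z : Tens σ β N T) :
    map (AddMonoidHom.id N) (rightLin_id σ) H.ev' H.ev'_leftLin (penD α σ N x' z) =
      H.evD σ N x' z :=
  map_comp _ _ (fun _ => rfl) (fun _ => rfl) z

theorem ξD_tmul (x' : T') (x : T) : H.ξD (tmul α α x x') = H.evD β _ x' (H.γ' x) :=
  H.map_ev'_penD x' (H.γ' x)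

theorem comulD_right : RightLin β β H.comulD := fun r z => by
  have h := rightLin_map (τ := β) (τ' := β) H.γ' H.γ'_right (AddMonoidHom.id T')
    (leftLin_id α) (rightLin_id β) r z
  simp only [comulD, AddMonoidHom.comp_apply, AddEquiv.coe_toAddMonoidHom]
  rw [h, assoc_op_smul]

theorem comulD_left : LeftLin β β H.comulD := fun r z => by
  have h := leftLin_map (τ := β) (τ' := β) H.γ' H.γ'_right (AddMonoidHom.id T')
    (leftLin_id α) H.γ'_left r z
  simp only [comulD, AddMonoidHom.comp_apply, AddEquiv.coe_toAddMonoidHom]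
  rw [h, assoc_smul]

theorem ev'_rightLin : RightLin β β H.ev' := fun r z => H.ev'_right (β r) z

theorem ξD_right : RightLin β β H.ξD := fun r z => H.ξD_op_smul (β r) z

theorem ξD_left : LeftLin β β H.ξD := H.ξD_smul

/-- In Sweedler form: `x¹ ⊗ x² ev'(x³ ⊗ x') = x¹ ⊗ ev(x² ⊗ x³) x' = x ⊗ x'`. -/
theorem ract_ξD (z : Tens α α T T') : ract β _ (H.ξD z) = z := by
  induction z using Tens.induction with
  | zero => simp only [map_zero]
  | add x y hx hy => simp only [map_add, hx, hy]
  | tmul x x' =>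
    rw [ξD_tmul]
    have hr : LeftLin α α (AddMonoidHom.mk' (fun b : A => b • x')
      fun b c => by rw [add_smul]) := fun r b => by simp [mul_smul]
    refine (H.apply_γ'_of_ev ((ract β _).comp (H.evD β _ x'))
      (map (AddMonoidHom.id T) (rightLin_id α) _ hr) (fun t t' y => ?_) x).trans ?_
    · change tmul α α y (op (H.ev' (tmul α α t x')) • t') =
        tmul α α y (H.ev (tmul β β t' t) • x')
      rw [H.ev_smul]
    · change tmul α α x ((1 : A) • x') = _
      rw [one_smul]

/-- The axiom `γ_coassoc` is bracketed to the right, so all five factors are rebracketed before it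
reads as a statement on `(Y ⊗ Y) ⊗ T`, `Y = T ⊗_R T'`. -/
theorem γ'_comulD (x : T) :
    map H.comulD H.comulD_right (AddMonoidHom.id T) (leftLin_id β) (H.γ' x) =
      assoc.symm (map (AddMonoidHom.id _) (rightLin_id β) H.γ' H.γ'_left (H.γ' x)) := by
  have hs : LeftLin β β (assoc (ρ := α) (σ := α) (ρ' := β) (σ' := β) (M := T) (N := T')
      (P := T)).symm.toAddMonoidHom := fun r z => assoc_symm_smul (β r) z
  have h := congrArg (assoc.symm.toAddMonoidHom.comp ((map (AddMonoidHom.id (Tens α α T T'))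
    (rightLin_id β) _ hs).comp (assoc (ρ := α) (σ := α) (ρ' := β) (σ' := β) (M := T) (N := T')
      (P := Tens α α T (Tens β β T' T))).symm.toAddMonoidHom)) (H.γ_coassoc x)
  change map _ _ _ _ (assoc.symm (H.γ x)) = assoc.symm (map _ _ _ _ (assoc.symm (H.γ x)))
  refine Eq.trans ?_ (h.trans ?_)
  · generalize H.γ x = w
    induction w using Tens.induction with
    | zero => simp only [map_zero]
    | add x y hx hy => simp only [map_add, hx, hy]
    | tmul t w =>
      induction w using Tens.induction with
      | zero => simp only [map_zero, tmul_zero]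
      | add x y hx hy => simp only [map_add, tmul_add_right, hx, hy]
      | tmul t' y =>
        change tmul β β (assoc (tmul α α (assoc.symm (H.γ t)) t')) y = assoc.symm (map _
          (rightLin_id β) _ hs (assoc.symm (map _ (rightLin_id α) assoc.toAddMonoidHom
            (fun r z => assoc_smul (α r) z) (assoc (tmul α α (H.γ t) (tmul β β t' y))))))
        -- The inner `γ t` is not a simple tensor. Replacing it by an arbitrary `v` allows a second
        -- expansion, after which both bracketings agree by computation.
        generalize H.γ t = v
        induction v using Tens.induction with
        | zero => simp only [map_zero, zero_tmul]
        | add x y hx hy => simp only [map_add, tmul_add_left, hx, hy]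
        | tmul s v =>
          induction v using Tens.induction with
          | zero => simp only [map_zero, tmul_zero, zero_tmul]
          | add x y hx hy => simp only [map_add, tmul_add_left, tmul_add_right, hx, hy]
          | tmul s' u => rfl
  · generalize H.γ x = w
    induction w using Tens.induction with
    | zero => simp only [map_zero]
    | add x y hx hy => simp only [map_add, hx, hy]
    | tmul t w =>
      induction w using Tens.induction with
      | zero => simp only [map_zero, tmul_zero]
      | add x y hx hy => simp only [map_add, tmul_add_right, hx, hy]
      | tmul t' y => rfl

theorem penD_map {K' : Type*} [Ring K'] {σ' : S →+* K'} {N' : Type*} [AddCommGroup N']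
    [Module K'ᵐᵒᵖ N']
    (g : N →+ N') (hg : RightLin σ σ' g) (x' : T') (z : Tens σ β N T) :
    penD α σ' N' x' (map g hg (AddMonoidHom.id T) (leftLin_id β) z) =
      map g hg (AddMonoidHom.id _) (leftLin_id β) (penD α σ N x' z) :=
  map_comm_symm ..

theorem evD_map {K' : Type*} [Ring K'] {σ' : S →+* K'} {N' : Type*} [AddCommGroup N']
    [Module K'ᵐᵒᵖ N']
    (g : N →+ N') (hg : RightLin σ σ' g) (x' : T') (z : Tens σ β N T) :
    H.evD σ' N' x' (map g hg (AddMonoidHom.id T) (leftLin_id β) z) =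
      map g hg (AddMonoidHom.id _) (leftLin_id β) (H.evD σ N x' z) :=
  map_comm_symm ..

theorem penD_assoc {L : Type*} [Ring L] {τ : S →+* L} {Q : Type*} [AddCommGroup Q]
    [Module Lᵐᵒᵖ Q] [Module B N] [SMulCommClass B Kᵐᵒᵖ N] (x' : T')
    (z : Tens τ β Q (Tens σ β N T)) :
    penD α σ _ x' (assoc.symm z) = assoc.symm (map (AddMonoidHom.id Q) (rightLin_id τ)
      (penD α σ N x') (leftLin_map _ _ _ _ (leftLin_id β)) z) := by
  induction z using Tens.induction with
  | zero => simp only [map_zero]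
  | add x y hx hy => simp only [map_add, hx, hy]
  | tmul p w =>
    induction w using Tens.induction with
    | zero => simp only [map_zero, tmul_zero]
    | add x y hx hy => simp only [map_add, tmul_add_right, hx, hy]
    | tmul n m => rfl

theorem comulD_coassoc (z : Tens α α T T') :
    map H.comulD H.comulD_right (AddMonoidHom.id _) (leftLin_id β) (H.comulD z) =
      assoc.symm (map (AddMonoidHom.id _) (rightLin_id β) H.comulD H.comulD_left (H.comulD z)) := by
  induction z using Tens.induction with
  | zero => simp only [map_zero]
  | add x y hx hy => simp only [map_add, hx, hy]
  | tmul x x' =>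
    rw [comulD_tmul, ← penD_map, γ'_comulD, penD_assoc]
    congr 1
    generalize H.γ' x = w
    refine (map_comp (f'' := AddMonoidHom.id _) (g'' := H.comulD.comp (tmulRight α α T x'))
      (rightLin_id β) (fun r x => H.comulD_left r (tmul α α x x')) (fun _ => rfl)
      (fun _ => rfl) w).trans ?_
    symm
    exact map_comp _ _ (fun _ => rfl) (fun _ => rfl) w

theorem map_ev'_assoc {L : Type*} [Ring L] {τ : S →+* L} {Q : Type*} [AddCommGroup Q]
    [Module Lᵐᵒᵖ Q] [Module B N] [SMulCommClass B Kᵐᵒᵖ N]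
    (z : Tens τ β Q (Tens σ β N (Tens α α T T'))) :
    map (AddMonoidHom.id _) (rightLin_id σ) H.ev' H.ev'_leftLin (assoc.symm z) =
      assoc.symm (map (AddMonoidHom.id Q)
        (rightLin_id τ) (map (AddMonoidHom.id N) (rightLin_id σ) H.ev' H.ev'_leftLin)
        (leftLin_map _ _ _ _ (leftLin_id β)) z) := by
  induction z using Tens.induction with
  | zero => simp only [map_zero]
  | add x y hx hy => simp only [map_add, hx, hy]
  | tmul p w =>
    induction w using Tens.induction with
    | zero => simp only [map_zero, tmul_zero]
    | add x y hx hy => simp only [map_add, tmul_add_right, hx, hy]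
    | tmul n m => rfl

theorem ξD_comulD (z : Tens α α T T') :
    map H.comulD H.comulD_right (AddMonoidHom.id B) (leftLin_id β) (H.ξD z) =
      assoc.symm (map (AddMonoidHom.id _) (rightLin_id β) H.ξD H.ξD_left (H.comulD z)) := by
  have h := congrArg (map (AddMonoidHom.id _) (rightLin_id β) H.ev' H.ev'_leftLin)
    (H.comulD_coassoc z)
  rw [map_comm_symm, map_ev'_assoc, map_comp (rightLin_id β) H.ξD_left (fun _ => rfl)
    (fun _ => rfl)] at h
  exact h

/-- Applying `ev'` in the middle of coassociativity contracts `ev'(x³¹ ⊗ x³²) ⊗ x³³` to `1 ⊗ x³`, so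
the first two factors of `γ'(x)` behave like elements of `D`. -/
theorem γ'_ξD (x : T) :
    map H.ξD H.ξD_right (AddMonoidHom.id T) (leftLin_id β) (H.γ' x) =
      map (unitR β _) (unitR_right β _) (AddMonoidHom.id T) (leftLin_id β) (H.γ' x) := by
  have hev : RightLin β β (map (AddMonoidHom.id (Tens α α T T')) (rightLin_id β) H.ev'
    H.ev'_leftLin) := rightLin_map _ _ _ _ H.ev'_rightLin
  have h := congrArg (map _ hev (AddMonoidHom.id T) (leftLin_id β)) (H.γ'_comulD x)
  rw [map_comp H.ξD_right (leftLin_id β) (fun _ => rfl) (fun _ => rfl)] at h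
  rw [h]
  generalize H.γ' x = w
  induction w using Tens.induction with
  | zero => simp only [map_zero]
  | add x y hx hy => simp only [map_add, hx, hy]
  | tmul z t =>
    exact H.apply_γ'_of_ev' ((map _ hev (AddMonoidHom.id T) (leftLin_id β)).comp
      (assoc.symm.toAddMonoidHom.comp (tmulLeft β β _ z)))
      (assoc.symm.toAddMonoidHom.comp (tmulLeft β β _ z)) (fun t w => rfl) t

theorem ξD_ξD (z : Tens α α T T') :
    map H.ξD H.ξD_right (AddMonoidHom.id B) (leftLin_id β) (H.ξD z) =
      map (unitR β _) (unitR_right β _) (AddMonoidHom.id B) (leftLin_id β) (H.ξD z) := by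
  induction z using Tens.induction with
  | zero => simp only [map_zero]
  | add x y hx hy => simp only [map_add, hx, hy]
  | tmul x x' => rw [ξD_tmul, ← evD_map, ← evD_map, γ'_ξD]

theorem comulD_ev' (z : Tens α α T T') :
    map H.ev' H.ev'_rightLin (AddMonoidHom.id _) (leftLin_id β) (H.comulD z) = tmul β β 1 z := by
  induction z using Tens.induction with
  | zero => simp only [map_zero, tmul_zero]
  | add x y hx hy => simp only [map_add, tmul_add_right, hx, hy]
  | tmul x x' =>
    rw [comulD_tmul, ← penD_map]
    exact congrArg (penD α β B x') (H.ev'_γ x)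

theorem ξD_ev' (z : Tens α α T T') :
    map H.ev' H.ev'_rightLin (AddMonoidHom.id _) (leftLin_id β) (H.ξD z) =
      tmul β β 1 (H.ev' z) := by
  have h := congrArg (map (AddMonoidHom.id B) (rightLin_id β) H.ev' H.ev'_leftLin) (H.comulD_ev' z)
  rw [map_comm_symm] at h
  exact h

/-- `z ↦ ξ(a z)`. -/
def ξDMul (a : B) : Tens α α T T' →+ Tens β β (Tens α α T T') B :=
  H.ξD.comp (DistribSMul.toAddMonoidHom _ a)

theorem ξDMul_apply (a : B) (z : Tens α α T T') : H.ξDMul a z = H.ξD (a • z) := rfl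

theorem ξDMul_right (a : B) : RightLin β β (H.ξDMul a) := fun r z => by
  rw [ξDMul_apply, ξDMul_apply, ← H.ξD_right, ← smul_comm a (op (β r)) z]

/-- `z ⊗ m ↦ ξ(a z) m`. -/
def entD (M : Type*) [AddCommGroup M] [Module B M] (a : B) :
    Tens β β (Tens α α T T') M →+ Tens β β (Tens α α T T') M :=
  (actL β β _ M).comp (map (H.ξDMul a) (H.ξDMul_right a) (AddMonoidHom.id M) (leftLin_id β))

theorem entD_tmul (M : Type*) [AddCommGroup M] [Module B M] (a : B) (m : M)
    (z : Tens α α T T') : H.entD M a (tmul β β z m) =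
      actL β β _ M (tmul β β (H.ξD (a • z)) m) := rfl

/-- With `y = a x¹`, the last factor satisfies `ev'(y³ ⊗ x²) x³ = y³ ev(x² ⊗ x³)`. The expression is
therefore `γ'(a x¹) ev(x² ⊗ x³)`, which the `ev` law reduces to `γ'(a x)`. -/
theorem entD_γ' (x : T) (a : B) : H.entD T a (H.γ' x) = H.γ' (a • x) := by
  have hr : RightLin α α (H.γ'.comp (DistribSMul.toAddMonoidHom _ a)) := fun s y => by
    simp only [AddMonoidHom.comp_apply, DistribSMul.toAddMonoidHom_apply]
    rw [← H.γ'_right, ← smul_comm a (op (α s)) y]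
  refine (H.apply_γ'_of_ev (H.entD T a) ((ract α _).comp (map
    _ hr (AddMonoidHom.id A) (leftLin_id α))) (fun t t' y => ?_) x).trans ?_
  · change actL β β _ T (tmul β β (H.ξD (tmul α α (a • y) t')) t) =
      op (H.ev (tmul β β t' t)) • H.γ' (a • y)
    rw [ξD_tmul]
    generalize H.γ' (a • y) = w
    induction w using Tens.induction with
    | zero => simp only [map_zero, zero_tmul, smul_zero]
    | add x y hx hy => simp only [map_add, tmul_add_left, hx, hy, smul_add]
    | tmul w s =>
      change tmul β β w (H.ev' (tmul α α s t') • t) =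
        tmul β β w (op (H.ev (tmul β β t' t)) • s)
      rw [H.ev'_smul]
  · change op (1 : A) • H.γ' (a • x) = _
    rw [op_one, one_smul]

theorem penD_actL (x' : T') (z : Tens β β (Tens σ β N B) T) :
    penD α σ N x' (actL β σ N T z) = actL β σ N _ (penD α β _ x' z) := by
  induction z using Tens.induction with
  | zero => simp only [map_zero]
  | add x y hx hy => simp only [map_add, hx, hy]
  | tmul w t =>
    induction w using Tens.induction with
    | zero => simp only [map_zero, zero_tmul]
    | add x y hx hy => simp only [map_add, tmul_add_left, hx, hy]
    | tmul n m => rfl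

theorem entD_comulD (z : Tens α α T T') (a : B) :
    H.entD _ a (H.comulD z) = H.comulD (a • z) := by
  induction z using Tens.induction with
  | zero => simp only [map_zero, smul_zero]
  | add x y hx hy => simp only [map_add, smul_add, hx, hy]
  | tmul x x' =>
    rw [smul_tmul, comulD_tmul, comulD_tmul, ← entD_γ']
    simp only [entD, AddMonoidHom.comp_apply]
    rw [penD_actL, penD_map]

end Left

end Herd

namespace Tens

variable {S B K : Type*} [Ring S] [Ring B] [Ring K] {β : S →+* B} {σ : S →+* K}
  {M N : Type*} [AddCommGroup M] [AddCommGroup N] [Module B M] [Module Kᵐᵒᵖ N]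

theorem actL_left {Q L : Type*} [Ring Q] [Ring L] (τ : Q →+* L) [Module L N]
    [SMulCommClass L Kᵐᵒᵖ N] : LeftLin τ τ (actL β σ N M) := fun r z => by
  simp only [actL, AddMonoidHom.comp_apply, AddEquiv.coe_toAddMonoidHom]
  rw [assoc_smul]
  exact leftLin_map (τ := τ) (τ' := τ) _ _ _ _ (leftLin_id τ) r _

theorem actL_map {K' N' : Type*} [Ring K'] {σ' : S →+* K'} [AddCommGroup N'] [Module K'ᵐᵒᵖ N']
    (g : N →+ N') (hg : RightLin σ σ' g) (hg' : RightLin β β (map g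
      hg (AddMonoidHom.id B) (leftLin_id β))) (z : Tens β β (Tens σ β N B) M) :
    actL β σ' N' M (map _ hg' (AddMonoidHom.id M) (leftLin_id β) z) =
      map g hg (AddMonoidHom.id M) (leftLin_id β) (actL β σ N M z) := by
  induction z using Tens.induction with
  | zero => simp only [map_zero]
  | add x y hx hy => simp only [map_add, hx, hy]
  | tmul w t =>
    induction w using Tens.induction with
    | zero => simp only [map_zero, zero_tmul]
    | add x y hx hy => simp only [map_add, tmul_add_left, hx, hy]
    | tmul n m => rfl

theorem actL_unitR {N : Type*} [AddCommGroup N] [Module Bᵐᵒᵖ N] (z : Tens β β N M) :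
    actL β β N M (map (unitR β N) (unitR_right β N) (AddMonoidHom.id M) (leftLin_id β) z) = z := by
  induction z using Tens.induction with
  | zero => simp only [map_zero]
  | add x y hx hy => simp only [map_add, hx, hy]
  | tmul n m =>
    change tmul β β n ((1 : B) • m) = _
    rw [one_smul]

end Tens

/-! ### Consequences of factoring `ξ` through `D ⊗_S B` -/

namespace Herd

variable {S R B A : Type*} [Ring S] [Ring R] [Ring B] [Ring A] {β : S →+* B} {α : R →+* A}
  {T T' : Type*} [AddCommGroup T] [Module Aᵐᵒᵖ T] [Module B T] [SMulCommClass B Aᵐᵒᵖ T]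
  [AddCommGroup T'] [Module Bᵐᵒᵖ T'] [Module A T'] [SMulCommClass A Bᵐᵒᵖ T'] (H : Herd α β T T')

/-- A factorisation of `ξD` through `D ⊗_S B`. -/
structure LiftD where
  ξ : Tens α α T T' →+ Tens (RingHom.id S) β H.D B
  incl_ξ : ∀ z, H.inclD B (ξ z) = H.ξD z
  ξ_ιD : ∀ c, ξ (H.ιD c) = tmul (RingHom.id S) β c 1
  right : ∀ (a : B) z, ξ (op a • z) = op a • ξ z
  left : LeftLin β (RingHom.id S) ξ

theorem ξD_ιD (c : H.D) : H.ξD (H.ιD c) = tmul β β (H.ιD c) (1 : B) := c.2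

theorem inclD_left (M : Type*) [AddCommGroup M] [Module B M] :
    LeftLin (RingHom.id S) β (H.inclD M) :=
  leftLin_map _ _ _ _ H.ιD_left

theorem inclD_smul (M : Type*) [AddCommGroup M] [Module B M] {K : Type*} [Ring K] [Module Kᵐᵒᵖ M]
    [SMulCommClass B Kᵐᵒᵖ M] (a : K) (z : Tens (RingHom.id S) β H.D M) :
    H.inclD M (op a • z) = op a • H.inclD M z :=
  rightLin_map (τ := RingHom.id K) (τ' := RingHom.id K) _ _ _ _ (rightLin_id _) a z

variable {H} in
theorem exists_liftD (hi : Function.Injective (H.inclD B))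
    (hr : ∀ z, ∃ w, H.inclD B w = H.ξD z) : Nonempty H.LiftD := by
  obtain ⟨ξ, hξ⟩ := exists_lift_of_injective hi H.ξD hr
  refine ⟨⟨ξ, hξ, fun c => hi ?_, fun a z => hi ?_, fun r z => hi ?_⟩⟩
  · rw [hξ, ξD_ιD]; rfl
  · rw [hξ, inclD_smul, hξ, ξD_op_smul]
  · rw [hξ, H.inclD_left B r, hξ, ξD_left]

namespace LiftD

variable {H} (E : H.LiftD)

theorem ξ_right : RightLin β β E.ξ := fun r z => E.right (β r) z

/-- `z ⊗ m ↦ ξ(z) m`, a retraction of `D ⊗_S M → (T ⊗_R T') ⊗_S M`. -/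
def retr (M : Type*) [AddCommGroup M] [Module B M] :
    Tens β β (Tens α α T T') M →+ Tens (RingHom.id S) β H.D M :=
  (actL β (RingHom.id S) H.D M).comp (map E.ξ E.ξ_right (AddMonoidHom.id M) (leftLin_id β))

variable (M : Type*) [AddCommGroup M] [Module B M]

theorem retr_left : LeftLin β (RingHom.id S) (E.retr M) := fun r z => by
  simp only [retr, AddMonoidHom.comp_apply]
  rw [← actL_left (RingHom.id S), leftLin_map (τ := β) (τ' := RingHom.id S) _ _ _ _ E.left]

theorem inclD_retr (z : Tens β β (Tens α α T T') M) : H.inclD M (E.retr M z) =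
    actL β β _ M (map H.ξD H.ξD_right (AddMonoidHom.id M) (leftLin_id β) z) := by
  simp only [retr, AddMonoidHom.comp_apply]
  refine (actL_map H.ιD H.ιD_right (rightLin_map _ _ _ _ (rightLin_id β)) _).symm.trans ?_
  congr 1
  exact map_comp H.ξD_right (leftLin_id β) E.incl_ξ (fun _ => rfl) z

theorem retr_inclD (z : Tens (RingHom.id S) β H.D M) : E.retr M (H.inclD M z) = z := by
  induction z using Tens.induction with
  | zero => simp only [map_zero]
  | add x y hx hy => simp only [map_add, hx, hy]
  | tmul c m =>
    change actL β _ _ M (tmul β β (E.ξ (H.ιD c)) m) = _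
    rw [E.ξ_ιD, actL_tmul, one_smul]

/-- Split by `z ⊗ m ↦ ξ(z) m`, for any left `B`-module `M`. -/
theorem inclD_injective (E : H.LiftD) (M : Type*) [AddCommGroup M] [Module B M] :
    Function.Injective (H.inclD M) :=
  Function.LeftInverse.injective (E.retr_inclD M)

theorem map_map_ιD_injective (E : H.LiftD) (M : Type*) [AddCommGroup M] [Module B M]
    {K N : Type*} [Ring K] [AddCommGroup N] [Module Kᵐᵒᵖ N] (σ : S →+* K) :
    Function.Injective (map (map (AddMonoidHom.id N) (rightLin_id σ) H.ιD H.ιD_left)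
      (rightLin_map _ _ _ _ H.ιD_right)
      (AddMonoidHom.id M)
      (leftLin_id β)) := by
  refine Function.LeftInverse.injective (g := fun z => assoc.symm
    (map (AddMonoidHom.id N) (rightLin_id σ)
    (E.retr M) (E.retr_left M) (assoc z))) fun z => ?_
  obtain ⟨w, rfl⟩ := assoc.symm.surjective z
  beta_reduce
  rw [← map_assoc_symm (H.inclD_left M), AddEquiv.apply_symm_apply]
  congr 1
  exact (map_comp (rightLin_id _) (leftLin_id _) (fun _ => rfl) (E.retr_inclD M) w).trans
    (map_id_apply w)

/-- Contracting `hw` by `actL` turns the unit side into `w` and the `ξ` side into `inclD` of the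
retraction of `w`. -/
theorem exists_map_inclD_eq (E : H.LiftD) {M : Type*} [AddCommGroup M] [Module B M]
    {K N : Type*} [Ring K] [AddCommGroup N] [Module Kᵐᵒᵖ N] {σ : S →+* K}
    (w : Tens σ β N (Tens β β (Tens α α T T') M))
    (hw : map (AddMonoidHom.id N)
        (rightLin_id σ) (map H.ξD H.ξD_right (AddMonoidHom.id M) (leftLin_id β))
        (leftLin_map _ _ _ _ H.ξD_left) w =
      map (AddMonoidHom.id N)
        (rightLin_id σ) (map (unitR β _) (unitR_right β _) (AddMonoidHom.id M) (leftLin_id β))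
        (leftLin_map _ _ _ _ (unitR_left β _ β)) w) :
    ∃ w', map (AddMonoidHom.id N) (rightLin_id σ) (H.inclD M) (H.inclD_left M) w' = w := by
  refine ⟨map (AddMonoidHom.id N) (rightLin_id σ) (E.retr M) (E.retr_left M) w, ?_⟩
  have h := congrArg (map (AddMonoidHom.id N) (rightLin_id σ)
    (actL β β (Tens α α T T') M) (actL_left β)) hw
  have hl : LeftLin β β ((H.inclD M).comp (E.retr M)) := fun r z => by
    rw [AddMonoidHom.comp_apply, E.retr_left, H.inclD_left]; rfl
  refine Eq.trans (map_comp (rightLin_id _) hl (fun _ => rfl) (fun _ => rfl) _)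
      (Eq.trans (Eq.trans ?_ h) ?_)
  · exact (map_comp (rightLin_id _) hl (fun _ => rfl) (fun z => (E.inclD_retr M z).symm) _).symm
  · exact (map_comp (rightLin_id _) (leftLin_id _) (fun _ => rfl) (fun z => actL_unitR z) _).trans
      (map_id_apply _)

end LiftD

end Herd

/-! ### Purity and the factorisation of `ξ` for `D`, in the split and the flat case -/

namespace Herd

variable {S R B A T T' : Type u} [Ring S] [Ring R] [Ring B] [Ring A] {β : S →+* B} {α : R →+* A}
  [AddCommGroup T] [Module Aᵐᵒᵖ T] [Module B T] [SMulCommClass B Aᵐᵒᵖ T]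
  [AddCommGroup T'] [Module Bᵐᵒᵖ T'] [Module A T'] [SMulCommClass A Bᵐᵒᵖ T'] (H : Herd α β T T')

/-- For every right `S`-module `N` the sequence `0 → N ⊗ D → N ⊗ Y → N ⊗ (Y ⊗ B)` is exact, where
`Y = T ⊗_R T'`. -/
structure IsPureD : Prop where
  injective (N : Type u) [AddCommGroup N] [Module Sᵐᵒᵖ N] :
    Function.Injective (map (AddMonoidHom.id N) (rightLin_id (RingHom.id S)) H.ιD H.ιD_left)
  exact (N : Type u) [AddCommGroup N] [Module Sᵐᵒᵖ N]
    (y : Tens (RingHom.id S) β N (Tens α α T T')) :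
    map (AddMonoidHom.id N) (rightLin_id (RingHom.id S)) H.ξD H.ξD_left y =
      map (AddMonoidHom.id N) (rightLin_id (RingHom.id S)) (unitR β _) (unitR_left β _ β) y →
    ∃ w, map (AddMonoidHom.id N) (rightLin_id (RingHom.id S)) H.ιD H.ιD_left w = y

section Split

variable {N : Type*} [AddCommGroup N] [Module Bᵐᵒᵖ N] {π : B →+ S}

/-- `n ⊗ a ↦ n π(a)`. -/
def splitR (hl : LeftLin β (RingHom.id S) π) (N : Type*) [AddCommGroup N] [Module Bᵐᵒᵖ N] :
    Tens β β N B →+ N :=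
  (rid β N).comp (map (AddMonoidHom.id N) (rightLin_id β) π hl)

theorem splitR_tmul (hl : LeftLin β (RingHom.id S) π) (a : B) (n : N) :
    splitR hl N (tmul β β n a) = op (β (π a)) • n := rfl

theorem splitR_unitR (hl : LeftLin β (RingHom.id S) π) (h1 : ∀ r, π (β r) = r) (n : N) :
    splitR hl N (unitR β N n) = n := by
  have e1 : π 1 = 1 := by simpa using h1 1
  rw [unitR_apply, splitR_tmul, e1, map_one, op_one, one_smul]

theorem splitR_right (hl : LeftLin β (RingHom.id S) π) (hr : RightLin β (RingHom.id S) π) :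
    RightLin β β (splitR hl N) := fun r z => by
  induction z using Tens.induction with
  | zero => simp only [map_zero, smul_zero]
  | add x y hx hy => simp only [map_add, smul_add, hx, hy]
  | tmul n a =>
    rw [op_smul_tmul, splitR_tmul, splitR_tmul, hr, smul_smul, ← op_mul, ← map_mul]
    rfl

theorem splitR_left (hl : LeftLin β (RingHom.id S) π) {L : Type*} [Ring L] (τ : S →+* L)
    [Module L N] [SMulCommClass L Bᵐᵒᵖ N] : LeftLin τ τ (splitR hl N) := fun r z => by
  induction z using Tens.induction with
  | zero => simp only [map_zero, smul_zero]
  | add x y hx hy => simp only [map_add, smul_add, hx, hy]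
  | tmul n a =>
    rw [smul_tmul, splitR_tmul, splitR_tmul, ← smul_comm]

theorem splitR_map (hl : LeftLin β (RingHom.id S) π) {N' : Type*} [AddCommGroup N'] [Module Bᵐᵒᵖ N']
    (g : N →+ N') (hg : RightLin β β g) (z : Tens β β N B) :
    splitR hl N' (map g hg (AddMonoidHom.id B) (leftLin_id β) z) = g (splitR hl N z) := by
  induction z using Tens.induction with
  | zero => simp only [map_zero]
  | add x y hx hy => simp only [map_add, hx, hy]
  | tmul n a => rw [map_tmul, splitR_tmul, splitR_tmul, hg]; rfl

/-- Naturality of `- ⊗ π` moves `ξ` inside, where the cocycle condition `ξD_ξD` replaces it by `- ⊗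
1`. -/
theorem splitR_ξD_mem (hl : LeftLin β (RingHom.id S) π) (z : Tens α α T T') :
    splitR hl _ (H.ξD z) ∈ H.D := by
  change H.ξD _ = unitR β _ _
  rw [← splitR_map hl _ H.ξD_right, ξD_ξD, splitR_map]

/-- `z ↦ (id ⊗ π)(ξ z)`, a retraction of `D → T ⊗_R T'`. -/
def projD (hl : LeftLin β (RingHom.id S) π) : Tens α α T T' →+ H.D :=
  ((splitR hl _).comp H.ξD).codRestrict H.D (H.splitR_ξD_mem hl)

theorem projD_ιD (hl : LeftLin β (RingHom.id S) π) (h1 : ∀ r, π (β r) = r) (c : H.D) :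
    H.projD hl (H.ιD c) = c :=
  Subtype.ext <| by
    change splitR hl _ (H.ξD (H.ιD c)) = H.ιD c
    rw [ξD_ιD, ← unitR_apply, splitR_unitR hl h1]

theorem projD_right (hl : LeftLin β (RingHom.id S) π) (hr : RightLin β (RingHom.id S) π) :
    RightLin β (RingHom.id S) (H.projD hl) := fun r z =>
  Subtype.ext <| by
    change splitR hl _ (H.ξD (op (β r) • z)) = op (β r) • splitR hl _ (H.ξD z)
    rw [ξD_right, splitR_right hl hr]

theorem projD_left (hl : LeftLin β (RingHom.id S) π) :
    LeftLin β (RingHom.id S) (H.projD hl) := fun r z =>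
  Subtype.ext <| by
    change splitR hl _ (H.ξD ((β r) • z)) = (β r) • splitR hl _ (H.ξD z)
    rw [ξD_left, splitR_left hl β]

theorem liftD_of_split (h : SplitExtension β) : Nonempty H.LiftD := by
  obtain ⟨π, hl, hr, h1⟩ := h
  have hr : RightLin β (RingHom.id S) π := fun r a => hr a r
  have hl : LeftLin β (RingHom.id S) π := hl
  refine exists_liftD (Function.LeftInverse.injective (g := map (H.projD hl) (H.projD_right hl hr)
    (AddMonoidHom.id B) (leftLin_id β)) fun z => ?_) fun z => ⟨map (H.projD hl)
      (H.projD_right hl hr) (AddMonoidHom.id B) (leftLin_id β) (H.ξD z), ?_⟩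
  · exact (map_comp (rightLin_id _) (leftLin_id _) (H.projD_ιD hl h1) (fun _ => rfl) z).trans
      (map_id_apply z)
  · have h := congrArg (map (splitR hl (Tens α α T T')) (splitR_right hl hr) (AddMonoidHom.id B)
      (leftLin_id β)) (H.ξD_ξD z)
    have hp : RightLin β β ((splitR hl _).comp H.ξD) := fun r z => by
      rw [AddMonoidHom.comp_apply, AddMonoidHom.comp_apply, ξD_right, splitR_right hl hr]
    refine Eq.trans (map_comp hp (leftLin_id _) (fun _ => rfl) (fun _ => rfl) _)
      (Eq.trans (Eq.trans ?_ h) ?_)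
    · exact (map_comp hp (leftLin_id _) (fun _ => rfl) (fun _ => rfl) _).symm
    · exact (map_comp (rightLin_id _) (leftLin_id _) (splitR_unitR hl h1) (fun _ => rfl) _).trans
        (map_id_apply _)

theorem isPureD_of_split (h : SplitExtension β) : H.IsPureD := by
  obtain ⟨π, hl, hr, h1⟩ := h
  have hr : RightLin β (RingHom.id S) π := fun r a => hr a r
  have hl : LeftLin β (RingHom.id S) π := hl
  refine ⟨fun N _ _ => Function.LeftInverse.injective (g := map (AddMonoidHom.id N) (rightLin_id _)
    (H.projD hl) (H.projD_left hl)) fun z => ?_, fun N _ _ y hy => ⟨map (AddMonoidHom.id N)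
      (rightLin_id _) (H.projD hl) (H.projD_left hl) y, ?_⟩⟩
  · exact (map_comp (rightLin_id _) (leftLin_id _) (fun _ => rfl) (H.projD_ιD hl h1) z).trans
      (map_id_apply z)
  · have h := congrArg (map (AddMonoidHom.id N) (rightLin_id _)
      (splitR hl (Tens α α T T')) (splitR_left hl β)) hy
    have hp : LeftLin β β ((splitR hl _).comp H.ξD) := fun r z => by
      rw [AddMonoidHom.comp_apply, AddMonoidHom.comp_apply, ξD_left, splitR_left hl β]
    refine Eq.trans (map_comp (rightLin_id _) hp (fun _ => rfl) (fun _ => rfl) _)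
      (Eq.trans (Eq.trans ?_ h) ?_)
    · exact (map_comp (rightLin_id _) hp (fun _ => rfl) (fun _ => rfl) _).symm
    · exact (map_comp (rightLin_id _) (leftLin_id _) (fun _ => rfl) (splitR_unitR hl h1) _).trans
        (map_id_apply _)

end Split

section FaithfullyFlat

/-- `ξ - (- ⊗ 1)`, whose kernel is `D`. -/
def diffD : Tens α α T T' →+ Tens β β (Tens α α T T') B := H.ξD - unitR β _

theorem diffD_right : RightLin β β H.diffD := fun r z => by
  simp only [diffD, AddMonoidHom.sub_apply]
  rw [ξD_right, unitR_right, smul_sub]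

theorem exact_ιD_diffD : Function.Exact H.ιD H.diffD := fun z => by
  rw [diffD, AddMonoidHom.sub_apply, sub_eq_zero]
  exact ⟨fun hz => ⟨⟨z, hz⟩, rfl⟩, by rintro ⟨c, rfl⟩; exact c.2⟩

variable {H}

theorem inclD_injective_of_leftFaithfullyFlat (h : LeftFaithfullyFlat β T) :
    Function.Injective (H.inclD T) :=
  (h.injective_iff H.ιD H.ιD_right).1 Subtype.val_injective

theorem exists_inclD_eq_γ' (h : LeftFaithfullyFlat β T) (x : T) : ∃ w, H.inclD T w = H.γ' x := by
  refine ((h.exact_iff H.ιD H.diffD H.ιD_right H.diffD_right).1 H.exact_ιD_diffD (H.γ' x)).1 ?_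
  exact (map_sub_left _ _ H.ξD_right (unitR_right β _) H.diffD_right _ _ _).trans
    (sub_eq_zero.2 (H.γ'_ξD x))

/-- Acting on `x` moves `k` to `D ⊗_S T`, where it must vanish by flatness of `T`; applying `ev'(- ⊗
x')` then yields `k ev'(x ⊗ x') = 0`. -/
theorem ev'_smul_eq_zero (h : LeftFaithfullyFlat β T) {k : Tens (RingHom.id S) β H.D B}
    (hk : H.inclD B k = 0) (z : Tens α α T T') : op (H.ev' z) • k = 0 := by
  induction z using Tens.induction with
  | zero => rw [map_zero, op_zero, zero_smul]
  | add x y hx hy => rw [map_add, op_add, add_smul, hx, hy, add_zero]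
  | tmul x x' =>
    have hx : LeftLin β β (AddMonoidHom.mk' (fun a : B => a • x) fun b c => by
          rw [add_smul]) := fun r b => by simp [mul_smul]
    have h0 : map (AddMonoidHom.id H.D) (rightLin_id _) _ hx k = 0 := by
      refine inclD_injective_of_leftFaithfullyFlat (H := H) h ((map_comm_symm ..).symm.trans ?_)
      exact (congrArg (map (AddMonoidHom.id (Tens α α T T')) (rightLin_id β) _ hx) hk).trans
        (by rw [map_zero, map_zero])
    refine Eq.trans ?_ ((congrArg (H.evD (RingHom.id S) H.D x') h0).trans (map_zero _))
    clear hk h0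
    induction k using Tens.induction with
    | zero => simp only [map_zero, smul_zero]
    | add x y hx hy => simp only [map_add, smul_add, hx, hy]
    | tmul c a =>
      change tmul _ β c (a * H.ev' (tmul α α x x')) = tmul _ β c (H.ev' (a • tmul α α x x'))
      rw [H.ev'_left]

/-- The `ev'` law writes `k ⊗ t` as `k ev'(t¹ ⊗ t²) ⊗ t³`. -/
theorem tmul_eq_zero_of_inclD (h : LeftFaithfullyFlat β T) {k : Tens (RingHom.id S) β H.D B}
    (hk : H.inclD B k = 0) (t : T) : tmul β β k t = 0 := by
  have hG : RightLin β β (AddMonoidHom.mk' (fun a : B => op a • k) fun b c => by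
      rw [op_add, add_smul]) :=
    fun r b => by simp [mul_smul]
  have h1 := H.apply_γ'_of_ev' 0 (map _ hG (AddMonoidHom.id T) (leftLin_id β)) (fun t z => by
    change _ = tmul β β (op (H.ev' z) • k) t
    rw [ev'_smul_eq_zero h hk, zero_tmul, AddMonoidHom.zero_apply]) t
  have h2 : tmul β β (op (1 : B) • k) t = 0 := h1.symm
  rwa [op_one, one_smul] at h2

/-- As for `C`: `- ⊗ T` kills the inclusion of the kernel of `inclD`, so exactness makes `inclD`
injective after `- ⊗ T`, and this is reflected. -/
theorem inclD_injective_of_flat (h : LeftFaithfullyFlat β T) :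
    Function.Injective (H.inclD B) := by
  let K : Submodule Bᵐᵒᵖ (Tens (RingHom.id S) β H.D B) :=
    { carrier := {k | H.inclD B k = 0}
      zero_mem' := map_zero _
      add_mem' := fun {x y} hx hy => by
        change H.inclD B (x + y) = 0
        rw [map_add, show H.inclD B x = 0 from hx, show H.inclD B y = 0 from hy, add_zero]
      smul_mem' := fun a x hx => by
        change H.inclD B (op a.unop • x) = 0
        rw [inclD_smul, show H.inclD B x = 0 from hx, smul_zero] }
  have hj : RightLin β β K.subtype.toAddMonoidHom := fun _ _ => rfl
  have hi : RightLin β β (H.inclD B) := fun r z => H.inclD_smul B (β r) z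
  have hex : Function.Exact K.subtype.toAddMonoidHom (H.inclD B) := fun k =>
    ⟨fun hk => ⟨⟨k, hk⟩, rfl⟩, by rintro ⟨k, rfl⟩; exact k.2⟩
  rw [h.exact_iff _ _ hj hi, show map _ hj (AddMonoidHom.id T) (leftLin_id β) = 0 from
    hom_ext fun k t => tmul_eq_zero_of_inclD h k.2 t, exact_zero_iff, ← h.injective_iff] at hex
  exact hex

theorem liftD_of_flat (h : LeftFaithfullyFlat β T) : Nonempty H.LiftD := by
  refine exists_liftD (inclD_injective_of_flat h) fun z => ?_
  induction z using Tens.induction with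
  | zero => exact ⟨0, by rw [map_zero, map_zero]⟩
  | add x y hx hy =>
    obtain ⟨v, hv⟩ := hx
    obtain ⟨w, hw⟩ := hy
    exact ⟨v + w, by rw [map_add, map_add, hv, hw]⟩
  | tmul x x' =>
    obtain ⟨w, hw⟩ := exists_inclD_eq_γ' (H := H) h x
    exact ⟨H.evD (RingHom.id S) H.D x' w, by
      rw [ξD_tmul, ← hw]
      exact (H.evD_map H.ιD H.ιD_right x' w).symm⟩

/-- After `- ⊗ T` the sequence is `N` tensored with a sequence split by `retr`, and faithful
flatness reflects exactness. -/
theorem isPureD_of_flat (h : LeftFaithfullyFlat β T) : H.IsPureD := by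
  obtain ⟨E⟩ := liftD_of_flat (H := H) h
  have hι (N : Type u) [AddCommGroup N] [Module Sᵐᵒᵖ N] : RightLin (RingHom.id S) β
      (map (AddMonoidHom.id N) (rightLin_id (RingHom.id S)) H.ιD H.ιD_left) :=
    rightLin_map _ _ _ _ H.ιD_right
  have hξ (N : Type u) [AddCommGroup N] [Module Sᵐᵒᵖ N] : RightLin β β
      (map (AddMonoidHom.id N) (rightLin_id (RingHom.id S)) H.ξD H.ξD_left) :=
    rightLin_map _ _ _ _ H.ξD_right
  have hu (N : Type u) [AddCommGroup N] [Module Sᵐᵒᵖ N] : RightLin β β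
      (map (AddMonoidHom.id N) (rightLin_id (RingHom.id S)) (unitR β (Tens α α T T'))
        (unitR_left β _ β)) :=
    rightLin_map _ _ _ _ (unitR_right β _)
  have hd (N : Type u) [AddCommGroup N] [Module Sᵐᵒᵖ N] : RightLin β β
      (map (AddMonoidHom.id N) (rightLin_id (RingHom.id S)) H.ξD H.ξD_left -
        map (AddMonoidHom.id N) (rightLin_id (RingHom.id S)) (unitR β (Tens α α T T'))
          (unitR_left β _ β)) := fun r z => by
    rw [AddMonoidHom.sub_apply, AddMonoidHom.sub_apply, hξ, hu, smul_sub]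
  refine ⟨fun N _ _ => (h.injective_iff _ (hι N)).2 (E.map_map_ιD_injective T _),
    fun N _ _ y hy => ?_⟩
  have hex := (h.exact_iff (map (AddMonoidHom.id N) (rightLin_id (RingHom.id S)) H.ιD H.ιD_left)
    (map (AddMonoidHom.id N) (rightLin_id (RingHom.id S)) H.ξD H.ξD_left -
        map (AddMonoidHom.id N) (rightLin_id (RingHom.id S)) (unitR β (Tens α α T T'))
          (unitR_left β _ β)) (hι N) (hd N)).2 fun v => ⟨fun hv => ?_, ?_⟩
  · refine (hex y).1 ?_
    rw [AddMonoidHom.sub_apply, hy, sub_self]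
  · rw [map_sub_left _ _ (hξ N) (hu N), sub_eq_zero] at hv
    obtain ⟨w, rfl⟩ := assoc.symm.surjective v
    rw [← map_assoc_symm (leftLin_map _ H.ξD_right _ _ H.ξD_left),
      ← map_assoc_symm (leftLin_map _ (unitR_right β _) _ _ (unitR_left β _ β))] at hv
    obtain ⟨w', rfl⟩ := E.exists_map_inclD_eq w (assoc.symm.injective hv)
    exact ⟨assoc.symm w', (map_assoc_symm (H.inclD_left T) (hι N) w').symm⟩
  · rintro ⟨w, rfl⟩
    induction w using Tens.induction with
    | zero => simp only [map_zero]
    | add x y hx hy => simp only [map_add, hx, hy, add_zero]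
    | tmul w t =>
      rw [map_tmul, map_tmul]
      refine (congrArg (fun v => tmul β β v t) ?_).trans (zero_tmul ..)
      induction w using Tens.induction with
      | zero => simp only [map_zero]
      | add x y hx hy => simp only [map_add, hx, hy, add_zero]
      | tmul n c =>
        rw [AddMonoidHom.sub_apply, sub_eq_zero, map_tmul, map_tmul, map_tmul, ξD_ιD]
        rfl

end FaithfullyFlat

end Herd

namespace Tens

variable {S B K : Type*} [Ring S] [Ring B] [Ring K] {β : S →+* B} {σ : S →+* K}
  {N : Type*} [AddCommGroup N]

theorem actL_self [Module Kᵐᵒᵖ N] (a : B) (v : Tens σ β N B) :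
    actL β σ N B (tmul β β v a) = op a • v := by
  induction v using Tens.induction with
  | zero => simp only [zero_tmul, map_zero, smul_zero]
  | add x y hx hy => simp only [tmul_add_left, map_add, smul_add, hx, hy]
  | tmul n m => rfl

theorem assoc_unitR [Module Bᵐᵒᵖ N] {L Q : Type*} [Ring L] [AddCommGroup Q] [Module Lᵐᵒᵖ Q]
    {Q' L' : Type*} [Ring Q'] [Ring L'] {τ : Q' →+* L'} {τ' : Q' →+* L}
    [Module L' N] [SMulCommClass L' Bᵐᵒᵖ N] (h : LeftLin τ τ (unitR β N))
    (z : Tens τ' τ Q N) :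
    assoc.symm (map (AddMonoidHom.id Q) (rightLin_id τ') (unitR β N) h z) = tmul β β z 1 := by
  induction z using Tens.induction with
  | zero => simp only [zero_tmul, map_zero]
  | add x y hx hy => simp only [tmul_add_left, map_add, hx, hy]
  | tmul n m => rfl

end Tens

/-! ### The coring `D`, its entwining with `B`, and the entwined module `T` -/

namespace Herd

variable {S R B A T T' : Type u} [Ring S] [Ring R] [Ring B] [Ring A] {β : S →+* B} {α : R →+* A}
  [AddCommGroup T] [Module Aᵐᵒᵖ T] [Module B T] [SMulCommClass B Aᵐᵒᵖ T]
  [AddCommGroup T'] [Module Bᵐᵒᵖ T'] [Module A T'] [SMulCommClass A Bᵐᵒᵖ T'] {H : Herd α β T T'}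

theorem comulD_ξD (H : Herd α β T T') (z : Tens α α T T') :
    map H.ξD H.ξD_right (AddMonoidHom.id _) (leftLin_id β) (H.comulD z) =
      map (unitR β _) (unitR_right β _) (AddMonoidHom.id _) (leftLin_id β) (H.comulD z) := by
  induction z using Tens.induction with
  | zero => simp only [map_zero]
  | add x y hx hy => simp only [map_add, hx, hy]
  | tmul x x' => rw [comulD_tmul, ← penD_map, ← penD_map, γ'_ξD]

theorem inclDD_right (H : Herd α β T T') : RightLin (RingHom.id S) β H.inclDD :=
  rightLin_map _ _ _ _ H.ιD_right

theorem inclDD_left (H : Herd α β T T') : LeftLin (RingHom.id S) β H.inclDD :=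
  leftLin_map _ _ _ _ H.ιD_left

theorem inclDD_injective (E : H.LiftD) (hp : H.IsPureD) : Function.Injective H.inclDD := by
  have h := (E.inclD_injective (Tens α α T T')).comp (hp.injective H.D)
  convert h using 1
  funext z
  symm
  exact map_comp H.ιD_right H.ιD_left (fun _ => rfl) (fun _ => rfl) z

theorem map_inclDD_injective (E : H.LiftD) (M : Type*) [AddCommGroup M] [Module B M] :
    Function.Injective (map H.inclDD H.inclDD_right (AddMonoidHom.id M) (leftLin_id β)) := by
  have hX : RightLin β β (H.inclD (Tens α α T T')) := fun r z => H.inclD_smul _ (β r) z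
  have h2 : Function.Injective (map (H.inclD (Tens α α T T')) hX
      (AddMonoidHom.id M) (leftLin_id β)) := by
    have h3 := assoc.symm.injective.comp ((E.inclD_injective
      (Tens β β (Tens α α T T') M)).comp (assoc (ρ' := β) (σ' := β)).injective)
    convert h3 using 1
    funext z
    obtain ⟨w, rfl⟩ := assoc.symm.surjective z
    simp only [Function.comp_apply, AddEquiv.apply_symm_apply]
    induction w using Tens.induction with
    | zero => simp only [map_zero]
    | add x y hx hy => simp only [map_add, hx, hy]
    | tmul c w =>
      induction w using Tens.induction with
      | zero => simp only [tmul_zero, map_zero]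
      | add x y hx hy => simp only [map_add, tmul_add_right, hx, hy]
      | tmul z m => rfl
  have h := h2.comp (E.map_map_ιD_injective M (N := H.D) (RingHom.id S))
  convert h using 1
  funext z
  symm
  exact map_comp H.inclDD_right (leftLin_id _)
    (fun z => map_comp H.ιD_right H.ιD_left (fun _ => rfl) (fun _ => rfl) z) (fun _ => rfl) z

theorem map_ιD_inclDD_injective (E : H.LiftD) (hp : H.IsPureD) :
    Function.Injective (map H.inclDD H.inclDD_right H.ιD H.ιD_left) := by
  have h := (map_inclDD_injective E (Tens α α T T')).comp
    (hp.injective (Tens (RingHom.id S) (RingHom.id S) H.D H.D))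
  convert h using 1
  funext z
  symm
  exact map_comp H.inclDD_right H.ιD_left (fun _ => rfl) (fun _ => rfl) z

theorem LiftD.inclD_retr_comulD (E : H.LiftD) (z : Tens α α T T') :
    H.inclD _ (E.retr _ (H.comulD z)) = H.comulD z := by
  rw [E.inclD_retr, comulD_ξD, actL_unitR]

theorem LiftD.inclD_retr_γ' (E : H.LiftD) (x : T) :
    H.inclD _ (E.retr _ (H.γ' x)) = H.γ' x := by
  rw [E.inclD_retr, γ'_ξD, actL_unitR]

/-- `γ'_ξD` restricts the first leg to `D`. Purity with `N = D` restricts the second, its hypothesis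
being `ξD_comulD` together with `ξ(d) = d ⊗ 1`. -/
theorem exists_inclDD_eq_comulD (E : H.LiftD) (hp : H.IsPureD) (c : H.D) :
    ∃ w, H.inclDD w = H.comulD (H.ιD c) := by
  obtain ⟨w, hw⟩ := hp.exact H.D (E.retr _ (H.comulD (H.ιD c))) (by
    refine E.inclD_injective _ ?_
    refine (map_comm_symm ..).symm.trans (Eq.trans ?_ (map_comm_symm ..))
    refine (congrArg (map _ _ H.ξD _) (E.inclD_retr_comulD _)).trans (Eq.trans ?_
      (congrArg (map _ _ (unitR β _) (unitR_left β _ β)) (E.inclD_retr_comulD _)).symm)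
    apply assoc.symm.injective
    rw [assoc_unitR, ← ξD_comulD, ξD_ιD]
    rfl)
  refine ⟨w, ?_⟩
  rw [← E.inclD_retr_comulD, ← hw]
  exact (map_comp H.ιD_right H.ιD_left (fun _ => rfl) (fun _ => rfl) w).symm

theorem exists_counitD (H : Herd α β T T') (hm : IsEffectiveMono β) :
    ∃ ε : H.D →+ S, ∀ c, β (ε c) = H.ev' (H.ιD c) := by
  refine exists_lift_of_injective (i := β.toAddMonoidHom) hm.1 (H.ev'.comp H.ιD) fun c => hm.2 _ ?_
  have h := H.ξD_ev' (H.ιD c)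
  rw [ξD_ιD] at h
  exact h

theorem ιD_rid_counit {ε : H.D →+ S} (hε : ∀ c, β (ε c) = H.ev' (H.ιD c))
    (hl : LeftLin (RingHom.id S) (RingHom.id S) ε)
    (w : Tens (RingHom.id S) (RingHom.id S) H.D H.D) :
    H.ιD (rid (RingHom.id S) H.D (map (AddMonoidHom.id H.D) (rightLin_id _) ε hl w)) =
      ract β _ (map (AddMonoidHom.id _) (rightLin_id β) H.ev' H.ev'_leftLin (H.inclDD w)) := by
  induction w using Tens.induction with
  | zero => simp only [map_zero]
  | add x y hx hy => simp only [map_add, hx, hy]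
  | tmul d c =>
    change op (β (ε c)) • H.ιD d = op (H.ev' (H.ιD c)) • H.ιD d
    rw [hε]

theorem ιD_lid_counit {ε : H.D →+ S} (hε : ∀ c, β (ε c) = H.ev' (H.ιD c))
    (hr : RightLin (RingHom.id S) (RingHom.id S) ε)
    (w : Tens (RingHom.id S) (RingHom.id S) H.D H.D) :
    H.ιD (lid (RingHom.id S) H.D (map ε hr (AddMonoidHom.id H.D) (leftLin_id _) w)) =
      lact β _ (map H.ev' H.ev'_rightLin (AddMonoidHom.id _) (leftLin_id β) (H.inclDD w)) := by
  induction w using Tens.induction with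
  | zero => simp only [map_zero]
  | add x y hx hy => simp only [map_add, hx, hy]
  | tmul d c =>
    change β (ε d) • H.ιD c = H.ev' (H.ιD d) • H.ιD c
    rw [hε]

theorem lid_counit {ε : H.D →+ S} (hε : ∀ c, β (ε c) = H.ev' (H.ιD c))
    (hr : RightLin (RingHom.id S) (RingHom.id S) ε) (M : Type*) [AddCommGroup M]
    [Module B M] (w : Tens (RingHom.id S) β H.D M) :
    lid β M (map ε hr (AddMonoidHom.id M) (leftLin_id _) w) =
      lact β _ (map H.ev' H.ev'_rightLin (AddMonoidHom.id _) (leftLin_id β) (H.inclD M w)) := by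
  induction w using Tens.induction with
  | zero => simp only [map_zero]
  | add x y hx hy => simp only [map_add, hx, hy]
  | tmul d c =>
    change β (ε d) • c = H.ev' (H.ιD d) • c
    rw [hε]

theorem lact_unit {M : Type*} [AddCommGroup M] [Module B M] (m : M) :
    lact β M (tmul β β 1 m) = m := by
  change (1 : B) • m = m
  rw [one_smul]

/-- The coring structure on `D`. -/
def coringD (E : H.LiftD) (hp : H.IsPureD) (hm : IsEffectiveMono β)
    {Δ : H.D →+ Tens (RingHom.id S) (RingHom.id S) H.D H.D}
    (hΔ : ∀ c, H.inclDD (Δ c) = H.comulD (H.ιD c)) {ε : H.D →+ S}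
    (hε : ∀ c, β (ε c) = H.ev' (H.ιD c)) : Coring S H.D where
  comul := Δ
  comul_right r c := inclDD_injective E hp <| by
    rw [H.inclDD_right, hΔ, hΔ, H.ιD_right, H.comulD_right]
  comul_left r c := inclDD_injective E hp <| by
    rw [H.inclDD_left, hΔ, hΔ, H.ιD_left, H.comulD_left]
  counit := ε
  counit_right r c := hm.1 <| by
    rw [hε, H.ιD_right, H.ev'_rightLin, op_smul_eq_mul, op_smul_eq_mul, map_mul, hε]; rfl
  counit_left r c := hm.1 <| by
    rw [hε, H.ιD_left, H.ev'_leftLin, smul_eq_mul, smul_eq_mul, map_mul, hε]; rfl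
  coassoc c := by
    -- The coring axiom is bracketed to the right. Applying `assoc.symm` and swapping sides gives
    -- the form that mirrors the computation for `C`.
    apply assoc.symm.injective
    rw [AddEquiv.symm_apply_apply]
    symm
    apply map_ιD_inclDD_injective E hp
    have hr : RightLin (RingHom.id S) β (H.comulD.comp H.ιD) := fun r c => by
      rw [AddMonoidHom.comp_apply, AddMonoidHom.comp_apply, H.ιD_right, H.comulD_right]
    have hl : LeftLin (RingHom.id S) β (H.comulD.comp H.ιD) := fun r c => by
      rw [AddMonoidHom.comp_apply, AddMonoidHom.comp_apply, H.ιD_left, H.comulD_left]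
    refine (map_assoc_symm H.inclDD_left H.inclDD_right _).symm.trans (Eq.trans ?_
      (map_comp (f'' := H.comulD.comp H.ιD) (g'' := H.ιD) hr H.ιD_left hΔ (fun _ => rfl) _).symm)
    refine Eq.trans ?_ (map_comp (f := H.ιD) (g := H.ιD) (g' := AddMonoidHom.id _) hr H.ιD_left
      (hf := H.ιD_right) (hg := H.ιD_left) (hg' := leftLin_id β) (hf' := H.comulD_right)
      (fun _ => rfl) (fun _ => rfl) _)
    refine Eq.trans ?_ (congrArg _ (hΔ c)).symm
    rw [comulD_coassoc, ← hΔ]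
    congr 1
    exact (map_comp (g'' := H.comulD.comp H.ιD) H.ιD_right hl (fun _ => rfl) hΔ _).trans
      (map_comp H.ιD_right hl (fun _ => rfl) (fun _ => rfl) _).symm
  counit_comul c := Subtype.val_injective <| by
    refine (ιD_lid_counit hε _ _).trans ?_
    rw [hΔ, comulD_ev', lact_unit]; rfl
  comul_counit c := Subtype.val_injective <| by
    refine (ιD_rid_counit hε _ _).trans ?_
    rw [hΔ]
    -- Here it is the right counit law that is the section property of `ξ`, since `ξ` applies `ev'`
    -- to the second leg of `comulD`.
    exact H.ract_ξD _

/-- The entwining map `a ⊗ c ↦ ξ(a c)`. -/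
def LiftD.φ (E : H.LiftD) : Tens β (RingHom.id S) B H.D →+ Tens (RingHom.id S) β H.D B :=
  lift (fun a c => E.ξ (a • H.ιD c)) (fun a a' c => by rw [add_smul, map_add])
    (fun a c c' => by rw [map_add, smul_add, map_add])
    (fun r a c => by rw [H.ιD_left, smul_smul]; rfl)

namespace LiftD

variable (E : H.LiftD)

theorem φ_tmul (a : B) (c : H.D) : E.φ (tmul _ _ a c) = E.ξ (a • H.ιD c) := rfl

theorem inclD_φ (a : B) (c : H.D) : H.inclD B (E.φ (tmul _ _ a c)) = H.ξD (a • H.ιD c) :=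
  E.incl_ξ _

theorem φ_right : RightLin (RingHom.id S) β E.φ := fun r z => by
  induction z using Tens.induction with
  | zero => simp only [map_zero, smul_zero]
  | add x y hx hy => simp only [map_add, smul_add, hx, hy]
  | tmul a c =>
    rw [op_smul_tmul, φ_tmul, φ_tmul, H.ιD_right, smul_comm a (op (β r)) (H.ιD c), E.right]

theorem φ_left : LeftLin β (RingHom.id S) E.φ := fun r z => by
  induction z using Tens.induction with
  | zero => simp only [map_zero, smul_zero]
  | add x y hx hy => simp only [map_add, smul_add, hx, hy]
  | tmul a c =>
    rw [smul_tmul, φ_tmul, φ_tmul, smul_eq_mul, mul_smul, E.left]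

theorem inclD_actL (M : Type*) [AddCommGroup M] [Module B M] (m : M)
    (v : Tens (RingHom.id S) β H.D B) :
    H.inclD M (actL β (RingHom.id S) H.D M (tmul β β v m)) =
      actL β β _ M (tmul β β (H.inclD B v) m) := by
  induction v using Tens.induction with
  | zero => simp only [map_zero, zero_tmul]
  | add x y hx hy => simp only [map_add, tmul_add_left, hx, hy]
  | tmul c a => rfl

/-- Under the identification of `D ⊗_S B` with `Y` by the action, the entwined left action is left
multiplication on `Y`, because `ξ` is right `B`-linear. -/
theorem leftEntwinedAct_self (w : Tens (RingHom.id S) β H.D B) (b : B) :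
    leftEntwinedAct β E.φ E.φ_right B (tmul _ _ b w) =
      E.ξ (b • ract β _ (H.inclD B w)) := by
  induction w using Tens.induction with
  | zero => simp only [map_zero, tmul_zero, smul_zero]
  | add x y hx hy => simp only [map_add, tmul_add_right, smul_add, hx, hy]
  | tmul c a =>
    change actL β (RingHom.id S) H.D B (tmul β β (E.ξ (b • H.ιD c)) a) =
      E.ξ (b • op a • H.ιD c)
    rw [actL_self, smul_comm b (op a) (H.ιD c), E.right]

theorem inclD_leftEntwinedAct (M : Type*) [AddCommGroup M] [Module B M]
    (w : Tens (RingHom.id S) β H.D M) (a : B) :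
    H.inclD M (leftEntwinedAct β E.φ E.φ_right M (tmul _ _ a w)) =
      H.entD M a (H.inclD M w) := by
  induction w using Tens.induction with
  | zero => simp only [map_zero, tmul_zero]
  | add x y hx hy => simp only [map_add, tmul_add_right, hx, hy]
  | tmul c m =>
    change H.inclD M (actL β (RingHom.id S) H.D M (tmul β β (E.ξ (a • H.ιD c)) m)) =
      H.entD M a (tmul β β (H.ιD c) m)
    rw [inclD_actL, E.incl_ξ, entD_tmul]

theorem map_inclDD_assoc (v : Tens (RingHom.id S) β H.D B) (c : H.D) :
    map H.inclDD H.inclDD_right (AddMonoidHom.id B) (leftLin_id β)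
        (assoc.symm (tmul (RingHom.id S) (RingHom.id S) c v)) =
      assoc.symm (tmul β β (H.ιD c) (H.inclD B v)) := by
  induction v using Tens.induction with
  | zero => simp only [map_zero, tmul_zero]
  | add x y hx hy => simp only [map_add, tmul_add_right, hx, hy]
  | tmul c a => rfl

theorem map_inclDD_φ_assoc (c : H.D) (v : Tens (RingHom.id S) β H.D B) :
    map H.inclDD H.inclDD_right (AddMonoidHom.id B) (leftLin_id β)
        (assoc.symm (map (AddMonoidHom.id H.D) (rightLin_id (RingHom.id S)) E.φ E.φ_left
          (assoc (tmul β (RingHom.id S) v c)))) =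
      assoc.symm (map (AddMonoidHom.id _) (rightLin_id β) H.ξD H.ξD_left
        (actL β β _ _ (tmul β β (H.inclD B v) (H.ιD c)))) := by
  induction v using Tens.induction with
  | zero => simp only [map_zero, zero_tmul]
  | add x y hx hy => simp only [map_add, tmul_add_left, hx, hy]
  | tmul d a =>
    refine (map_inclDD_assoc (E.ξ (a • H.ιD c)) d).trans ?_
    rw [E.incl_ξ]
    rfl

/-- Passing `a` through `d ⊗ c` from the left: the first `φ` gives `ξ(a d) c`, which is `entD`, and
the second is `ξ` on the last factor. -/
theorem map_inclDD_φ_φ (w : Tens (RingHom.id S) (RingHom.id S) H.D H.D) (a : B) :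
    map H.inclDD H.inclDD_right (AddMonoidHom.id B) (leftLin_id β)
        (assoc.symm (map (AddMonoidHom.id H.D) (rightLin_id (RingHom.id S)) E.φ E.φ_left
          (assoc (map E.φ E.φ_right (AddMonoidHom.id H.D) (leftLin_id _)
            (assoc.symm (tmul β (RingHom.id S) a w)))))) =
      assoc.symm (map (AddMonoidHom.id _) (rightLin_id β) H.ξD H.ξD_left
        (H.entD _ a (H.inclDD w))) := by
  induction w using Tens.induction with
  | zero => simp only [map_zero, tmul_zero]
  | add x y hx hy => simp only [map_add, tmul_add_right, hx, hy]
  | tmul d c =>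
    refine (E.map_inclDD_φ_assoc c (E.ξ (a • H.ιD d))).trans ?_
    rw [E.incl_ξ]
    rfl

end LiftD

/-- The entwining of `D` with `B`. -/
def entwiningD (E : H.LiftD) (hp : H.IsPureD) (hm : IsEffectiveMono β)
    {Δ : H.D →+ Tens (RingHom.id S) (RingHom.id S) H.D H.D}
    (hΔ : ∀ c, H.inclDD (Δ c) = H.comulD (H.ιD c)) {ε : H.D →+ S}
    (hε : ∀ c, β (ε c) = H.ev' (H.ιD c)) : LeftEntwining β (coringD E hp hm hΔ hε) where
  φ := E.φ
  right_lin := E.φ_right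
  left_lin := E.φ_left
  φ_mul a b c := by
    rw [E.leftEntwinedAct_self, E.inclD_φ, ract_ξD, smul_smul, E.φ_tmul]
  φ_one c := by rw [E.φ_tmul, one_smul, E.ξ_ιD]
  φ_comul z := by
    apply assoc.symm.injective
    rw [AddEquiv.symm_apply_apply]
    apply map_inclDD_injective E B
    induction z using Tens.induction with
    | zero => simp only [map_zero]
    | add x y hx hy => simp only [map_add, hx, hy]
    | tmul a c =>
      have hr : RightLin (RingHom.id S) β (H.comulD.comp H.ιD) := fun r c => by
        rw [AddMonoidHom.comp_apply, AddMonoidHom.comp_apply, H.ιD_right, H.comulD_right]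
      refine Eq.trans ?_ (E.map_inclDD_φ_φ (Δ c) a).symm
      -- Both sides are determined by `a c`, and `ξD_comulD` identifies them.
      rw [hΔ, entD_comulD, ← ξD_comulD, ← E.inclD_φ]
      exact (map_comp hr (leftLin_id _) hΔ (fun _ => rfl) _).trans
        (map_comp hr (leftLin_id _) (fun _ => rfl) (fun _ => rfl) _).symm
  φ_counit z := by
    refine (lid_counit hε _ B _).trans ?_
    induction z using Tens.induction with
    | zero => simp only [map_zero]
    | add x y hx hy => simp only [map_add, hx, hy]
    | tmul a c =>
      rw [E.inclD_φ, ξD_ev', lact_unit]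
      change H.ev' (a • H.ιD c) = a * β (ε c)
      rw [H.ev'_left, hε]

/-- The entwined module `T`. -/
def moduleD (E : H.LiftD) (hp : H.IsPureD) (hm : IsEffectiveMono β)
    {Δ : H.D →+ Tens (RingHom.id S) (RingHom.id S) H.D H.D}
    (hΔ : ∀ c, H.inclDD (Δ c) = H.comulD (H.ιD c)) {ε : H.D →+ S}
    (hε : ∀ c, β (ε c) = H.ev' (H.ιD c)) : LeftEntwinedModule (entwiningD E hp hm hΔ hε) T where
  coact := (E.retr T).comp H.γ'
  left_lin r x := by
    rw [AddMonoidHom.comp_apply, AddMonoidHom.comp_apply, H.γ'_left, E.retr_left]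
  coassoc x := by
    apply assoc.symm.injective
    rw [AddEquiv.symm_apply_apply]
    symm
    apply map_inclDD_injective E T
    have hr : RightLin (RingHom.id S) β (H.comulD.comp H.ιD) := fun r c => by
      rw [AddMonoidHom.comp_apply, AddMonoidHom.comp_apply, H.ιD_right, H.comulD_right]
    refine (map_assoc_symm (H.inclD_left T) H.inclDD_right _).symm.trans (Eq.trans ?_
      (map_comp (f'' := H.comulD.comp H.ιD) (g'' := AddMonoidHom.id T) hr (leftLin_id _)
        hΔ (fun _ => rfl) _).symm)
    refine Eq.trans ?_ (map_comp (f := H.ιD) (g := AddMonoidHom.id T) (g' := AddMonoidHom.id _)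
      hr (leftLin_id _) (hf := H.ιD_right) (hg := leftLin_id _) (hg' := leftLin_id β)
      (hf' := H.comulD_right) (fun _ => rfl) (fun _ => rfl) _)
    refine Eq.trans ?_ (congrArg _ (E.inclD_retr_γ' x)).symm
    rw [γ'_comulD, ← E.inclD_retr_γ' x]
    congr 1
    exact (map_comp H.ιD_right H.γ'_left (fun _ => rfl) E.inclD_retr_γ' _).trans
      (map_comp H.ιD_right H.γ'_left (fun _ => rfl) (fun _ => rfl) _).symm
  counit x := by
    refine (lid_counit hε _ T _).trans ?_
    rw [AddMonoidHom.comp_apply, E.inclD_retr_γ']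
    -- The counit law of the comodule is the herd's `ev'` law followed by the action of `B`.
    exact (congrArg (lact β T) (H.ev'_γ x)).trans (lact_unit x)
  entwined a x := E.inclD_injective T <| by
    refine Eq.trans ?_ (E.inclD_leftEntwinedAct T _ a).symm
    rw [AddMonoidHom.comp_apply, AddMonoidHom.comp_apply, E.inclD_retr_γ', E.inclD_retr_γ', entD_γ']

theorem exists_entwining_left (E : H.LiftD) (hp : H.IsPureD) (hm : IsEffectiveMono β) :
    Function.Injective H.inclDD ∧ Function.Injective (H.inclD B) ∧
      Function.Injective (H.inclD T) ∧
      ∃ 𝒟 : Coring S H.D,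
        (∀ c : H.D, H.inclDD (𝒟.comul c) = H.comulD (H.ιD c)) ∧
        (∀ c : H.D, β (𝒟.counit c) = H.ev' (H.ιD c)) ∧
        ∃ E : LeftEntwining β 𝒟,
          (∀ (b : B) (d : H.D), H.inclD B (E.φ (Tens.tmul β (RingHom.id S) b d)) =
            H.ξD (b • H.ιD d)) ∧
          ∃ M : LeftEntwinedModule E T, ∀ x : T, H.inclD T (M.coact x) = H.γ' x := by
  obtain ⟨Δ, hΔ⟩ := exists_lift_of_injective (inclDD_injective E hp) (H.comulD.comp H.ιD)
    (exists_inclDD_eq_comulD E hp)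
  obtain ⟨ε, hε⟩ := H.exists_counitD hm
  exact ⟨inclDD_injective E hp, E.inclD_injective B, E.inclD_injective T,
    coringD E hp hm hΔ hε, hΔ, hε, entwiningD E hp hm hΔ hε, E.inclD_φ, moduleD E hp hm hΔ hε,
    E.inclD_retr_γ'⟩

theorem entwining_left (H : Herd α β T T')
    (h : (LeftFaithfullyFlat β T ∧ (LeftFaithfullyFlat β B ∨ RightFaithfullyFlat β B)) ∨
      SplitExtension β) :
    Function.Injective H.inclDD ∧ Function.Injective (H.inclD B) ∧
      Function.Injective (H.inclD T) ∧
      ∃ 𝒟 : Coring S H.D,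
        (∀ c : H.D, H.inclDD (𝒟.comul c) = H.comulD (H.ιD c)) ∧
        (∀ c : H.D, β (𝒟.counit c) = H.ev' (H.ιD c)) ∧
        ∃ E : LeftEntwining β 𝒟,
          (∀ (b : B) (d : H.D), H.inclD B (E.φ (Tens.tmul β (RingHom.id S) b d)) =
            H.ξD (b • H.ιD d)) ∧
          ∃ M : LeftEntwinedModule E T, ∀ x : T, H.inclD T (M.coact x) = H.γ' x := by
  rcases h with ⟨hT, hA⟩ | hs
  · obtain ⟨E⟩ := liftD_of_flat (H := H) hT
    exact exists_entwining_left E (isPureD_of_flat hT)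
      (hA.elim (fun h => h.isEffectiveMono) fun h => h.isEffectiveMono)
  · obtain ⟨E⟩ := H.liftD_of_split hs
    exact exists_entwining_left E (H.isPureD_of_split hs) hs.isEffectiveMono

end Herd

end BimoduleHerd

end

theorem mainTheorem2 {R S A B T T' : Type u} [Ring R] [Ring S] [Ring A] [Ring B]
    (α : R →+* A) (β : S →+* B)
    [AddCommGroup T] [Module B T] [Module Aᵐᵒᵖ T] [SMulCommClass B Aᵐᵒᵖ T]
    [AddCommGroup T'] [Module A T'] [Module Bᵐᵒᵖ T'] [SMulCommClass A Bᵐᵒᵖ T']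
    (H : Herd α β T T') :
    (((RightFaithfullyFlat α T ∧ (RightFaithfullyFlat α A ∨ LeftFaithfullyFlat α A)) ∨
        SplitExtension α) →
      Function.Injective H.inclCC ∧ Function.Injective (H.inclC A) ∧
      Function.Injective (H.inclC T) ∧
      ∃ 𝒞 : Coring R H.C,
        (∀ c : H.C, H.inclCC (𝒞.comul c) = H.comulC (H.ιC c)) ∧
        (∀ c : H.C, α (𝒞.counit c) = H.ev (H.ιC c)) ∧
        ∃ E : RightEntwining α 𝒞,
          (∀ (c : H.C) (a : A), H.inclC A (E.ψ (Tens.tmul (RingHom.id R) α c a)) =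
            H.ξC (op a • H.ιC c)) ∧
          ∃ M : RightEntwinedModule E T, ∀ x : T, H.inclC T (M.coact x) = H.γ x) ∧
    (((LeftFaithfullyFlat β T ∧ (LeftFaithfullyFlat β B ∨ RightFaithfullyFlat β B)) ∨
        SplitExtension β) →
      Function.Injective H.inclDD ∧ Function.Injective (H.inclD B) ∧
      Function.Injective (H.inclD T) ∧
      ∃ 𝒟 : Coring S H.D,
        (∀ d : H.D, H.inclDD (𝒟.comul d) = H.comulD (H.ιD d)) ∧
        (∀ d : H.D, β (𝒟.counit d) = H.ev' (H.ιD d)) ∧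
        ∃ E : LeftEntwining β 𝒟,
          (∀ (b : B) (d : H.D), H.inclD B (E.φ (Tens.tmul β (RingHom.id S) b d)) =
            H.ξD (b • H.ιD d)) ∧
          ∃ M : LeftEntwinedModule E T, ∀ x : T, H.inclD T (M.coact x) = H.γ' x) :=
  ⟨H.entwining_right, H.entwining_left⟩
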